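/- Let $n\ge 1$. A cylinder is a set $\{x=(x',x_n)\in\mathbb R^{n-1}\times\mathbb R:\ |x'-c'|<R,\ |x_n-c_n|<h\}$ with $R,h>0$ and $c\in\mathbb R^n$. For an open set $\Omega\subseteq\mathbb R^n$ and a continuous $w:\Omega\to[-1,1]$ put $$\Omega_{\rm in}(w)=\{x\in\Omega:|w(x)|<1\},\qquad F^{\pm}(w)=\partial\{w=\pm1\}\cap\Omega .$$ Such a $w$ is a classical supersolution (respectively subsolution) in $\Omega$ if $w$ is $C^2$ on $\Omega_{\rm in}(w)$ and up to the free boundary (it agrees on $\overline{\Omega_{\rm in}(w)}\cap\Omega$ with a $C^2$ function defined in a neighbourhood of this set, and $\nabla w$ on $F^\pm(w)$ means the gradient of that function), $\Delta w\le 0$ (respectively $\Delta w\ge 0$) in $\Omega_{\rm in}(w)$, the sets $F^+(w)$ and $F^-(w)$ are (possibly empty) $C^2$ hypersurfaces, and $$0<|\nabla w|\le 1\ (\text{resp. } |\nabla w|\ge 1)\ \text{ on } F^-(w),\qquad |\nabla w|\ge 1\ (\text{resp. } |\nabla w|\le 1)\ \text{ on } F^+(w).$$ Let $\Omega$ be a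 cylinder, and let $V$ be a classical subsolution and $W$ a classical supersolution in $\Omega$ with $V\le W$. The pair $(V,W)$ is nicely intertwined in $\Omega$ if $$F^+(W)\subset\Omega_{\rm in}(V)\quad\text{and}\quad F^-(V)\subset\Omega_{\rm in}(W).$$ Let $S(\Omega)=\{v\in H^1(\Omega): V\le v\le W \text{ a.e.}\}$ and $I(v,\Omega)=\int_\Omega |\nabla v|^2+\mathbf 1_{\{|v|<1\}}$. **Proposition.** Let $D\Subset D'\Subset\Omega$ be cylinders, let $(V,W)$ be nicely intertwined in $\Omega$, and let $u\in S(\Omega)$ satisfy $I(u,\Omega)=\min_{v\in S(\Omega)}I(v,\Omega)$. Then there are $\delta,L>0$ and $\Lambda<\infty$ such that $$\operatorname{dist}(\partial D,\partial D')\ge\delta,\qquad \operatorname{dist}\big(F^+(W)\cap D',\,F^-(V)\cap D'\big)\ge L,\qquad V \text{ and } W \text{ are } \Lambda\text{-Lipschitz in } D'$$ (the distance to an empty set being $+\infty$), and for all such $\delta,L,\Lambda$ one has $|\nabla u|\le K$ a.e. in $D$, with a constant $K=K(n,\delta,L,\Lambda)$ that depends only on $n,\delta,L,\Lambda$. Moreover,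 $u$ agrees a.e. in $D$ with a function that is Lipschitz continuous on $D$ with constant $K$. -/

import Mathlib

open Set MeasureTheory Topology
open scoped NNReal ENNReal ContDiff Laplacian Gradient

namespace TwoPhase

/-- Euclidean space of dimension `n = m + 1`; a point is `x = (x', x_n)`, where `x'` consists of
the first `m` coordinates and `x_n` is the last one. -/
abbrev Space (m : ℕ) := EuclideanSpace ℝ (Fin (m + 1))

/-- The open vertical right cylinder `{|x' - c'| < R, |x_n - c_n| < h}`. -/
def cylinder {m : ℕ} (c : Space m) (R h : ℝ) : Set (Space m) :=
  {x | √(∑ i : Fin m, (x i.castSucc - c i.castSucc) ^ 2) < R ∧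
    |x (Fin.last m) - c (Fin.last m)| < h}

/-- `S` is a (nonempty, bounded, vertical, right) cylinder. -/
def IsCylinder {m : ℕ} (S : Set (Space m)) : Prop :=
  ∃ c R h, 0 < R ∧ 0 < h ∧ S = cylinder c R h

section Phases

variable {m : ℕ} (Ω : Set (Space m)) (w : Space m → ℝ)

/-- The interphase `Ω_in(w) = {x ∈ Ω : |w(x)| < 1}`. -/
def innerPhase : Set (Space m) := {x | x ∈ Ω ∧ |w x| < 1}

/-- `F⁺(w) = ∂{w = 1} ∩ Ω`. -/
def freeBdryPos : Set (Space m) := frontier {x | x ∈ Ω ∧ w x = 1} ∩ Ω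

/-- `F⁻(w) = ∂{w = -1} ∩ Ω`. -/
def freeBdryNeg : Set (Space m) := frontier {x | x ∈ Ω ∧ w x = -1} ∩ Ω

end Phases

/-- `S` is an embedded hypersurface of class `C²` (possibly empty, possibly disconnected): near
each of its points it is a regular level set of a `C²` function. -/
def IsC2Surface {m : ℕ} (S : Set (Space m)) : Prop :=
  ∀ p ∈ S, ∃ (U : Set (Space m)) (φ : Space m → ℝ), IsOpen U ∧ p ∈ U ∧ ContDiffOn ℝ 2 φ U ∧
    (∀ x ∈ U, ∇ φ x ≠ 0) ∧ S ∩ U = {x | x ∈ U ∧ φ x = 0}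

/-- `g` is a `C²` extension of `w` from the closure of `Ω_in(w)` relative to `Ω` to an open
neighbourhood of that closure. The existence of such a `g` says that `w` is `C²` up to the
free boundary; on the free boundary `∇ g` is the one-sided gradient of `w`, i.e. the limit of
`∇ w` from within `Ω_in(w)`, and so does not depend on the choice of `g`. -/
def IsC2Extension {m : ℕ} (Ω : Set (Space m)) (w g : Space m → ℝ) : Prop :=
  ∃ U : Set (Space m), IsOpen U ∧ Ω ∩ closure (innerPhase Ω w) ⊆ U ∧ ContDiffOn ℝ 2 g U ∧
    EqOn g w (Ω ∩ closure (innerPhase Ω w))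

/-- Classical supersolutions, in `Ω`, of the free boundary problem
`Δ w = 0` in `{|w| < 1}`, `|∇ w| = 1` on the free boundary, for functions with values in
`[-1, 1]`. -/
structure IsClassicalSupersolution {m : ℕ} (Ω : Set (Space m)) (w : Space m → ℝ) : Prop where
  continuousOn : ContinuousOn w Ω
  mem_Icc : ∀ x ∈ Ω, w x ∈ Icc (-1 : ℝ) 1
  laplacian_nonpos : ∀ x ∈ innerPhase Ω w, Δ w x ≤ 0
  surface_pos : IsC2Surface (freeBdryPos Ω w)
  surface_neg : IsC2Surface (freeBdryNeg Ω w)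
  gradient : ∃ g, IsC2Extension Ω w g ∧
    (∀ x ∈ freeBdryNeg Ω w, 0 < ‖∇ g x‖ ∧ ‖∇ g x‖ ≤ 1) ∧
    (∀ x ∈ freeBdryPos Ω w, 1 ≤ ‖∇ g x‖)

/-- Classical subsolutions, in `Ω`, of the same free boundary problem. -/
structure IsClassicalSubsolution {m : ℕ} (Ω : Set (Space m)) (w : Space m → ℝ) : Prop where
  continuousOn : ContinuousOn w Ω
  mem_Icc : ∀ x ∈ Ω, w x ∈ Icc (-1 : ℝ) 1
  laplacian_nonneg : ∀ x ∈ innerPhase Ω w, 0 ≤ Δ w x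
  surface_pos : IsC2Surface (freeBdryPos Ω w)
  surface_neg : IsC2Surface (freeBdryNeg Ω w)
  gradient : ∃ g, IsC2Extension Ω w g ∧
    (∀ x ∈ freeBdryNeg Ω w, 1 ≤ ‖∇ g x‖) ∧
    (∀ x ∈ freeBdryPos Ω w, ‖∇ g x‖ ≤ 1)

/-- The pair `(V, W)` is nicely intertwined in `Ω`. -/
def NicelyIntertwined {m : ℕ} (Ω : Set (Space m)) (V W : Space m → ℝ) : Prop :=
  freeBdryPos Ω W ⊆ innerPhase Ω V ∧ freeBdryNeg Ω V ⊆ innerPhase Ω W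

/-- `u ∈ H¹(Ω)` and `G ∈ L²(Ω)` is its weak gradient. -/
structure MemH1 {m : ℕ} (Ω : Set (Space m)) (u : Space m → ℝ) (G : Space m → Space m) :
    Prop where
  memLp : MemLp u 2 (volume.restrict Ω)
  memLp_grad : MemLp G 2 (volume.restrict Ω)
  weak_grad : ∀ φ : Space m → ℝ, ContDiff ℝ ∞ φ → HasCompactSupport φ → tsupport φ ⊆ Ω →
    ∀ e : Space m, ∫ x in Ω, u x * fderiv ℝ φ x e = - ∫ x in Ω, φ x * inner ℝ (G x) e

/-- The energy `I(u, Ω) = ∫_Ω |∇u|² + 1_{|u| < 1}` of a function `u` with weak gradient `G`. -/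
noncomputable def energy {m : ℕ} (Ω : Set (Space m)) (u : Space m → ℝ)
    (G : Space m → Space m) : ℝ :=
  ∫ x in Ω, (‖G x‖ ^ 2 + {y | |u y| < 1}.indicator (fun _ => (1 : ℝ)) x)

/-- `u` belongs to `S(Ω) = {v ∈ H¹(Ω) : V ≤ v ≤ W a.e.}` and has weak gradient `G`. -/
def Admissible {m : ℕ} (Ω : Set (Space m)) (V W u : Space m → ℝ) (G : Space m → Space m) :
    Prop :=
  MemH1 Ω u G ∧ ∀ᵐ x ∂(volume.restrict Ω), V x ≤ u x ∧ u x ≤ W x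

/-- `u`, with weak gradient `G`, minimizes the energy over `S(Ω)`. -/
def IsConstrainedMinimizer {m : ℕ} (Ω : Set (Space m)) (V W u : Space m → ℝ)
    (G : Space m → Space m) : Prop :=
  Admissible Ω V W u G ∧
    ∀ (v : Space m → ℝ) (H : Space m → Space m), Admissible Ω V W v H →
      energy Ω u G ≤ energy Ω v H

/-- `δ > 0` is a lower bound for `dist(∂D, ∂D')`, `L > 0` is a lower bound for
`dist(F⁺(W) ∩ D', F⁻(V) ∩ D')` (any `L > 0` if one of these sets is empty), and `Λ` is a common
Lipschitz constant of `V` and `W` in `D'`. -/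
structure ControlledBy {m : ℕ} (Ω D' D : Set (Space m)) (V W : Space m → ℝ)
    (δ L : ℝ) (Λ : ℝ≥0) : Prop where
  dist_pos : 0 < δ
  dist_le : ∀ x ∈ frontier D, ∀ y ∈ frontier D', δ ≤ dist x y
  separation_pos : 0 < L
  separation_le : ∀ x ∈ freeBdryPos Ω W ∩ D', ∀ y ∈ freeBdryNeg Ω V ∩ D', L ≤ dist x y
  lipschitz_V : LipschitzOnWith Λ V D'
  lipschitz_W : LipschitzOnWith Λ W D'

end TwoPhase

/-!
The proof is a regularity argument for the representative of `u` that is the limit of its averages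
over small balls.

*Reduction to one phase.* A ball about a point of `D` whose radius is at most `δ` and `L / 2` lies
in `D'`, and it cannot meet both `{W = 1}` and `{V = -1}`: a segment joining these sets crosses
`F⁺(W)` and then `F⁻(V)`, at points less than `L` apart (`forall_lt_one_or_forall_neg_one_lt`). The
exception is the case in which both sets contain a common point. Since the obstacles are
intertwined, the set of common points is open and closed in `Ω`, so `V = -1` and `W = 1` throughout,
the constant `1` competes with energy zero, and the weak gradient of `u` vanishes. Otherwise, after
the reflection `(V, W, u) ↦ (-W, -V, -u)` if need be, one has `W < 1` in the ball, and only the phase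
`{u = -1}` occurs there (`OnePhase`).

*Variations.* The competitor `u + min (t φ, W - u)`, with a test function `φ ≥ 0`, respects the
obstacle, and truncating `t φ` costs nothing because `W` is weakly superharmonic
(`IsConstrainedMinimizer.variation_up`). Applied to `-u`, whose upper obstacle is `-V`, it shows that
`u` is weakly subharmonic; applied to `u` near points with `W > -1`, it bounds the mass of the
Laplacian of `u` in a ball of radius `r` by a multiple of `r ^ (n - 1)`, and it shows that `u` is
harmonic where `u > -1`. The weak subharmonicity of `V` across `{V = -1}` is
`integral_inner_gradient_nonpos_of_laplacian_nonneg`.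

*Averages.* Let `η` be a radial kernel and `Ψ` its potential, `∇Ψ(z) = -η(z) z`. The derivative in
`r` of the average of `u` over the ball of radius `r` is the Laplacian of `u` tested with the
rescaled `Ψ` (`RadialKernel.hasDerivAt_avg`). Hence the averages increase with `r`, they increase at
most linearly where `W > -1`, and they are constant where `u > -1`. If `u + 1` vanishes at `y`, it
therefore grows at most linearly away from `y`: either `W = -1` somewhere near `y` and `u ≤ W` does
it, or the averages about `y` are small and control the values nearby by the sub-mean value property
(`OnePhase.exists_value_add_one_le`). In a ball of radius `d` without zeros, the averages being
constant, the smoothness of `η` gives a Lipschitz bound by a multiple of `(u + 1) / d`, which the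
linear growth makes uniform (`OnePhase.exists_lipschitz_value`).

*Conclusion.* The representative is Lipschitz at a scale that depends only on `δ` and `L`, and at
larger distances `|u| ≤ 1` suffices. Uniqueness of weak gradients turns the Lipschitz bound into the
bound for `∇u`. The constants are chosen before the domains and the functions.
-/

namespace TwoPhase

/-! ### Mollification in `L¹` -/

section Mollification

variable {E : Type*} [NormedAddCommGroup E] [InnerProductSpace ℝ E] [FiniteDimensional ℝ E]
  [MeasurableSpace E] [BorelSpace E]
  {F : Type*} [NormedAddCommGroup F]

open Filter Convolution ContinuousLinearMap

/-- Translations are continuous in `L¹`. -/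
theorem tendsto_lintegral_enorm_translate_sub {f : E → F} (hf : Integrable f) :
    Tendsto (fun y : E => ∫⁻ x, ‖f (x - y) - f x‖ₑ) (𝓝 0) (𝓝 0) := by
  have hf1 : MemLp f 1 := memLp_one_iff_integrable.2 hf
  let g : E → C(E, E) := fun y => ⟨fun x => x - y, by fun_prop⟩
  have hg : Continuous g := by
    refine ContinuousMap.continuous_of_continuous_uncurry _ ?_
    simp only [g, Function.uncurry_def, ContinuousMap.coe_mk]
    fun_prop
  have hgm : ∀ y, MeasurePreserving (g y) (volume : Measure E) volume :=
    fun y => measurePreserving_sub_right _ y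
  have key := Filter.Tendsto.compMeasurePreservingLp (μ := (volume : Measure E))
    (tendsto_const_nhds (x := hf1.toLp f) (f := 𝓝 (0 : E))) (hg.tendsto 0) hgm (hgm 0)
    ENNReal.one_ne_top
  rw [tendsto_iff_edist_tendsto_0] at key
  refine key.congr fun y => ?_
  rw [Lp.toLp_compMeasurePreserving, Lp.toLp_compMeasurePreserving, Lp.edist_toLp_toLp,
    eLpNorm_one_eq_lintegral_enorm]
  simp [g]

theorem tendsto_eLpNorm_mollify_sub [NormedSpace ℝ F] [CompleteSpace F] {f : E → F}
    (hf : Integrable f) {φ : ℕ → ContDiffBump (0 : E)}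
    (hφ : Tendsto (fun k => (φ k).rOut) atTop (𝓝 0)) :
    Tendsto (fun k => eLpNorm (((φ k).normed volume ⋆[lsmul ℝ ℝ, volume] f) - f) 1 volume)
      atTop (𝓝 0) := by
  have hT := tendsto_lintegral_enorm_translate_sub hf
  rw [ENNReal.tendsto_nhds_zero] at hT ⊢
  intro ε hε
  obtain ⟨r, hr, hball⟩ := Metric.eventually_nhds_iff_ball.1 (hT ε hε)
  filter_upwards [hφ.eventually (gt_mem_nhds hr)] with k hk
  rw [eLpNorm_one_eq_lintegral_enorm]
  set ρ := (φ k).normed (volume : Measure E) with hρ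
  have hρc : Continuous ρ := (φ k).continuous_normed
  have hρi : Integrable ρ := (φ k).integrable_normed
  have hint : ∫ t, ρ t = 1 := (φ k).integral_normed
  have hmeas : AEStronglyMeasurable (fun p : E × E => ρ p.2 • (f (p.1 - p.2) - f p.1))
      ((volume : Measure E).prod volume) := by
    have h1 := (hρi.convolution_integrand (lsmul ℝ ℝ) hf).aestronglyMeasurable
    have h2 : AEStronglyMeasurable (fun p : E × E => ρ p.2 • f p.1)
      ((volume : Measure E).prod volume) :=
      (hρc.comp continuous_snd).aestronglyMeasurable.smul hf.aestronglyMeasurable.comp_fst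
    refine (h1.sub h2).congr (Eventually.of_forall fun p => ?_)
    simp [smul_sub]
  have hpt : ∀ᵐ x, ‖((ρ ⋆[lsmul ℝ ℝ, volume] f) - f) x‖ₑ
      ≤ ∫⁻ t, ‖ρ t • (f (x - t) - f x)‖ₑ := by
    filter_upwards [hρi.ae_convolution_exists (lsmul ℝ ℝ) hf] with x hx
    refine le_trans (le_of_eq ?_) (enorm_integral_le_lintegral_enorm _)
    congr 1
    simp only [Pi.sub_apply, convolution_def, lsmul_apply, smul_sub]
    rw [integral_sub (by simpa using hx.integrable) (hρi.smul_const _), integral_smul_const, hint,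
      one_smul]
  calc ∫⁻ x, ‖((ρ ⋆[lsmul ℝ ℝ, volume] f) - f) x‖ₑ
      ≤ ∫⁻ x, ∫⁻ t, ‖ρ t • (f (x - t) - f x)‖ₑ := lintegral_mono_ae hpt
    _ = ∫⁻ t, ∫⁻ x, ‖ρ t • (f (x - t) - f x)‖ₑ := lintegral_lintegral_swap hmeas.enorm
    _ ≤ ∫⁻ t, ‖ρ t‖ₑ * ε := by
        refine lintegral_mono fun t => ?_
        simp only [enorm_smul]
        by_cases ht : t ∈ Metric.ball (0 : E) (φ k).rOut
        · rw [lintegral_const_mul' _ _ enorm_ne_top]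
          gcongr
          exact hball t (Metric.ball_subset_ball hk.le ht)
        · have : ρ t = 0 := by
            rw [← (φ k).support_normed_eq (μ := volume)] at ht
            simpa using ht
          simp [this]
    _ = ε := by
        rw [lintegral_mul_const _ hρc.enorm.measurable]
        have : ∫⁻ t, ‖ρ t‖ₑ = 1 := by
          rw [← ofReal_integral_norm_eq_lintegral_enorm hρi]
          have : ∀ t, ‖ρ t‖ = ρ t := fun t => Real.norm_of_nonneg ((φ k).nonneg_normed t)
          simp [this, hint]
        rw [this, one_mul]

/-- The product of an `L¹`-convergent sequence with a bounded, almost everywhere convergent one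
converges in the mean. -/
theorem tendsto_integral_mul_of_tendsto_eLpNorm {α : Type*} [MeasurableSpace α] {μ : Measure α}
    {f : ℕ → α → ℝ} {f₀ : α → ℝ} {g : ℕ → α → ℝ} {g₀ : α → ℝ} {C : ℝ}
    (hf : ∀ k, Integrable (f k) μ) (hf₀ : Integrable f₀ μ)
    (hlim : Tendsto (fun k => eLpNorm (f k - f₀) 1 μ) atTop (𝓝 0))
    (hg : ∀ k, AEStronglyMeasurable (g k) μ) (hgC : ∀ k x, |g k x| ≤ C)
    (hglim : ∀ᵐ x ∂μ, Tendsto (fun k => g k x) atTop (𝓝 (g₀ x))) :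
    Tendsto (fun k => ∫ x, g k x * f k x ∂μ) atTop (𝓝 (∫ x, g₀ x * f₀ x ∂μ)) := by
  have h1 : Tendsto (fun k => ∫ x, g k x * f₀ x ∂μ) atTop (𝓝 (∫ x, g₀ x * f₀ x ∂μ)) := by
    refine tendsto_integral_of_dominated_convergence (fun x => C * ‖f₀ x‖)
      (fun k => (hg k).mul hf₀.aestronglyMeasurable) (hf₀.norm.const_mul C) (fun k => ?_) ?_
    · refine Eventually.of_forall fun x => ?_
      rw [norm_mul]
      exact mul_le_mul_of_nonneg_right (hgC k x) (norm_nonneg _)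
    · filter_upwards [hglim] with x hx using hx.mul_const _
  have hC : ∀ k, ∀ᵐ x ∂μ, ‖g k x‖ ≤ C := fun k => Eventually.of_forall (hgC k)
  have h2 : Tendsto (fun k => ∫ x, g k x * (f k x - f₀ x) ∂μ) atTop (𝓝 0) := by
    have h3 : Tendsto (fun k => C * ∫ x, ‖f k x - f₀ x‖ ∂μ) atTop (𝓝 0) := by
      have : Tendsto (fun k => ∫ x, ‖f k x - f₀ x‖ ∂μ) atTop (𝓝 0) := by
        have := (ENNReal.tendsto_toReal ENNReal.zero_ne_top).comp hlim
        refine this.congr fun k => ?_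
        rw [Function.comp_apply, eLpNorm_one_eq_lintegral_enorm,
          ← integral_norm_eq_lintegral_enorm ((hf k).sub hf₀).aestronglyMeasurable]
        rfl
      simpa using this.const_mul C
    refine squeeze_zero_norm (fun k => ?_) h3
    refine (norm_integral_le_integral_norm _).trans ?_
    rw [← integral_const_mul]
    refine integral_mono (((hf k).sub hf₀).bdd_mul (hg k) (hC k)).norm
      (((hf k).sub hf₀).norm.const_mul C) fun x => ?_
    simp only [norm_mul]
    exact mul_le_mul_of_nonneg_right (hgC k x) (norm_nonneg _)
  have h4 := h1.add h2
  rw [add_zero] at h4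
  refine h4.congr fun k => ?_
  have h5 : Integrable (fun x => f k x - f₀ x) μ := (hf k).sub hf₀
  rw [← integral_add (hf₀.bdd_mul (hg k) (hC k)) (h5.bdd_mul (hg k) (hC k))]
  congr 1
  ext x
  ring

end Mollification

/-! ### Weakly differentiable functions -/

section TestFunctions

variable {E : Type*} [NormedAddCommGroup E] [NormedSpace ℝ E]

theorem hasCompactSupport_fderiv_apply_const {φ : E → ℝ} (h : HasCompactSupport φ) (e : E) :
    HasCompactSupport fun x => fderiv ℝ φ x e :=
  HasCompactSupport.fderiv_apply (𝕜 := ℝ) h e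

theorem continuous_fderiv_apply_const {φ : E → ℝ} (h : ContDiff ℝ 1 φ) (e : E) :
    Continuous fun x => fderiv ℝ φ x e :=
  (h.continuous_fderiv one_ne_zero).clm_apply continuous_const

end TestFunctions

section WeakGradient

variable {E : Type*} [NormedAddCommGroup E] [InnerProductSpace ℝ E] [FiniteDimensional ℝ E]
  [MeasurableSpace E] [BorelSpace E]

open Filter Convolution ContinuousLinearMap

/-- `f ∈ W^{1,1}(E)` and `F` is its weak gradient. -/
structure HasWeakGradient (f : E → ℝ) (F : E → E) : Prop where
  integrable : Integrable f
  integrable_grad : Integrable F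
  weak_grad : ∀ φ : E → ℝ, ContDiff ℝ ∞ φ → HasCompactSupport φ →
    ∀ e : E, ∫ x, f x * fderiv ℝ φ x e = - ∫ x, φ x * inner ℝ (F x) e

theorem integrable_mul_of_hasCompactSupport {f : E → ℝ} (hf : LocallyIntegrable f) {g : E → ℝ}
    (hg : Continuous g) (hgc : HasCompactSupport g) : Integrable (fun x => f x * g x) := by
  simpa [mul_comm] using hf.integrable_smul_left_of_hasCompactSupport hg hgc

namespace HasWeakGradient

variable {f g : E → ℝ} {F G : E → E}

theorem add (hf : HasWeakGradient f F) (hg : HasWeakGradient g G) :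
    HasWeakGradient (fun x => f x + g x) (fun x => F x + G x) where
  integrable := hf.integrable.add hg.integrable
  integrable_grad := hf.integrable_grad.add hg.integrable_grad
  weak_grad φ hφ hc e := by
    have h1 := (hφ.of_le (by simp) : ContDiff ℝ 1 φ)
    have hd := continuous_fderiv_apply_const h1 e
    have hdc := hasCompactSupport_fderiv_apply_const hc e
    have hi : ∀ {H : E → E}, Integrable H → Integrable fun x => φ x * inner ℝ (H x) e := by
      intro H hH
      simpa [mul_comm] using integrable_mul_of_hasCompactSupport
        (hH.inner_const e).locallyIntegrable hφ.continuous hc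
    simp only [add_mul, inner_add_left, mul_add]
    rw [integral_add (integrable_mul_of_hasCompactSupport hf.integrable.locallyIntegrable hd hdc)
      (integrable_mul_of_hasCompactSupport hg.integrable.locallyIntegrable hd hdc),
      integral_add (hi hf.integrable_grad) (hi hg.integrable_grad),
      hf.weak_grad φ hφ hc e, hg.weak_grad φ hφ hc e]
    ring

theorem const_mul (hf : HasWeakGradient f F) (c : ℝ) :
    HasWeakGradient (fun x => c * f x) (fun x => c • F x) where
  integrable := hf.integrable.const_mul c
  integrable_grad := hf.integrable_grad.smul c
  weak_grad φ hφ hc e := by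
    simp only [mul_assoc, integral_const_mul, hf.weak_grad φ hφ hc e, inner_smul_left,
      mul_left_comm _ c, RCLike.conj_to_real]
    ring

theorem neg (hf : HasWeakGradient f F) : HasWeakGradient (fun x => - f x) (fun x => - F x) := by
  simpa using hf.const_mul (-1)

theorem sub (hf : HasWeakGradient f F) (hg : HasWeakGradient g G) :
    HasWeakGradient (fun x => f x - g x) (fun x => F x - G x) := by
  simpa [sub_eq_add_neg] using hf.add hg.neg

theorem of_contDiff {φ : E → ℝ} (hφ : ContDiff ℝ 1 φ) (hc : HasCompactSupport φ) :
    HasWeakGradient φ (∇ φ) where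
  integrable := hφ.continuous.integrable_of_hasCompactSupport hc
  integrable_grad := by
    have h1 : Continuous (∇ φ) :=
      (InnerProductSpace.toDual ℝ E).symm.continuous.comp (hφ.continuous_fderiv one_ne_zero)
    refine h1.integrable_of_hasCompactSupport ((hc.fderiv (𝕜 := ℝ)).mono' ?_)
    intro x hx
    refine subset_tsupport _ fun h => hx ?_
    simp only [gradient]
    rw [h, map_zero]
  weak_grad ψ hψ hψc e := by
    have hψ1 := (hψ.of_le (by simp) : ContDiff ℝ 1 ψ)
    rw [integral_mul_fderiv_eq_neg_fderiv_mul_of_integrable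
      (((hφ.continuous_fderiv one_ne_zero).clm_apply continuous_const).mul
        hψ.continuous |>.integrable_of_hasCompactSupport hψc.mul_left)
      (hφ.continuous.mul (continuous_fderiv_apply_const hψ1 e)
        |>.integrable_of_hasCompactSupport hc.mul_right)
      (hφ.continuous.mul hψ.continuous |>.integrable_of_hasCompactSupport hψc.mul_left)
      (fun x _ => hφ.differentiable one_ne_zero x) (fun x _ => hψ1.differentiable one_ne_zero x)]
    congr 2
    ext x
    rw [mul_comm]
    congr 1
    rw [gradient, InnerProductSpace.toDual_symm_apply]

/-- The gradient of a mollification is the mollification of the weak gradient. -/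
theorem fderiv_mollify (hf : HasWeakGradient f F) (φ : ContDiffBump (0 : E)) (x e : E) :
    fderiv ℝ (φ.normed volume ⋆[lsmul ℝ ℝ, volume] f) x e
      = inner ℝ ((φ.normed volume ⋆[lsmul ℝ ℝ, volume] F) x) e := by
  set ρ := φ.normed (volume : Measure E) with hρ
  have hρs : ContDiff ℝ ∞ ρ := φ.contDiff_normed
  have hρs1 : ContDiff ℝ 1 ρ := hρs.of_le (by simp)
  have hρc : HasCompactSupport ρ := φ.hasCompactSupport_normed
  have hl := hf.integrable.locallyIntegrable
  rw [(hρc.hasFDerivAt_convolution_left (lsmul ℝ ℝ) hρs1 hl x).fderiv,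
    convolution_eq_swap, convolution_eq_swap]
  have hi1 : Integrable fun t => ((precompL E (lsmul ℝ ℝ)) (fderiv ℝ ρ (x - t))) (f t) := by
    have := (HasCompactSupport.convolutionExists_left (precompL E (lsmul ℝ ℝ))
      (hρc.fderiv (𝕜 := ℝ)) (hρs1.continuous_fderiv one_ne_zero) hl x).integrable_swap
    simpa using this
  have hi2 : Integrable fun t => ((lsmul ℝ ℝ) (ρ (x - t))) (F t) := by
    have := (HasCompactSupport.convolutionExists_left (lsmul ℝ ℝ)
      hρc hρs.continuous hf.integrable_grad.locallyIntegrable x).integrable_swap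
    simpa using this
  have key := hf.weak_grad (fun y => ρ (x - y)) (hρs.comp (contDiff_const.sub contDiff_id))
    (hρc.comp_homeomorph (Homeomorph.subLeft x)) e
  have hd : ∀ y, fderiv ℝ (fun y => ρ (x - y)) y e = - fderiv ℝ ρ (x - y) e := by
    intro y
    have h1 : HasFDerivAt ρ (fderiv ℝ ρ (x - y)) (x - y) :=
      (hρs1.differentiable one_ne_zero _).hasFDerivAt
    have h2 : HasFDerivAt (fun y : E => x - y) (-ContinuousLinearMap.id ℝ E) y := by
      simpa using (hasFDerivAt_id y).const_sub x
    have := (h1.comp y h2).fderiv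
    simp only [Function.comp_def] at this
    rw [this]
    simp
  simp only [hd] at key
  rw [integral_apply hi1]
  rw [real_inner_comm, ← integral_inner hi2]
  simp only [precompL_apply, lsmul_apply, smul_eq_mul, inner_smul_right]
  simp only [mul_neg, integral_neg, neg_inj] at key
  simp only [real_inner_comm] at key ⊢
  rw [← key]
  congr 1
  ext t
  ring

/-- The chain rule, for a `C¹` function with bounded derivative. -/
theorem comp (hf : HasWeakGradient f F) {h h' : ℝ → ℝ} (hh : ∀ s, HasDerivAt h (h' s) s)
    (hc : Continuous h') (hb : ∀ s, |h' s| ≤ 1) (h0 : h 0 = 0) :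
    HasWeakGradient (fun x => h (f x)) (fun x => h' (f x) • F x) := by
  have hcont : Continuous h := continuous_iff_continuousAt.2 fun s => (hh s).continuousAt
  have hlip : ∀ s t, |h s - h t| ≤ |s - t| := by
    intro s t
    have := convex_univ.norm_image_sub_le_of_norm_hasDerivWithin_le (f := h) (C := 1)
      (fun x _ => (hh x).hasDerivWithinAt) (fun x _ => hb x) (mem_univ t) (mem_univ s)
    simpa using this
  have hcomp : ∀ {g : E → ℝ}, Integrable g → Integrable fun x => h (g x) := by
    intro g hg
    refine hg.mono (hcont.comp_aestronglyMeasurable hg.aestronglyMeasurable)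
      (Eventually.of_forall fun x => ?_)
    simpa [h0] using hlip (g x) 0
  refine ⟨hcomp hf.integrable, ?_, fun ψ hψ hψc e => ?_⟩
  · refine hf.integrable_grad.mono ((hc.comp_aestronglyMeasurable
      hf.integrable.aestronglyMeasurable).smul hf.integrable_grad.aestronglyMeasurable)
      (Eventually.of_forall fun x => ?_)
    rw [norm_smul]
    exact mul_le_of_le_one_left (norm_nonneg _) (hb _)
  let φ : ℕ → ContDiffBump (0 : E) := fun k =>
    ⟨1 / ((k : ℝ) + 1) / 2, 1 / ((k : ℝ) + 1), by positivity, half_lt_self (by positivity)⟩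
  have hφ : Tendsto (fun k => (φ k).rOut) atTop (𝓝 0) := tendsto_one_div_add_atTop_nhds_zero_nat
  let fk : ℕ → E → ℝ := fun k => (φ k).normed volume ⋆[lsmul ℝ ℝ, volume] f
  let Fk : ℕ → E → E := fun k => (φ k).normed volume ⋆[lsmul ℝ ℝ, volume] F
  have hfki : ∀ k, Integrable (fk k) := fun k =>
    (φ k).integrable_normed.integrable_convolution _ hf.integrable
  have hFki : ∀ k, Integrable (Fk k) := fun k =>
    (φ k).integrable_normed.integrable_convolution _ hf.integrable_grad
  have hfl : Tendsto (fun k => eLpNorm (fk k - f) 1 volume) atTop (𝓝 0) :=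
    tendsto_eLpNorm_mollify_sub hf.integrable hφ
  have hFl : Tendsto (fun k => eLpNorm (Fk k - F) 1 volume) atTop (𝓝 0) :=
    tendsto_eLpNorm_mollify_sub hf.integrable_grad hφ
  obtain ⟨ns, hns, hae⟩ := (tendstoInMeasure_of_tendsto_eLpNorm one_ne_zero
    (fun k => (hfki k).aestronglyMeasurable) hf.integrable.aestronglyMeasurable
    hfl).exists_seq_tendsto_ae
  have hfks : ∀ k, ContDiff ℝ 1 (fk k) := fun k =>
    (φ k).hasCompactSupport_normed.contDiff_convolution_left _ (n := 1) (φ k).contDiff_normed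
      hf.integrable.locallyIntegrable
  have hψ1 : ContDiff ℝ 1 ψ := hψ.of_le (by simp)
  have hdψ := continuous_fderiv_apply_const hψ1 e
  have hdψc := hasCompactSupport_fderiv_apply_const hψc e
  -- the identity for the mollified functions
  have hk : ∀ k, ∫ x, h (fk k x) * fderiv ℝ ψ x e
      = - ∫ x, (ψ x * h' (fk k x)) * inner ℝ (Fk k x) e := by
    intro k
    have hd : ∀ x, HasFDerivAt (fun x => h (fk k x)) (h' (fk k x) • fderiv ℝ (fk k) x) x :=
      fun x => (hh (fk k x)).comp_hasFDerivAt x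
        ((hfks k).differentiable one_ne_zero x).hasFDerivAt
    have hfd : ∀ x, fderiv ℝ (fun x => h (fk k x)) x e = h' (fk k x) * inner ℝ (Fk k x) e := by
      intro x
      rw [(hd x).fderiv, smul_apply, hf.fderiv_mollify (φ k) x e]
      rfl
    have hck : Continuous fun x => h (fk k x) := hcont.comp (hfks k).continuous
    have hck' : Continuous fun x => fderiv ℝ (fun x => h (fk k x)) x e := by
      have : ∀ x, fderiv ℝ (fun x => h (fk k x)) x e = h' (fk k x) * fderiv ℝ (fk k) x e := by
        intro x
        rw [(hd x).fderiv, smul_apply, smul_eq_mul]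
      simp only [this]
      exact (hc.comp (hfks k).continuous).mul
        (((hfks k).continuous_fderiv one_ne_zero).clm_apply continuous_const)
    rw [integral_mul_fderiv_eq_neg_fderiv_mul_of_integrable
      (hck'.mul hψ.continuous |>.integrable_of_hasCompactSupport hψc.mul_left)
      (hck.mul hdψ |>.integrable_of_hasCompactSupport hdψc.mul_left)
      (hck.mul hψ.continuous |>.integrable_of_hasCompactSupport hψc.mul_left)
      (fun x _ => (hd x).differentiableAt) (fun x _ => hψ1.differentiable one_ne_zero x)]
    congr 2
    ext x
    rw [hfd]
    ring
  obtain ⟨C, hC⟩ := hψ.continuous.bounded_above_of_compact_support hψc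
  obtain ⟨C', hC'⟩ := hdψ.bounded_above_of_compact_support hdψc
  have hL : Tendsto (fun k => ∫ x, h (fk (ns k) x) * fderiv ℝ ψ x e) atTop
      (𝓝 (∫ x, h (f x) * fderiv ℝ ψ x e)) := by
    have := tendsto_integral_mul_of_tendsto_eLpNorm
      (f := fun k x => h (fk (ns k) x)) (f₀ := fun x => h (f x))
      (g := fun _ x => fderiv ℝ ψ x e) (g₀ := fun x => fderiv ℝ ψ x e) (C := C')
      (fun k => hcomp (hfki (ns k))) (hcomp hf.integrable) ?_
      (fun _ => hdψ.aestronglyMeasurable) (fun _ x => hC' x)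
      (Eventually.of_forall fun x => tendsto_const_nhds)
    · simpa only [mul_comm] using this
    · refine tendsto_of_tendsto_of_tendsto_of_le_of_le tendsto_const_nhds
        (hfl.comp hns.tendsto_atTop) (fun _ => zero_le) fun k => ?_
      exact eLpNorm_mono fun x => hlip _ _
  have hR : Tendsto (fun k => ∫ x, (ψ x * h' (fk (ns k) x)) * inner ℝ (Fk (ns k) x) e) atTop
      (𝓝 (∫ x, (ψ x * h' (f x)) * inner ℝ (F x) e)) := by
    refine tendsto_integral_mul_of_tendsto_eLpNorm (C := C) (fun k => (hFki (ns k)).inner_const e)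
      (hf.integrable_grad.inner_const e) ?_ (fun k => ?_) (fun k x => ?_) ?_
    · have h1 : Tendsto (fun k => ENNReal.ofReal ‖e‖ * eLpNorm (Fk (ns k) - F) 1 volume) atTop
          (𝓝 0) := by
        have := ENNReal.Tendsto.const_mul (a := ENNReal.ofReal ‖e‖)
          (hFl.comp hns.tendsto_atTop) (Or.inr ENNReal.ofReal_ne_top)
        simpa using this
      refine tendsto_of_tendsto_of_tendsto_of_le_of_le tendsto_const_nhds h1
        (fun _ => zero_le) fun k => ?_
      refine eLpNorm_le_mul_eLpNorm_of_ae_le_mul (Eventually.of_forall fun x => ?_) 1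
      simp only [Pi.sub_apply, ← inner_sub_left]
      rw [mul_comm]
      exact norm_inner_le_norm _ _
    · exact (hψ.continuous.mul (hc.comp (hfks (ns k)).continuous)).aestronglyMeasurable
    · rw [abs_mul]
      exact (mul_le_of_le_one_right (abs_nonneg _) (hb _)).trans (hC x)
    · filter_upwards [hae] with x hx
      exact ((hc.tendsto _).comp hx).const_mul _
  have := tendsto_nhds_unique hL ((hR.neg).congr fun k => (hk (ns k)).symm)
  rw [this]
  congr 2
  ext x
  rw [inner_smul_left, mul_assoc]
  rfl

end HasWeakGradient
end WeakGradient

/-! ### Truncation, cutoff functions and integration by parts -/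

theorem exists_cutoff {E : Type*} [NormedAddCommGroup E] [InnerProductSpace ℝ E]
    [FiniteDimensional ℝ E] {K U : Set E} (hK : IsCompact K) (hU : IsOpen U)
    (hKU : K ⊆ U) :
    ∃ χ : E → ℝ, ContDiff ℝ ∞ χ ∧ HasCompactSupport χ ∧ tsupport χ ⊆ U ∧ (∀ x, χ x ∈ Icc 0 1) ∧
      ∀ x ∈ K, χ =ᶠ[𝓝 x] 1 := by
  obtain ⟨K₁, hK₁, h01, h1U⟩ := exists_compact_between hK hU hKU
  obtain ⟨K₂, hK₂, h12, h2U⟩ := exists_compact_between hK₁ hU h1U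
  obtain ⟨χ, hχ, hr, hs, h1⟩ := exists_contMDiff_support_eq_eq_one_iff (n := ⊤)
    (modelWithCornersSelf ℝ E) (isOpen_interior (s := K₂)) hK₁.isClosed h12
  have hts : tsupport χ ⊆ K₂ := by
    rw [tsupport, hs]
    exact closure_minimal interior_subset hK₂.isClosed
  refine ⟨χ, contMDiff_iff_contDiff.1 hχ, hK₂.of_isClosed_subset (isClosed_tsupport χ) hts,
    hts.trans h2U, fun x => hr (mem_range_self x), fun x hx => ?_⟩
  filter_upwards [isOpen_interior.mem_nhds (h01 hx)] with y hy
  exact (h1 y).1 (interior_subset hy)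

section PosPart

variable {E : Type*} [NormedAddCommGroup E] [InnerProductSpace ℝ E] [FiniteDimensional ℝ E]
  [MeasurableSpace E] [BorelSpace E]

open Filter Convolution ContinuousLinearMap

theorem hasDerivAt_max_zero_sq (s : ℝ) : HasDerivAt (fun s : ℝ => max s 0 ^ 2) (2 * max s 0) s := by
  rcases lt_trichotomy s 0 with hs | rfl | hs
  · rw [max_eq_right hs.le, mul_zero]
    refine (hasDerivAt_const s (0 : ℝ)).congr_of_eventuallyEq ?_
    filter_upwards [gt_mem_nhds hs] with t ht
    rw [max_eq_right (le_of_lt ht)]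
    norm_num
  · rw [max_self, mul_zero, hasDerivAt_iff_isLittleO]
    simp only [sub_zero, max_self, smul_zero, ne_eq, OfNat.ofNat_ne_zero, not_false_eq_true,
      zero_pow]
    refine Asymptotics.IsBigO.trans_isLittleO (g := fun s : ℝ => s ^ 2) ?_ ?_
    · refine Asymptotics.IsBigO.of_bound 1 (Eventually.of_forall fun t => ?_)
      simp only [norm_pow, Real.norm_eq_abs, one_mul, sq_abs]
      rcases le_total t 0 with h | h
      · rw [max_eq_right h]; simpa using sq_nonneg t
      · rw [max_eq_left h]
    · exact Asymptotics.isLittleO_pow_id one_lt_two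
  · rw [max_eq_left hs.le]
    have := (hasDerivAt_pow 2 s)
    simp only [Nat.cast_ofNat, Nat.add_one_sub_one, pow_one] at this
    refine this.congr_of_eventuallyEq ?_
    filter_upwards [lt_mem_nhds hs] with t ht
    rw [max_eq_left (le_of_lt ht)]

/-- Weakly differentiable functions are stable under truncation. -/
theorem HasWeakGradient.posPart {f : E → ℝ} {F : E → E} (hf : HasWeakGradient f F) :
    HasWeakGradient (fun x => max (f x) 0) (fun x => {y | 0 < f y}.indicator F x) := by
  have hind : ∀ x, {y | 0 < f y}.indicator F x = (if 0 < f x then (1 : ℝ) else 0) • F x := by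
    intro x
    by_cases h : 0 < f x <;> simp [indicator, h]
  have hstep : Measurable fun s : ℝ => if 0 < s then (1 : ℝ) else 0 :=
    Measurable.ite measurableSet_Ioi measurable_const measurable_const
  have hGm : AEStronglyMeasurable (fun x => {y | 0 < f y}.indicator F x) := by
    simp only [hind]
    exact ((hstep.comp_aemeasurable hf.integrable.aemeasurable).aestronglyMeasurable).smul
      hf.integrable_grad.aestronglyMeasurable
  refine ⟨hf.integrable.pos_part, hf.integrable_grad.mono hGm (Eventually.of_forall fun x => ?_),
    fun ψ hψ hψc e => ?_⟩
  · exact norm_indicator_le_norm_self _ _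
  -- smooth approximations of the positive part
  let κ : ℕ → ℝ := fun k => 1 / ((k : ℝ) + 1)
  have hκ : ∀ k, 0 < κ k := fun k => by positivity
  have hκl : Tendsto κ atTop (𝓝 0) := tendsto_one_div_add_atTop_nhds_zero_nat
  let h : ℕ → ℝ → ℝ := fun k s => √(max s 0 ^ 2 + κ k ^ 2) - κ k
  let h' : ℕ → ℝ → ℝ := fun k s => max s 0 / √(max s 0 ^ 2 + κ k ^ 2)
  have hpos : ∀ k s, 0 < max s 0 ^ 2 + κ k ^ 2 := fun k s =>
    add_pos_of_nonneg_of_pos (sq_nonneg _) (pow_pos (hκ k) 2)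
  have hd : ∀ k s, HasDerivAt (h k) (h' k s) s := by
    intro k s
    have := (((hasDerivAt_max_zero_sq s).add_const (κ k ^ 2)).sqrt (hpos k s).ne').sub_const (κ k)
    refine HasDerivAt.congr_deriv this ?_
    rw [mul_div_mul_left _ _ two_ne_zero]
  have hc : ∀ k, Continuous (h' k) := fun k =>
    Continuous.div (by fun_prop) (by fun_prop) fun s => (Real.sqrt_pos.2 (hpos k s)).ne'
  have hb : ∀ k s, |h' k s| ≤ 1 := by
    intro k s
    simp only [h']
    rw [abs_div, abs_of_nonneg (Real.sqrt_nonneg _), div_le_one (Real.sqrt_pos.2 (hpos k s))]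
    refine Real.le_sqrt_of_sq_le ?_
    rw [sq_abs]
    nlinarith [sq_nonneg (κ k)]
  have h0 : ∀ k, h k 0 = 0 := by
    intro k
    simp [h, Real.sqrt_sq (hκ k).le]
  have hmax : ∀ k s, |h k s| ≤ |s| := by
    intro k s
    have := convex_univ.norm_image_sub_le_of_norm_hasDerivWithin_le (f := h k) (C := 1)
      (fun x _ => (hd k x).hasDerivWithinAt) (fun x _ => hb k x) (mem_univ 0) (mem_univ s)
    simpa [h0] using this
  have hl : ∀ s, Tendsto (fun k => h k s) atTop (𝓝 (max s 0)) := by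
    intro s
    have : Tendsto (fun k => √(max s 0 ^ 2 + κ k ^ 2) - κ k) atTop
        (𝓝 (√(max s 0 ^ 2 + 0 ^ 2) - 0)) :=
      ((tendsto_const_nhds.add (hκl.pow 2)).sqrt).sub hκl
    simpa [Real.sqrt_sq (le_max_right s 0)] using this
  have hl' : ∀ s, Tendsto (fun k => h' k s) atTop (𝓝 (if 0 < s then 1 else 0)) := by
    intro s
    by_cases hs : 0 < s
    · simp only [h', if_pos hs]
      have : Tendsto (fun k => max s 0 / √(max s 0 ^ 2 + κ k ^ 2)) atTop
          (𝓝 (max s 0 / √(max s 0 ^ 2 + 0 ^ 2))) := by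
        refine tendsto_const_nhds.div ((tendsto_const_nhds.add (hκl.pow 2)).sqrt) ?_
        rw [max_eq_left hs.le]
        exact (Real.sqrt_pos.2 (by positivity)).ne'
      simpa [max_eq_left hs.le, Real.sqrt_sq hs.le, div_self hs.ne'] using this
    · simp [h', max_eq_right (not_lt.1 hs), hs]
  have hψ1 : ContDiff ℝ 1 ψ := hψ.of_le (by simp)
  have hdψ := continuous_fderiv_apply_const hψ1 e
  have hdψc := hasCompactSupport_fderiv_apply_const hψc e
  obtain ⟨C, hC⟩ := hψ.continuous.bounded_above_of_compact_support hψc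
  obtain ⟨C', hC'⟩ := hdψ.bounded_above_of_compact_support hdψc
  have hcm : ∀ k, Continuous (h k) := fun k =>
    continuous_iff_continuousAt.2 fun s => (hd k s).continuousAt
  have hL : Tendsto (fun k => ∫ x, h k (f x) * fderiv ℝ ψ x e) atTop
      (𝓝 (∫ x, max (f x) 0 * fderiv ℝ ψ x e)) := by
    refine tendsto_integral_of_dominated_convergence (fun x => C' * ‖f x‖) (fun k => ?_)
      (hf.integrable.norm.const_mul C') (fun k => Eventually.of_forall fun x => ?_)
      (Eventually.of_forall fun x => (hl (f x)).mul_const _)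
    · exact ((hcm k).comp_aestronglyMeasurable hf.integrable.aestronglyMeasurable).mul
        hdψ.aestronglyMeasurable
    · rw [norm_mul, mul_comm]
      exact mul_le_mul (hC' x) (hmax k _) (norm_nonneg _) ((norm_nonneg _).trans (hC' x))
  have hR : Tendsto (fun k => ∫ x, ψ x * inner ℝ (h' k (f x) • F x) e) atTop
      (𝓝 (∫ x, ψ x * inner ℝ ({y | 0 < f y}.indicator F x) e)) := by
    refine tendsto_integral_of_dominated_convergence (fun x => C * (‖F x‖ * ‖e‖)) (fun k => ?_)
      ((hf.integrable_grad.norm.mul_const _).const_mul C)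
      (fun k => Eventually.of_forall fun x => ?_) (Eventually.of_forall fun x => ?_)
    · exact hψ.continuous.aestronglyMeasurable.mul
        ((((hc k).comp_aestronglyMeasurable hf.integrable.aestronglyMeasurable).smul
          hf.integrable_grad.aestronglyMeasurable).inner_const)
    · rw [norm_mul]
      refine mul_le_mul (hC x) ?_ (norm_nonneg _) ((norm_nonneg _).trans (hC x))
      refine (norm_inner_le_norm _ _).trans (mul_le_mul_of_nonneg_right ?_ (norm_nonneg _))
      rw [norm_smul]
      exact mul_le_of_le_one_left (norm_nonneg _) (hb k _)
    · rw [hind]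
      exact (((hl' (f x)).smul_const (F x)).inner tendsto_const_nhds).const_mul _
  exact tendsto_nhds_unique hL ((hR.neg).congr fun k =>
    ((hf.comp (hd k) (hc k) (hb k) (h0 k)).weak_grad ψ hψ hψc e).symm)

/-- A crude bound; any constant multiple of `C` is good enough for dominated convergence. -/
theorem norm_mollify_le {g : E → E} (hg : Continuous g) {C : ℝ} (hC : ∀ x, ‖g x‖ ≤ C)
    (φ : ContDiffBump (0 : E)) (x : E) :
    ‖(φ.normed volume ⋆[lsmul ℝ ℝ, volume] g) x‖ ≤ 3 * C := by
  have h1 : dist ((φ.normed volume ⋆[lsmul ℝ ℝ, volume] g) x) (g x) ≤ 2 * C :=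
    φ.dist_normed_convolution_le hg.aestronglyMeasurable fun y _ => by
      rw [dist_eq_norm, two_mul]
      exact (norm_sub_le _ _).trans (add_le_add (hC y) (hC x))
  rw [dist_eq_norm] at h1
  have := norm_le_norm_add_norm_sub (g x) ((φ.normed volume ⋆[lsmul ℝ ℝ, volume] g) x)
  linarith [hC x, norm_sub_rev (g x) ((φ.normed volume ⋆[lsmul ℝ ℝ, volume] g) x),
    norm_le_norm_add_norm_sub' ((φ.normed volume ⋆[lsmul ℝ ℝ, volume] g) x) (g x)]

/-- Test functions of class `C¹` suffice. -/
theorem HasWeakGradient.weak_grad_of_contDiff_one {f : E → ℝ} {F : E → E}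
    (hf : HasWeakGradient f F) {φ : E → ℝ} (hφ : ContDiff ℝ 1 φ) (hφc : HasCompactSupport φ)
    (e : E) : ∫ x, f x * fderiv ℝ φ x e = - ∫ x, φ x * inner ℝ (F x) e := by
  let b : ℕ → ContDiffBump (0 : E) := fun k =>
    ⟨1 / ((k : ℝ) + 1) / 2, 1 / ((k : ℝ) + 1), by positivity, half_lt_self (by positivity)⟩
  have hb : Tendsto (fun k => (b k).rOut) atTop (𝓝 0) := tendsto_one_div_add_atTop_nhds_zero_nat
  let φk : ℕ → E → ℝ := fun k => (b k).normed volume ⋆[lsmul ℝ ℝ, volume] φ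
  have hφi : LocallyIntegrable φ := (hφ.continuous.integrable_of_hasCompactSupport
    hφc).locallyIntegrable
  have hks : ∀ k, ContDiff ℝ ∞ (φk k) := fun k =>
    (b k).hasCompactSupport_normed.contDiff_convolution_left _ (b k).contDiff_normed hφi
  have hkc : ∀ k, HasCompactSupport (φk k) := fun k =>
    (b k).hasCompactSupport_normed.convolution _ hφc
  have hw := HasWeakGradient.of_contDiff hφ hφc
  have hgc : Continuous (∇ φ) :=
    (InnerProductSpace.toDual ℝ E).symm.continuous.comp (hφ.continuous_fderiv one_ne_zero)
  have hin : ∀ x, fderiv ℝ φ x e = inner ℝ (∇ φ x) e := fun x => by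
    rw [gradient, InnerProductSpace.toDual_symm_apply]
  obtain ⟨C, hC⟩ := (hφ.continuous.bounded_above_of_compact_support hφc)
  obtain ⟨C', hC'⟩ := (hφ.continuous_fderiv one_ne_zero).bounded_above_of_compact_support
    (hφc.fderiv (𝕜 := ℝ))
  have hC'' : ∀ x, ‖∇ φ x‖ ≤ C' := fun x => by
    rw [gradient, LinearIsometryEquiv.norm_map]
    exact hC' x
  have hL : Tendsto (fun k => ∫ x, f x * fderiv ℝ (φk k) x e) atTop
      (𝓝 (∫ x, f x * fderiv ℝ φ x e)) := by
    refine tendsto_integral_of_dominated_convergence (fun x => ‖f x‖ * (3 * C' * ‖e‖))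
      (fun k => ?_) (hf.integrable.norm.mul_const _) (fun k => Eventually.of_forall fun x => ?_)
      (Eventually.of_forall fun x => Tendsto.const_mul _ ?_)
    · exact hf.integrable.aestronglyMeasurable.mul
        (continuous_fderiv_apply_const ((hks k).of_le (by simp)) e).aestronglyMeasurable
    · rw [norm_mul]
      refine mul_le_mul_of_nonneg_left ?_ (norm_nonneg _)
      rw [hw.fderiv_mollify (b k) x e]
      exact (norm_inner_le_norm _ _).trans
        (mul_le_mul_of_nonneg_right (norm_mollify_le hgc hC'' _ _) (norm_nonneg _))
    · simp only [φk, hw.fderiv_mollify (b _) x e, hin]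
      exact (ContDiffBump.convolution_tendsto_right_of_continuous hb hgc x).inner
        tendsto_const_nhds
  have hR : Tendsto (fun k => ∫ x, φk k x * inner ℝ (F x) e) atTop
      (𝓝 (∫ x, φ x * inner ℝ (F x) e)) := by
    refine tendsto_integral_of_dominated_convergence (fun x => 3 * C * (‖F x‖ * ‖e‖))
      (fun k => ?_) ((hf.integrable_grad.norm.mul_const _).const_mul _)
      (fun k => Eventually.of_forall fun x => ?_)
      (Eventually.of_forall fun x => Tendsto.mul_const _ ?_)
    · exact (hks k).continuous.aestronglyMeasurable.mul
        hf.integrable_grad.aestronglyMeasurable.inner_const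
    · rw [norm_mul]
      have h1 : dist (φk k x) (φ x) ≤ 2 * C :=
        (b k).dist_normed_convolution_le hφ.continuous.aestronglyMeasurable fun y _ => by
          rw [dist_eq_norm, two_mul]
          exact (norm_sub_le _ _).trans (add_le_add (hC y) (hC x))
      rw [dist_eq_norm] at h1
      refine mul_le_mul ?_ (norm_inner_le_norm _ _) (norm_nonneg _) ?_
      · linarith [hC x, norm_le_norm_add_norm_sub' (φk k x) (φ x)]
      · linarith [(norm_nonneg _).trans (hC x)]
    · exact ContDiffBump.convolution_tendsto_right_of_continuous hb hφ.continuous x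
  exact tendsto_nhds_unique hL (hR.neg.congr fun k => (hf.weak_grad _ (hks k) (hkc k) e).symm)

/-- Integration by parts against a `C¹` vector field, written as a field of linear forms. -/
theorem HasWeakGradient.integral_apply_eq_neg {ι : Type*} [Fintype ι] (b : OrthonormalBasis ι ℝ E)
    {f : E → ℝ} {F : E → E} (hf : HasWeakGradient f F) {X : E → E →L[ℝ] ℝ}
    (hX : ContDiff ℝ 1 X) (hXc : HasCompactSupport X) :
    ∫ x, X x (F x) = - ∫ x, f x * ∑ i, fderiv ℝ X x (b i) (b i) := by
  have h1 : ∀ i, ContDiff ℝ 1 fun x => X x (b i) := fun i => hX.clm_apply contDiff_const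
  have h2 : ∀ i, HasCompactSupport fun x => X x (b i) := fun i =>
    hXc.mono' fun x hx => subset_tsupport _ fun h => hx (by simp [h])
  have h3 : ∀ i x, fderiv ℝ (fun x => X x (b i)) x (b i) = fderiv ℝ X x (b i) (b i) := by
    intro i x
    have := ((hX.differentiable one_ne_zero x).hasFDerivAt.clm_apply
      (hasFDerivAt_const (b i) x)).fderiv
    rw [this]
    simp
  have h4 : ∀ x, X x (F x) = ∑ i, X x (b i) * inner ℝ (F x) (b i) := by
    intro x
    conv_lhs => rw [← b.sum_repr' (F x)]
    simp [map_sum, mul_comm, real_inner_comm]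
  have hi1 : ∀ i, Integrable fun x => X x (b i) * inner ℝ (F x) (b i) := by
    intro i
    simpa [mul_comm] using integrable_mul_of_hasCompactSupport
      (hf.integrable_grad.inner_const (b i)).locallyIntegrable (h1 i).continuous (h2 i)
  have hi2 : ∀ i, Integrable fun x => f x * fderiv ℝ X x (b i) (b i) := by
    intro i
    simp only [← h3]
    exact integrable_mul_of_hasCompactSupport hf.integrable.locallyIntegrable
      (continuous_fderiv_apply_const (h1 i) _)
      (hasCompactSupport_fderiv_apply_const (h2 i) _)
  simp only [h4, Finset.mul_sum]
  rw [integral_finsetSum _ fun i _ => hi1 i, integral_finsetSum _ fun i _ => hi2 i,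
    ← Finset.sum_neg_distrib]
  refine Finset.sum_congr rfl fun i _ => ?_
  rw [eq_neg_iff_add_eq_zero, add_comm, ← eq_neg_iff_add_eq_zero]
  simpa only [h3] using hf.weak_grad_of_contDiff_one (h1 i) (h2 i) (b i)

/-- A field with nonnegative divergence pairs nonpositively with the weak gradient of a
nonnegative function of compact support. -/
theorem HasWeakGradient.integral_apply_nonpos {ι : Type*} [Fintype ι] (b : OrthonormalBasis ι ℝ E)
    {f : E → ℝ} {F : E → E} (hf : HasWeakGradient f F) {K U : Set E} (hK : IsCompact K)
    (hU : IsOpen U) (hKU : K ⊆ U) (hf0 : ∀ᵐ x, 0 ≤ f x) (hfK : ∀ᵐ x, x ∉ K → f x = 0 ∧ F x = 0)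
    {X : E → E →L[ℝ] ℝ} (hX : ∀ x ∈ U, ContDiffAt ℝ 1 X x)
    (hdiv : ∀ x ∈ K, 0 ≤ ∑ i, fderiv ℝ X x (b i) (b i)) :
    ∫ x, X x (F x) ≤ 0 := by
  obtain ⟨χ, hχ, hχc, hχU, -, hχ1⟩ := exists_cutoff hK hU hKU
  have hY : ContDiff ℝ 1 fun x => χ x • X x := by
    refine contDiff_iff_contDiffAt.2 fun x => ?_
    by_cases hx' : x ∈ tsupport χ
    swap
    · refine (contDiffAt_const (c := (0 : E →L[ℝ] ℝ))).congr_of_eventuallyEq ?_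
      filter_upwards [notMem_tsupport_iff_eventuallyEq.1 hx'] with y hy
      simp [hy]
    exact ((hχ.of_le (by simp)).contDiffAt).smul (hX x (hχU hx'))
  have hYc : HasCompactSupport fun x => χ x • X x := hχc.smul_right
  have key := hf.integral_apply_eq_neg b hY hYc
  have h1 : ∫ x, X x (F x) = ∫ x, (χ x • X x) (F x) := by
    refine integral_congr_ae ?_
    filter_upwards [hfK] with x hx
    by_cases hxK : x ∈ K
    · have : χ x = 1 := (hχ1 x hxK).self_of_nhds
      simp [this]
    · simp [(hx hxK).2]
  rw [h1, key, neg_nonpos]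
  refine integral_nonneg_of_ae ?_
  filter_upwards [hfK, hf0] with x hx hx0
  by_cases hxK : x ∈ K
  · have : (fun x => χ x • X x) =ᶠ[𝓝 x] X := by
      filter_upwards [hχ1 x hxK] with y hy
      simp [hy]
    rw [this.fderiv_eq]
    exact mul_nonneg hx0 (hdiv x hxK)
  · simp [(hx hxK).1]

end PosPart

/-! ### Functions of class `H¹` -/

section Admissible

open Filter InnerProductSpace

variable {m : ℕ} {Ω : Set (Space m)} {u v : Space m → ℝ} {G H : Space m → Space m}

theorem fderiv_eq_zero_of_notMem_tsupport {φ : Space m → ℝ} {x : Space m}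
    (hx : x ∉ tsupport φ) : fderiv ℝ φ x = 0 :=
  image_eq_zero_of_notMem_tsupport fun h => hx (tsupport_fderiv_subset ℝ h)

theorem gradient_eq_zero_of_notMem_tsupport {φ : Space m → ℝ} {x : Space m}
    (hx : x ∉ tsupport φ) : ∇ φ x = 0 := by
  rw [gradient, fderiv_eq_zero_of_notMem_tsupport hx, map_zero]

theorem gradient_congr {f g : Space m → ℝ} {x : Space m} (h : f =ᶠ[𝓝 x] g) : ∇ f x = ∇ g x := by
  rw [gradient, gradient, h.fderiv_eq]

theorem norm_gradient (f : Space m → ℝ) (x : Space m) : ‖∇ f x‖ = ‖fderiv ℝ f x‖ := by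
  rw [gradient, LinearIsometryEquiv.norm_map]

theorem measurable_gradient (f : Space m → ℝ) : Measurable (∇ f) :=
  (toDual ℝ (Space m)).symm.continuous.measurable.comp (measurable_fderiv ℝ f)

theorem continuous_gradient {f : Space m → ℝ} (hf : ContDiff ℝ 1 f) : Continuous (∇ f) :=
  (toDual ℝ (Space m)).symm.continuous.comp (hf.continuous_fderiv one_ne_zero)

theorem integrable_inner_of_memLp {μ : Measure (Space m)} (hG : MemLp G 2 μ) (hH : MemLp H 2 μ) :
    Integrable (fun x => inner ℝ (G x) (H x)) μ := by
  refine (hG.norm.integrable_mul hH.norm).mono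
    (hG.aestronglyMeasurable.inner hH.aestronglyMeasurable) (Eventually.of_forall fun x => ?_)
  simpa using abs_real_inner_le_norm (G x) (H x)

theorem isFiniteMeasure_restrict_of_isBounded (hΩ : Bornology.IsBounded Ω) :
    IsFiniteMeasure (volume.restrict Ω) :=
  ⟨by rw [Measure.restrict_apply_univ]; exact hΩ.measure_lt_top⟩

theorem MemH1.neg (hu : MemH1 Ω u G) : MemH1 Ω (fun x => - u x) (fun x => - G x) where
  memLp := hu.memLp.neg
  memLp_grad := hu.memLp_grad.neg
  weak_grad φ hφ hc hs e := by
    simp only [neg_mul, inner_neg_left, mul_neg, integral_neg, hu.weak_grad φ hφ hc hs e]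

theorem memLp_fderiv_apply [IsFiniteMeasure (volume.restrict Ω)] {φ : Space m → ℝ}
    (hφ : ContDiff ℝ ∞ φ) (hc : HasCompactSupport φ) (e : Space m) :
    MemLp (fun x => fderiv ℝ φ x e) 2 (volume.restrict Ω) := by
  have h1 : ContDiff ℝ 1 φ := hφ.of_le (by simp)
  obtain ⟨C, hC⟩ := (continuous_fderiv_apply_const h1 e).bounded_above_of_compact_support
    (hasCompactSupport_fderiv_apply_const hc e)
  exact MemLp.of_bound (continuous_fderiv_apply_const h1 e).aestronglyMeasurable C
    (Eventually.of_forall hC)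

theorem memLp_of_hasCompactSupport [IsFiniteMeasure (volume.restrict Ω)]
    {F : Type*} [NormedAddCommGroup F] {φ : Space m → F}
    (hφ : Continuous φ) (hc : HasCompactSupport φ) :
    MemLp φ 2 (volume.restrict Ω) := by
  obtain ⟨C, hC⟩ := hφ.bounded_above_of_compact_support hc
  exact MemLp.of_bound hφ.aestronglyMeasurable C (Eventually.of_forall hC)

theorem MemH1.add [IsFiniteMeasure (volume.restrict Ω)] (hu : MemH1 Ω u G) (hv : MemH1 Ω v H) :
    MemH1 Ω (fun x => u x + v x) (fun x => G x + H x) where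
  memLp := hu.memLp.add hv.memLp
  memLp_grad := hu.memLp_grad.add hv.memLp_grad
  weak_grad φ hφ hc hs e := by
    have h1 : MemLp (fun x => fderiv ℝ φ x e) 2 (volume.restrict Ω) := memLp_fderiv_apply hφ hc e
    have h2 : MemLp φ 2 (volume.restrict Ω) := memLp_of_hasCompactSupport hφ.continuous hc
    have h3 : ∀ {F : Space m → Space m}, MemLp F 2 (volume.restrict Ω) →
        Integrable (fun x => φ x * inner ℝ (F x) e) (volume.restrict Ω) := fun hF =>
      h2.integrable_mul (hF.inner_const e)
    have h4 : Integrable (fun x => u x * fderiv ℝ φ x e) (volume.restrict Ω) :=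
      hu.memLp.integrable_mul h1
    have h5 : Integrable (fun x => v x * fderiv ℝ φ x e) (volume.restrict Ω) :=
      hv.memLp.integrable_mul h1
    simp only [add_mul, inner_add_left, mul_add]
    rw [integral_add h4 h5, integral_add (h3 hu.memLp_grad) (h3 hv.memLp_grad),
      hu.weak_grad φ hφ hc hs e, hv.weak_grad φ hφ hc hs e]
    ring

theorem HasWeakGradient.memH1 (hu : HasWeakGradient u G)
    (h2 : MemLp u 2 (volume.restrict Ω)) (h2' : MemLp G 2 (volume.restrict Ω)) : MemH1 Ω u G where
  memLp := h2
  memLp_grad := h2'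
  weak_grad φ hφ hc hs e := by
    rw [setIntegral_eq_integral_of_forall_compl_eq_zero,
      setIntegral_eq_integral_of_forall_compl_eq_zero, hu.weak_grad φ hφ hc e]
    · intro x hx
      rw [image_eq_zero_of_notMem_tsupport fun h => hx (hs h), zero_mul]
    · intro x hx
      rw [fderiv_eq_zero_of_notMem_tsupport fun h => hx (hs h)]
      simp

/-- Multiplication by a cutoff function turns a function of class `H¹(Ω)` into a weakly
differentiable function on the whole space. -/
theorem MemH1.hasWeakGradient_cutoff [IsFiniteMeasure (volume.restrict Ω)] (hu : MemH1 Ω u G)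
    {χ : Space m → ℝ} (hχ : ContDiff ℝ ∞ χ) (hχc : HasCompactSupport χ) (hχΩ : tsupport χ ⊆ Ω) :
    HasWeakGradient (fun x => χ x * u x) (fun x => χ x • G x + u x • ∇ χ x) := by
  have hχ1 : ContDiff ℝ 1 χ := hχ.of_le (by simp)
  have h2 : MemLp χ 2 (volume.restrict Ω) := memLp_of_hasCompactSupport hχ.continuous hχc
  have hgc : HasCompactSupport (∇ χ) :=
    hχc.mono' fun x hx => by
      by_contra h
      exact hx (gradient_eq_zero_of_notMem_tsupport h)
  have h3 : MemLp (∇ χ) 2 (volume.restrict Ω) :=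
    memLp_of_hasCompactSupport (continuous_gradient hχ1) hgc
  have hi1 : Integrable (fun x => χ x • G x) (volume.restrict Ω) :=
    (h2.norm.integrable_mul hu.memLp_grad.norm).mono
      (h2.aestronglyMeasurable.smul hu.memLp_grad.aestronglyMeasurable)
      (Eventually.of_forall fun x => by simp [norm_smul])
  have hi2 : Integrable (fun x => u x • ∇ χ x) (volume.restrict Ω) :=
    (hu.memLp.norm.integrable_mul h3.norm).mono
      (hu.memLp.aestronglyMeasurable.smul h3.aestronglyMeasurable)
      (Eventually.of_forall fun x => by simp [norm_smul])
  have hz : ∀ x, x ∉ Ω → χ x = 0 := fun x hx =>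
    image_eq_zero_of_notMem_tsupport fun h => hx (hχΩ h)
  have hz' : ∀ x, x ∉ Ω → ∇ χ x = 0 := fun x hx =>
    gradient_eq_zero_of_notMem_tsupport fun h => hx (hχΩ h)
  refine ⟨?_, ?_, fun ψ hψ hψc e => ?_⟩
  · refine (integrableOn_iff_integrable_of_support_subset (s := Ω) fun x hx => ?_).1
      (h2.integrable_mul hu.memLp)
    by_contra h
    exact hx (by simp [hz x h])
  · refine (integrableOn_iff_integrable_of_support_subset (s := Ω) fun x hx => ?_).1 (hi1.add hi2)
    by_contra h
    exact hx (by simp [hz x h, hz' x h])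
  · have hψ1 : ContDiff ℝ 1 ψ := hψ.of_le (by simp)
    have h4 : MemLp (fun x => fderiv ℝ ψ x e) 2 (volume.restrict Ω) := memLp_fderiv_apply hψ hψc e
    have h5 : MemLp ψ 2 (volume.restrict Ω) := memLp_of_hasCompactSupport hψ.continuous hψc
    have hp := hu.weak_grad (fun x => χ x * ψ x) (hχ.mul hψ) hχc.mul_right
      ((closure_mono (Function.support_mul_subset_left _ _)).trans hχΩ) e
    have hd : ∀ x, fderiv ℝ (fun x => χ x * ψ x) x e
        = χ x * fderiv ℝ ψ x e + ψ x * fderiv ℝ χ x e := by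
      intro x
      rw [fderiv_fun_mul (hχ1.differentiable one_ne_zero x) (hψ1.differentiable one_ne_zero x)]
      simp
    simp only [hd] at hp
    have eL : ∫ x in Ω, χ x * u x * fderiv ℝ ψ x e = ∫ x, χ x * u x * fderiv ℝ ψ x e :=
      setIntegral_eq_integral_of_forall_compl_eq_zero fun x hx => by simp [hz x hx]
    have eR : ∫ x in Ω, ψ x * inner ℝ (χ x • G x + u x • ∇ χ x) e
        = ∫ x, ψ x * inner ℝ (χ x • G x + u x • ∇ χ x) e :=
      setIntegral_eq_integral_of_forall_compl_eq_zero fun x hx => by simp [hz x hx, hz' x hx]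
    rw [← eL, ← eR]
    · obtain ⟨C', hC'⟩ := hψ.continuous.bounded_above_of_compact_support hψc
      have hu1 : Integrable u (volume.restrict Ω) := hu.memLp.integrable one_le_two
      have hA : Integrable (fun x => χ x * u x * fderiv ℝ ψ x e) (volume.restrict Ω) := by
        obtain ⟨C, hC⟩ := hχ.continuous.bounded_above_of_compact_support hχc
        have := (hu.memLp.integrable_mul h4).bdd_mul (c := C) hχ.continuous.aestronglyMeasurable
          (Eventually.of_forall hC)
        simpa [mul_assoc] using this
      have hB : Integrable (fun x => u x * (ψ x * fderiv ℝ χ x e)) (volume.restrict Ω) := by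
        have := (hu.memLp.integrable_mul
          (memLp_fderiv_apply (Ω := Ω) hχ hχc e)).bdd_mul (c := C')
          hψ.continuous.aestronglyMeasurable (Eventually.of_forall hC')
        refine this.congr (Eventually.of_forall fun x => ?_)
        simp only [Pi.mul_apply]
        ring
      have hD : Integrable (fun x => ψ x * inner ℝ (χ x • G x) e) (volume.restrict Ω) :=
        (hi1.inner_const e).bdd_mul hψ.continuous.aestronglyMeasurable (Eventually.of_forall hC')
      have hE : Integrable (fun x => ψ x * inner ℝ (u x • ∇ χ x) e) (volume.restrict Ω) :=
        (hi2.inner_const e).bdd_mul hψ.continuous.aestronglyMeasurable (Eventually.of_forall hC')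
      simp only [inner_add_left, mul_add]
      rw [integral_add hD hE]
      have e1 : ∫ x in Ω, u x * (χ x * fderiv ℝ ψ x e + ψ x * fderiv ℝ χ x e)
          = (∫ x in Ω, χ x * u x * fderiv ℝ ψ x e)
            + ∫ x in Ω, u x * (ψ x * fderiv ℝ χ x e) := by
        rw [← integral_add hA hB]
        congr 1
        ext x
        ring
      have e2 : ∫ x in Ω, ψ x * inner ℝ (u x • ∇ χ x) e
          = ∫ x in Ω, u x * (ψ x * fderiv ℝ χ x e) := by
        congr 1
        ext x
        rw [real_inner_smul_left, inner_gradient_left]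
        ring
      have e3 : ∫ x in Ω, ψ x * inner ℝ (χ x • G x) e
          = ∫ x in Ω, χ x * ψ x * inner ℝ (G x) e := by
        congr 1
        ext x
        rw [real_inner_smul_left]
        ring
      rw [e2, e3]
      linarith

/-- By Rademacher's theorem the gradient of a Lipschitz function exists almost everywhere; it is
also the weak gradient. -/
theorem memH1_gradient_of_lipschitzWith {f : Space m → ℝ} {Λ : ℝ≥0} (hf : LipschitzWith Λ f)
    (hΩ : Bornology.IsBounded Ω) : MemH1 Ω f (∇ f) := by
  have := isFiniteMeasure_restrict_of_isBounded hΩ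
  refine ⟨?_, ?_, fun φ hφ hc hs e => ?_⟩
  · obtain ⟨C, hC⟩ := (hf.isBounded_image hΩ).exists_norm_le
    refine MemLp.of_bound hf.continuous.aestronglyMeasurable C ?_
    rw [ae_restrict_iff (measurableSet_le hf.continuous.norm.measurable measurable_const)]
    exact Eventually.of_forall fun x hx => hC _ (mem_image_of_mem f hx)
  · refine MemLp.of_bound (measurable_gradient f).aestronglyMeasurable Λ
      (Eventually.of_forall fun x => ?_)
    rw [norm_gradient]
    exact norm_fderiv_le_of_lipschitz ℝ hf
  · have hφ1 : ContDiff ℝ 1 φ := hφ.of_le (by simp)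
    obtain ⟨C, hC⟩ := hφ1.lipschitzWith_of_hasCompactSupport hc one_ne_zero
    have key := hf.integral_lineDeriv_mul_eq (μ := volume) hC hc e
    rw [setIntegral_eq_integral_of_forall_compl_eq_zero,
      setIntegral_eq_integral_of_forall_compl_eq_zero]
    · have e1 : ∫ x, lineDeriv ℝ f x e * φ x = ∫ x, φ x * inner ℝ (∇ f x) e := by
        refine integral_congr_ae ?_
        filter_upwards [hf.ae_differentiableAt (μ := volume)] with x hx
        rw [hx.lineDeriv_eq_fderiv, inner_gradient_left, mul_comm]
      have e2 : ∫ x, lineDeriv ℝ φ x (-e) * f x = - ∫ x, f x * fderiv ℝ φ x e := by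
        rw [← integral_neg]
        congr 1
        ext x
        rw [(hφ1.differentiable one_ne_zero x).lineDeriv_eq_fderiv, map_neg]
        ring
      rw [← e1, key, e2, neg_neg]
    · intro x hx
      rw [image_eq_zero_of_notMem_tsupport fun h => hx (hs h), zero_mul]
    · intro x hx
      rw [fderiv_eq_zero_of_notMem_tsupport fun h => hx (hs h)]
      simp

/-! ### Classical sub- and superharmonicity in weak form -/

theorem laplacian_eq_sum_fderiv (f : Space m → ℝ) (x : Space m) :
    Δ f x = ∑ i, fderiv ℝ (fderiv ℝ f) x (EuclideanSpace.basisFun (Fin (m + 1)) ℝ i)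
      (EuclideanSpace.basisFun (Fin (m + 1)) ℝ i) := by
  rw [laplacian_eq_iteratedFDeriv_orthonormalBasis f (EuclideanSpace.basisFun (Fin (m + 1)) ℝ)]
  simp [iteratedFDeriv_two_apply]

theorem integral_inner_gradient_nonneg_of_laplacian_nonpos {f ξ : Space m → ℝ}
    {K U : Set (Space m)} (hK : IsCompact K) (hU : IsOpen U) (hKU : K ⊆ U)
    (hf : ∀ x ∈ U, ContDiffAt ℝ 2 f x) (hΔ : ∀ x ∈ K, Δ f x ≤ 0) (hξ : HasWeakGradient ξ H)
    (hξ0 : ∀ᵐ x, 0 ≤ ξ x) (hξK : ∀ᵐ x, x ∉ K → ξ x = 0 ∧ H x = 0) :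
    0 ≤ ∫ x, inner ℝ (∇ f x) (H x) := by
  have := hξ.integral_apply_nonpos (EuclideanSpace.basisFun (Fin (m + 1)) ℝ) hK hU hKU hξ0 hξK
    (X := fun x => - fderiv ℝ f x) (fun x hx => ((hf x hx).fderiv_right (by norm_num)).neg)
    (fun x hx => by
      have h := hΔ x hx
      rw [laplacian_eq_sum_fderiv] at h
      have : fderiv ℝ (fun x => - fderiv ℝ f x) x = - fderiv ℝ (fderiv ℝ f) x := fderiv_fun_neg
      rw [this]
      simpa using h)
  simp only [inner_gradient_left]
  simpa [integral_neg] using this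

/-- A nonnegative Lipschitz function that is classically subharmonic where it is positive is
weakly subharmonic, also across the boundary of its positivity set. -/
theorem integral_inner_gradient_nonpos_of_laplacian_nonneg {f ξ : Space m → ℝ} {Λ : ℝ≥0}
    {K U : Set (Space m)} (hK : IsCompact K) (hU : IsOpen U) (hKU : K ⊆ U)
    (hfΛ : LipschitzOnWith Λ f U) (hf0 : ∀ x ∈ U, 0 ≤ f x)
    (hf : ∀ x ∈ U, 0 < f x → ContDiffAt ℝ 2 f x)
    (hΔ : ∀ x ∈ U, 0 < f x → 0 ≤ Δ f x) (hξ : HasWeakGradient ξ H)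
    (hξ0 : ∀ᵐ x, 0 ≤ ξ x) (hξK : ∀ᵐ x, x ∉ K → ξ x = 0 ∧ H x = 0) :
    ∫ x, inner ℝ (∇ f x) (H x) ≤ 0 := by
  let θ : ℕ → Space m → ℝ := fun k x => Real.smoothTransition (k * f x - 1)
  have hθs : ContDiff ℝ ∞ Real.smoothTransition := Real.smoothTransition.contDiff
  -- the field `θₖ ∇f` vanishes near `{f = 0}` and has nonnegative divergence
  have hk : ∀ k, ∫ x, (θ k x • fderiv ℝ f x) (H x) ≤ 0 := by
    intro k
    have hzero : ∀ x ∈ U, ¬ 0 < f x → (fun x => θ k x • fderiv ℝ f x) =ᶠ[𝓝 x] 0 := by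
      intro x hx h0
      have hc : ContinuousAt f x := hfΛ.continuousOn.continuousAt (hU.mem_nhds hx)
      have h1 : ∀ᶠ y in 𝓝 x, (k : ℝ) * f y - 1 < 0 := by
        have : ContinuousAt (fun y => (k : ℝ) * f y - 1) x := (hc.const_mul _).sub_const _
        refine this.eventually (gt_mem_nhds ?_)
        change (k : ℝ) * f x - 1 < 0
        rw [le_antisymm (not_lt.1 h0) (hf0 x hx)]
        norm_num
      filter_upwards [h1] with y hy
      simp [θ, Real.smoothTransition.zero_of_nonpos hy.le]
    refine hξ.integral_apply_nonpos (EuclideanSpace.basisFun (Fin (m + 1)) ℝ) hK hU hKU hξ0 hξK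
      (X := fun x => θ k x • fderiv ℝ f x) (fun x hx => ?_) (fun x hx => ?_)
    · by_cases h : 0 < f x
      · have h1 : ContDiffAt ℝ 1 (fderiv ℝ f) x := (hf x hx h).fderiv_right (by norm_num)
        have h2 : ContDiffAt ℝ 1 (fun y => (k : ℝ) * f y - 1) x :=
          (contDiffAt_const.mul ((hf x hx h).of_le (by norm_num))).sub contDiffAt_const
        have h3 : ContDiffAt ℝ 1 (θ k) x :=
          ContDiffAt.comp x (hθs.of_le (by simp)).contDiffAt h2
        exact h3.smul h1
      · exact (contDiffAt_const (c := (0 : Space m →L[ℝ] ℝ))).congr_of_eventuallyEq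
          (hzero x hx h)
    · by_cases h : 0 < f x
      · have hfx := hf x (hKU hx) h
        have hd : HasFDerivAt f (fderiv ℝ f x) x :=
          (hfx.differentiableAt (by norm_num)).hasFDerivAt
        have hd2 : HasFDerivAt (fderiv ℝ f) (fderiv ℝ (fderiv ℝ f) x) x :=
          ((hfx.fderiv_right (m := 1) (by norm_num)).differentiableAt (by norm_num)).hasFDerivAt
        have hs : HasDerivAt Real.smoothTransition (deriv Real.smoothTransition (k * f x - 1))
            (k * f x - 1) :=
          ((hθs.differentiable (by simp)) _).hasDerivAt
        have hθd : HasFDerivAt (θ k)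
            (deriv Real.smoothTransition (k * f x - 1) • ((k : ℝ) • fderiv ℝ f x)) x :=
          HasDerivAt.comp_hasFDerivAt (h₂ := Real.smoothTransition)
            (f := fun y => (k : ℝ) * f y - 1) x hs ((hd.const_mul (k : ℝ)).sub_const 1)
        have := (hθd.smul hd2).fderiv
        rw [show (fun x => θ k x • fderiv ℝ f x) = θ k • fderiv ℝ f from rfl, this]
        have hL := hΔ x (hKU hx) h
        rw [laplacian_eq_sum_fderiv] at hL
        have hmono : 0 ≤ deriv Real.smoothTransition (k * f x - 1) :=
          Real.smoothTransition.monotone.deriv_nonneg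
        simp only [add_apply, smul_apply,
          ContinuousLinearMap.smulRight_apply, smul_eq_mul, Finset.sum_add_distrib,
          ← Finset.mul_sum]
        refine add_nonneg (mul_nonneg (Real.smoothTransition.nonneg _) hL)
          (Finset.sum_nonneg fun i _ => ?_)
        rw [mul_assoc, mul_assoc]
        exact mul_nonneg hmono (mul_nonneg (Nat.cast_nonneg _) (mul_self_nonneg _))
      · rw [(hzero x (hKU hx) h).fderiv_eq]
        simp
  have hlim : Tendsto (fun k => ∫ x, (θ k x • fderiv ℝ f x) (H x)) atTop
      (𝓝 (∫ x, inner ℝ (∇ f x) (H x))) := by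
    simp only [inner_gradient_left]
    have hθm : ∀ k, AEStronglyMeasurable (fun x => (θ k x • fderiv ℝ f x) (H x)) volume := by
      intro k
      have h1 : AEStronglyMeasurable
          (fun x => U.indicator (θ k) x * inner ℝ (∇ f x) (H x)) volume := by
        refine AEStronglyMeasurable.mul ?_
          ((measurable_gradient f).aestronglyMeasurable.inner
            hξ.integrable_grad.aestronglyMeasurable)
        refine (aestronglyMeasurable_indicator_iff hU.measurableSet).2 ?_
        refine ContinuousOn.aestronglyMeasurable ?_ hU.measurableSet
        exact Real.smoothTransition.continuous.comp_continuousOn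
          ((hfΛ.continuousOn.const_smul (k : ℝ)).sub continuousOn_const)
      refine h1.congr ?_
      filter_upwards [hξK] with x hx
      by_cases h : x ∈ U
      · simp [h, inner_gradient_left]
      · simp [(hx fun hK => h (hKU hK)).2]
    refine tendsto_integral_of_dominated_convergence (fun x => Λ * ‖H x‖) hθm
      (hξ.integrable_grad.norm.const_mul _) (fun k => ?_) ?_
    · filter_upwards [hξK] with x hx
      by_cases h : x ∈ U
      · rw [smul_apply, norm_smul, Real.norm_of_nonneg
          (Real.smoothTransition.nonneg _)]
        refine (mul_le_of_le_one_left (norm_nonneg _) (Real.smoothTransition.le_one _)).trans ?_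
        refine ((fderiv ℝ f x).le_opNorm _).trans (mul_le_mul_of_nonneg_right ?_ (norm_nonneg _))
        exact norm_fderiv_le_of_lipschitzOn ℝ (hU.mem_nhds h) hfΛ
      · simp [(hx fun hK => h (hKU hK)).2]
    · filter_upwards [hξK] with x hx
      by_cases h : x ∈ U
      · by_cases h0 : 0 < f x
        · refine tendsto_const_nhds.congr' ?_
          obtain ⟨N, hN⟩ := exists_nat_ge (2 / f x)
          filter_upwards [eventually_ge_atTop N] with k hkN
          have : (2 : ℝ) ≤ k * f x := by
            rw [← div_le_iff₀ h0]
            exact hN.trans (by exact_mod_cast hkN)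
          simp [θ, Real.smoothTransition.one_of_one_le (show (1 : ℝ) ≤ k * f x - 1 by linarith)]
        · -- at a zero `f` has a local minimum, so its derivative vanishes there
          have : fderiv ℝ f x = 0 := by
            refine IsLocalMin.fderiv_eq_zero ?_
            filter_upwards [hU.mem_nhds h] with y hy
            exact (not_lt.1 h0).trans (hf0 y hy)
          simp [this]
      · simp [(hx fun hK => h (hKU hK)).2]
  exact le_of_tendsto' hlim hk

end Admissible

/-! ### Variations of a constrained minimizer -/

section Variation

open Filter InnerProductSpace

variable {m : ℕ} {Ω : Set (Space m)} {V W u : Space m → ℝ} {G : Space m → Space m}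

theorem integrable_phase [IsFiniteMeasure (volume.restrict Ω)]
    (hu : AEStronglyMeasurable u (volume.restrict Ω)) :
    Integrable ({y | |u y| < 1}.indicator fun _ => (1 : ℝ)) (volume.restrict Ω) := by
  have hm : Measurable fun s : ℝ => if |s| < 1 then (1 : ℝ) else 0 :=
    Measurable.ite (measurableSet_lt (by fun_prop) measurable_const) measurable_const
      measurable_const
  have heq : ({y | |u y| < 1}.indicator fun _ => (1 : ℝ))
      = fun x => (fun s : ℝ => if |s| < 1 then (1 : ℝ) else 0) (u x) := by
    ext x
    simp [indicator]
  rw [heq]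
  refine Integrable.of_bound (hm.comp_aemeasurable hu.aemeasurable).aestronglyMeasurable 1
    (Eventually.of_forall fun x => ?_)
  by_cases h : |u x| < 1 <;> simp [h]

/-- Minimality, with the phase term estimated by the measure of the set where it increases. -/
theorem IsConstrainedMinimizer.le_of_competitor [IsFiniteMeasure (volume.restrict Ω)]
    (hu : IsConstrainedMinimizer Ω V W u G) {ζ : Space m → ℝ} {H : Space m → Space m}
    (hζ : MemH1 Ω ζ H)
    (hadm : ∀ᵐ x ∂(volume.restrict Ω), V x ≤ u x + ζ x ∧ u x + ζ x ≤ W x) {M : ℝ}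
    (hM : (volume.restrict Ω).real {x | |u x + ζ x| < 1 ∧ ¬ |u x| < 1} ≤ M) :
    -M ≤ ∫ x in Ω, (2 * inner ℝ (G x) (H x) + ‖H x‖ ^ 2) := by
  have hv := hu.1.1.add hζ
  have hle := hu.2 _ _ ⟨hv, hadm⟩
  have hG2 := hu.1.1.memLp_grad.integrable_norm_pow (p := 2) two_ne_zero
  have hH2 := hζ.memLp_grad.integrable_norm_pow (p := 2) two_ne_zero
  have hGH2 := hv.memLp_grad.integrable_norm_pow (p := 2) two_ne_zero
  have hin := integrable_inner_of_memLp hu.1.1.memLp_grad hζ.memLp_grad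
  have hp1 := integrable_phase hu.1.1.memLp.aestronglyMeasurable
  have hp2 := integrable_phase hv.memLp.aestronglyMeasurable
  set S : Set (Space m) := {x | |u x + ζ x| < 1 ∧ ¬ |u x| < 1} with hS
  have hSm : NullMeasurableSet S (volume.restrict Ω) := by
    refine NullMeasurableSet.inter ?_ ?_
    · exact nullMeasurableSet_lt hv.memLp.aestronglyMeasurable.aemeasurable.abs
        aemeasurable_const
    · exact (nullMeasurableSet_lt hu.1.1.memLp.aestronglyMeasurable.aemeasurable.abs
        aemeasurable_const).compl
  have hphase : ∫ x in Ω, ({y | |u y + ζ y| < 1}.indicator (fun _ => (1 : ℝ)) x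
      - {y | |u y| < 1}.indicator (fun _ => (1 : ℝ)) x) ≤ M := by
    refine le_trans ?_ hM
    have h1 : ∫ x in Ω, S.indicator (fun _ => (1 : ℝ)) x = (volume.restrict Ω).real S := by
      rw [integral_indicator₀ hSm, setIntegral_const, smul_eq_mul, mul_one]
    rw [← h1]
    refine integral_mono (hp2.sub hp1) ?_ fun x => ?_
    · exact (integrable_const (1 : ℝ)).indicator₀ hSm
    · by_cases h1 : |u x + ζ x| < 1 <;> by_cases h2 : |u x| < 1 <;>
        simp [indicator, hS, h1, h2, -not_lt]
  rw [integral_sub hp2 hp1] at hphase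
  unfold energy at hle
  rw [integral_add hG2 hp1, integral_add hGH2 hp2] at hle
  have hexp : ∫ x in Ω, ‖G x + H x‖ ^ 2
      = (∫ x in Ω, ‖G x‖ ^ 2) + ∫ x in Ω, (2 * inner ℝ (G x) (H x) + ‖H x‖ ^ 2) := by
    have h2 : Integrable (fun x => 2 * inner ℝ (G x) (H x) + ‖H x‖ ^ 2) (volume.restrict Ω) :=
      (hin.const_mul 2).add hH2
    rw [← integral_add hG2 h2]
    congr 1
    ext x
    rw [norm_add_sq_real]
    ring
  linarith

/-- The pointwise inequality behind the variation estimate, on the set where the variation `t φ`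
is cut down to the obstacle `u + p`. Here `g`, `f`, `P` stand for `∇u`, `∇φ`, `∇p`, so that `g + P`
is the gradient of the obstacle and `t f - P` that of the part cut off. The difference of the two
sides is `‖t f - P‖²`. -/
theorem variation_pointwise (g f P : Space m) (t : ℝ) :
    2 * inner ℝ g P + ‖P‖ ^ 2 + 2 * inner ℝ (g + P) (t • f - P)
      ≤ 2 * t * inner ℝ g f + t ^ 2 * ‖f‖ ^ 2 := by
  have h := sq_nonneg ‖t • f - P‖
  rw [norm_sub_sq_real, norm_smul, mul_pow, Real.norm_eq_abs, sq_abs, inner_smul_left] at h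
  simp only [inner_add_left, inner_sub_right, inner_smul_right, real_inner_self_eq_norm_sq]
  simp only [RCLike.conj_to_real] at h
  rw [real_inner_comm P f] at *
  nlinarith

/-- Upward variations `u + min (t φ, W - u)`. If the obstacle `W` is weakly superharmonic on the
support of `φ`, cutting the variation off at the obstacle does no harm: the estimate is the one
that the variation `u + t φ` would give. Here `M` bounds the volume added to `{|u| < 1}`. -/
theorem IsConstrainedMinimizer.variation_up (hΩ : Bornology.IsBounded Ω)
    (hu : IsConstrainedMinimizer Ω V W u G) {D' : Set (Space m)} (hD' : IsOpen D') (hD'Ω : D' ⊆ Ω)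
    {Λ : ℝ≥0} (hW : LipschitzOnWith Λ W D') {φ : Space m → ℝ} (hφ : ContDiff ℝ ∞ φ)
    (hφc : HasCompactSupport φ) (hφD : tsupport φ ⊆ D') (hφ0 : ∀ x, 0 ≤ φ x) {t : ℝ} (ht : 0 ≤ t)
    (hS : ∀ (ξ : Space m → ℝ) (H : Space m → Space m), HasWeakGradient ξ H → (∀ᵐ x, 0 ≤ ξ x) →
      (∀ᵐ x, x ∉ tsupport φ → ξ x = 0 ∧ H x = 0) → 0 ≤ ∫ x, inner ℝ (∇ W x) (H x))
    {M : ℝ} (hM : ∀ ζ : Space m → ℝ, (∀ᵐ x ∂(volume.restrict Ω),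
      0 ≤ ζ x ∧ u x + ζ x ≤ W x ∧ (x ∉ tsupport φ → ζ x = 0)) →
      (volume.restrict Ω).real {x | |u x + ζ x| < 1 ∧ ¬ |u x| < 1} ≤ M) :
    -M ≤ ∫ x in Ω, (2 * t * inner ℝ (G x) (∇ φ x) + t ^ 2 * ‖∇ φ x‖ ^ 2) := by
  have hfin := isFiniteMeasure_restrict_of_isBounded hΩ
  have hφ1 : ContDiff ℝ 1 φ := hφ.of_le (by simp)
  obtain ⟨W', hW', hWW'⟩ := hW.extend_real
  have hgW : ∀ x ∈ D', ∇ W' x = ∇ W x := fun x hx =>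
    gradient_congr (by filter_upwards [hD'.mem_nhds hx] with y hy using (hWW' hy).symm)
  obtain ⟨χ, hχ, hχc, hχD, hχI, hχ1⟩ := exists_cutoff hφc hD' hφD
  -- the gap to the obstacle, cut off outside `D'`
  have hgap : MemH1 Ω (fun x => W' x + - u x) (fun x => ∇ W' x + - G x) :=
    (memH1_gradient_of_lipschitzWith hW' hΩ).add hu.1.1.neg
  have hp := hgap.hasWeakGradient_cutoff hχ hχc (hχD.trans hD'Ω)
  set p : Space m → ℝ := fun x => χ x * (W' x + - u x) with hp_def
  set P : Space m → Space m := fun x => χ x • (∇ W' x + - G x) + (W' x + - u x) • ∇ χ x with hP_def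
  have hpK : ∀ x ∈ tsupport φ, p x = W x - u x ∧ P x = ∇ W x - G x := by
    intro x hx
    have h1 : χ x = 1 := (hχ1 x hx).self_of_nhds
    have h2 : ∇ χ x = 0 := by
      rw [gradient_congr (hχ1 x hx)]
      simp [gradient]
    simp [hp_def, hP_def, h1, h2, hgW x (hφD hx), hWW' (hφD hx), sub_eq_add_neg]
  have haeD : ∀ᵐ x, x ∈ D' → u x ≤ W x := by
    rw [← ae_restrict_iff' hD'.measurableSet]
    exact (ae_restrict_of_ae_restrict_of_subset hD'Ω hu.1.2).mono fun x hx => hx.2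
  have hp0 : ∀ᵐ x, 0 ≤ p x := by
    filter_upwards [haeD] with x hx
    by_cases hxD : x ∈ D'
    · have h1 := hx hxD
      have h2 := hWW' hxD
      refine mul_nonneg (hχI x).1 ?_
      linarith
    · have : χ x = 0 := image_eq_zero_of_notMem_tsupport fun h => hxD (hχD h)
      simp [hp_def, this]
  have hφw : HasWeakGradient (fun x => t * φ x) (fun x => t • ∇ φ x) :=
    (HasWeakGradient.of_contDiff hφ1 hφc).const_mul t
  have hξ := (hφw.sub hp).posPart
  set A : Set (Space m) := {y | 0 < t * φ y - p y} with hA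
  set ξ : Space m → ℝ := fun x => max (t * φ x - p x) 0 with hξ_def
  set Hξ : Space m → Space m := fun x => A.indicator (fun x => t • ∇ φ x - P x) x with hHξ_def
  have hAK : ∀ᵐ x, x ∈ A → x ∈ tsupport φ := by
    filter_upwards [hp0] with x hx hxA
    by_contra h
    have : φ x = 0 := image_eq_zero_of_notMem_tsupport h
    simp only [hA, mem_ofPred_eq, this, mul_zero, zero_sub] at hxA
    linarith
  have hξK : ∀ᵐ x, x ∉ tsupport φ → ξ x = 0 ∧ Hξ x = 0 := by
    filter_upwards [hAK] with x hx hxK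
    have hxA : x ∉ A := fun h => hxK (hx h)
    refine ⟨?_, by simp [hHξ_def, hxA]⟩
    simp only [hξ_def]
    exact max_eq_right (not_lt.1 hxA)
  have hSξ := hS ξ Hξ hξ (Eventually.of_forall fun x => le_max_right _ _) hξK
  -- the competitor
  have hζ := hφw.sub hξ
  set ζ : Space m → ℝ := fun x => t * φ x - ξ x with hζ_def
  set H : Space m → Space m := fun x => t • ∇ φ x - Hξ x with hH_def
  have hζmin : ∀ x, ζ x = min (p x) (t * φ x) := by
    intro x
    simp only [hζ_def, hξ_def]
    rcases le_total (t * φ x - p x) 0 with h | h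
    · rw [max_eq_right h, min_eq_right (by linarith)]; ring
    · rw [max_eq_left h, min_eq_left (by linarith)]; ring
  have hcφ : HasCompactSupport (∇ φ) := hφc.mono' fun x hx => by
    by_contra h
    exact hx (gradient_eq_zero_of_notMem_tsupport h)
  have hζ2 : MemLp ζ 2 (volume.restrict Ω) := by
    have h1 : MemLp (fun x => t * φ x) 2 (volume.restrict Ω) :=
      (memLp_of_hasCompactSupport hφ.continuous hφc).const_mul t
    refine h1.mono hζ.integrable.aestronglyMeasurable.restrict ?_
    filter_upwards [ae_restrict_of_ae hp0] with x hx
    have h2 : 0 ≤ t * φ x := mul_nonneg ht (hφ0 x)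
    rw [hζmin, Real.norm_of_nonneg (le_min hx h2), Real.norm_of_nonneg h2]
    exact min_le_right _ _
  have hG2 := hu.1.1.memLp_grad
  have hφ2 : MemLp (∇ φ) 2 (volume.restrict Ω) :=
    memLp_of_hasCompactSupport (continuous_gradient hφ1) hcφ
  have hW2 : MemLp (∇ W') 2 (volume.restrict Ω) :=
    (memH1_gradient_of_lipschitzWith hW' hΩ).memLp_grad
  have hHpt : ∀ᵐ x, H x = if x ∈ A then ∇ W' x - G x else t • ∇ φ x := by
    filter_upwards [hAK] with x hx
    by_cases hxA : x ∈ A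
    · simp [hH_def, hHξ_def, hxA, (hpK x (hx hxA)).2, hgW x (hφD (hx hxA))]
    · simp [hH_def, hHξ_def, hxA]
  have hH2 : MemLp H 2 (volume.restrict Ω) := by
    have h1 : MemLp (fun x => ‖∇ W' x - G x‖ + ‖t • ∇ φ x‖) 2 (volume.restrict Ω) :=
      (hW2.sub hG2).norm.add (hφ2.const_smul t).norm
    refine h1.mono hζ.integrable_grad.aestronglyMeasurable.restrict ?_
    filter_upwards [ae_restrict_of_ae hHpt] with x hx
    rw [hx, Real.norm_of_nonneg (by positivity)]
    split_ifs
    · exact le_add_of_nonneg_right (norm_nonneg _)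
    · exact le_add_of_nonneg_left (norm_nonneg _)
  have hζprop : ∀ᵐ x ∂(volume.restrict Ω),
      0 ≤ ζ x ∧ u x + ζ x ≤ W x ∧ (x ∉ tsupport φ → ζ x = 0) := by
    filter_upwards [ae_restrict_of_ae hp0, hu.1.2] with x hx hx2
    have h2 : 0 ≤ t * φ x := mul_nonneg ht (hφ0 x)
    have h3 : x ∉ tsupport φ → ζ x = 0 := fun h => by
      have : φ x = 0 := image_eq_zero_of_notMem_tsupport h
      rw [hζmin, this, mul_zero, min_eq_right hx]
    refine ⟨by rw [hζmin]; exact le_min hx h2, ?_, h3⟩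
    by_cases hK : x ∈ tsupport φ
    · have : ζ x ≤ p x := by rw [hζmin]; exact min_le_left _ _
      rw [(hpK x hK).1] at this
      linarith
    · rw [h3 hK]
      linarith [hx2.2]
  have hcomp := hu.le_of_competitor (hζ.memH1 hζ2 hH2) (M := M) (by
    filter_upwards [hζprop, hu.1.2] with x h1 h2
    exact ⟨by linarith [h1.1, h2.1], h1.2.1⟩) (hM ζ hζprop)
  -- the contribution of the obstacle
  have hWi : Integrable (fun x => inner ℝ (∇ W' x) (Hξ x)) volume := by
    refine (hξ.integrable_grad.norm.const_mul (Λ : ℝ)).mono'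
      ((measurable_gradient W').aestronglyMeasurable.inner
        hξ.integrable_grad.aestronglyMeasurable) (Eventually.of_forall fun x => ?_)
    refine (norm_inner_le_norm _ _).trans (mul_le_mul_of_nonneg_right ?_ (norm_nonneg _))
    rw [norm_gradient]
    exact norm_fderiv_le_of_lipschitz ℝ hW'
  have hW'ξ : 0 ≤ ∫ x in Ω, inner ℝ (∇ W' x) (Hξ x) := by
    rw [setIntegral_eq_integral_of_ae_compl_eq_zero]
    · refine hSξ.trans_eq (integral_congr_ae ?_)
      filter_upwards [hξK] with x hx
      by_cases hK : x ∈ tsupport φ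
      · rw [hgW x (hφD hK)]
      · simp [(hx hK).2]
    · filter_upwards [hξK] with x hx hxΩ
      simp [(hx fun hK => hxΩ (hD'Ω (hφD hK))).2]
  have hint1 : Integrable (fun x => 2 * inner ℝ (G x) (H x) + ‖H x‖ ^ 2) (volume.restrict Ω) :=
    ((integrable_inner_of_memLp hG2 hH2).const_mul 2).add
      (hH2.integrable_norm_pow (p := 2) two_ne_zero)
  have hint2 : Integrable (fun x => 2 * t * inner ℝ (G x) (∇ φ x) + t ^ 2 * ‖∇ φ x‖ ^ 2)
      (volume.restrict Ω) :=
    ((integrable_inner_of_memLp hG2 hφ2).const_mul (2 * t)).add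
      ((hφ2.integrable_norm_pow (p := 2) two_ne_zero).const_mul _)
  have hfinal : ∫ x in Ω, (2 * inner ℝ (G x) (H x) + ‖H x‖ ^ 2 + 2 * inner ℝ (∇ W' x) (Hξ x))
      ≤ ∫ x in Ω, (2 * t * inner ℝ (G x) (∇ φ x) + t ^ 2 * ‖∇ φ x‖ ^ 2) := by
    refine integral_mono_ae (hint1.add ((hWi.restrict).const_mul 2)) hint2 ?_
    filter_upwards [ae_restrict_of_ae hHpt, ae_restrict_of_ae hAK] with x hx hxK
    by_cases hxA : x ∈ A
    · have h1 : Hξ x = t • ∇ φ x - (∇ W' x - G x) := by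
        simp [hHξ_def, hxA, (hpK x (hxK hxA)).2, hgW x (hφD (hxK hxA))]
      rw [hx, if_pos hxA, h1]
      have := variation_pointwise (G x) (∇ φ x) (∇ W' x - G x) t
      rwa [add_sub_cancel] at this
    · have h1 : Hξ x = 0 := by simp [hHξ_def, hxA]
      rw [hx, if_neg hxA, h1, inner_zero_right, inner_smul_right, norm_smul, mul_pow,
        Real.norm_eq_abs, sq_abs]
      apply le_of_eq
      ring
  have h2W : Integrable (fun x => 2 * inner ℝ (∇ W' x) (Hξ x)) (volume.restrict Ω) :=
    (hWi.restrict).const_mul 2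
  rw [integral_add hint1 h2W, integral_const_mul] at hfinal
  linarith

end Variation

/-! ### One-phase regions -/

section OnePhase

open Filter InnerProductSpace

variable {m : ℕ} {Ω B : Set (Space m)} {V W u : Space m → ℝ} {G : Space m → Space m} {Λ : ℝ≥0}

/-- The problem is invariant under the reflection that exchanges the two phases. -/
theorem IsConstrainedMinimizer.neg (hu : IsConstrainedMinimizer Ω V W u G) :
    IsConstrainedMinimizer Ω (fun x => - W x) (fun x => - V x) (fun x => - u x)
      (fun x => - G x) := by
  have he : ∀ (v : Space m → ℝ) (H : Space m → Space m),
      energy Ω (fun x => - v x) (fun x => - H x) = energy Ω v H := fun v H => by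
    simp [energy]
  refine ⟨⟨hu.1.1.neg, hu.1.2.mono fun x hx => ⟨neg_le_neg hx.2, neg_le_neg hx.1⟩⟩,
    fun v H hv => ?_⟩
  rw [he, ← he v H]
  exact hu.2 _ _ ⟨hv.1.neg, hv.2.mono fun x hx => ⟨by linarith [hx.2], by linarith [hx.1]⟩⟩

/-- The minimizer `u` in an open set `B` in which the upper obstacle stays below `1`, so that only
the phase `{u = -1}` can occur there. The obstacles are used only through the properties that
survive the reflection `(V, W, u) ↦ (-W, -V, -u)`. -/
structure OnePhase (Ω B : Set (Space m)) (V W u : Space m → ℝ) (G : Space m → Space m)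
    (Λ : ℝ≥0) : Prop where
  bounded : Bornology.IsBounded Ω
  minimizer : IsConstrainedMinimizer Ω V W u G
  isOpen : IsOpen B
  subset : B ⊆ Ω
  lipschitz_V : LipschitzOnWith Λ V B
  lipschitz_W : LipschitzOnWith Λ W B
  neg_one_le : ∀ x ∈ B, -1 ≤ V x
  lt_one : ∀ x ∈ B, W x < 1
  smooth_V : ∀ x ∈ B, -1 < V x → ContDiffAt ℝ 2 V x ∧ 0 ≤ Δ V x
  smooth_W : ∀ x ∈ B, -1 < W x → ContDiffAt ℝ 2 W x ∧ Δ W x ≤ 0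

/-- The first variation is read off from quadratic inequalities for all `t ≥ 0`. -/
theorem nonneg_of_forall_pos_quadratic {a b : ℝ} (hb : 0 ≤ b)
    (h : ∀ t : ℝ, 0 ≤ t → 0 ≤ 2 * t * a + t ^ 2 * b) : 0 ≤ a := by
  by_contra! ha
  -- almost the minimum point `-a / b` of the quadratic, without a division by zero
  have h1 := h (-a / (b + 1)) (div_nonneg (by linarith) (by linarith))
  have h2 : 2 * (-a / (b + 1)) * a + (-a / (b + 1)) ^ 2 * b
      = -(a ^ 2 * (b + 2)) / (b + 1) ^ 2 := by
    field_simp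
    ring
  rw [h2] at h1
  have : 0 < a ^ 2 * (b + 2) / (b + 1) ^ 2 := by
    have := ha.ne
    positivity
  rw [neg_div] at h1
  linarith

namespace OnePhase

variable {φ : Space m → ℝ}

theorem bounds (h : OnePhase Ω B V W u G Λ) :
    ∀ᵐ x ∂(volume.restrict Ω), x ∈ B → -1 ≤ u x ∧ u x < 1 ∧ V x ≤ u x ∧ u x ≤ W x := by
  filter_upwards [h.minimizer.1.2] with x hx hxB
  exact ⟨(h.neg_one_le x hxB).trans hx.1, hx.2.trans_lt (h.lt_one x hxB), hx⟩

theorem integral_expand (h : OnePhase Ω B V W u G Λ) (hφ : ContDiff ℝ ∞ φ)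
    (hφc : HasCompactSupport φ) (t : ℝ) :
    ∫ x in Ω, (2 * t * inner ℝ (G x) (∇ φ x) + t ^ 2 * ‖∇ φ x‖ ^ 2)
      = 2 * t * (∫ x in Ω, inner ℝ (G x) (∇ φ x)) + t ^ 2 * ∫ x in Ω, ‖∇ φ x‖ ^ 2 := by
  have hfin := isFiniteMeasure_restrict_of_isBounded h.bounded
  have hφ2 : MemLp (∇ φ) 2 (volume.restrict Ω) :=
    memLp_of_hasCompactSupport (continuous_gradient (hφ.of_le (by simp)))
      (hφc.mono' fun x hx => by
        by_contra h
        exact hx (gradient_eq_zero_of_notMem_tsupport h))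
  rw [integral_add ((integrable_inner_of_memLp h.minimizer.1.1.memLp_grad hφ2).const_mul _)
    ((hφ2.integrable_norm_pow (p := 2) two_ne_zero).const_mul _), integral_const_mul,
    integral_const_mul]

/-- `u` is weakly subharmonic in `B`: downward variations of `u` are upward variations of `-u`, and
they do not add volume to `{|u| < 1}`, since `u` is below `1` already. -/
theorem integral_nonpos (h : OnePhase Ω B V W u G Λ) (hφ : ContDiff ℝ ∞ φ)
    (hφc : HasCompactSupport φ) (hφB : tsupport φ ⊆ B) (hφ0 : ∀ x, 0 ≤ φ x) :
    ∫ x in Ω, inner ℝ (G x) (∇ φ x) ≤ 0 := by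
  have key : ∀ t : ℝ, 0 ≤ t → -0 ≤ ∫ x in Ω,
      (2 * t * inner ℝ (- G x) (∇ φ x) + t ^ 2 * ‖∇ φ x‖ ^ 2) := by
    intro t ht
    refine h.minimizer.neg.variation_up h.bounded h.isOpen h.subset h.lipschitz_V.neg hφ hφc hφB
      hφ0 ht (fun ξ H hξ hξ0 hξK => ?_) (fun ζ hζ => ?_)
    · have hgr : ∀ x, ∇ (fun x => - V x) x = - ∇ (fun x => V x + 1) x := by
        intro x
        rw [gradient, gradient, fderiv_fun_neg, fderiv_add_const, map_neg]
      simp only [hgr, inner_neg_left, integral_neg, Left.nonneg_neg_iff]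
      have hΔ : ∀ x ∈ B, -1 < V x → 0 ≤ Δ (fun x => V x + 1) x := by
        intro x hx hV
        rw [laplacian_eq_sum_fderiv]
        have : fderiv ℝ (fun x => V x + 1) = fderiv ℝ V := by
          ext1 y
          rw [fderiv_add_const]
        rw [this, ← laplacian_eq_sum_fderiv]
        exact (h.smooth_V x hx hV).2
      refine integral_inner_gradient_nonpos_of_laplacian_nonneg (f := fun x => V x + 1) (Λ := Λ)
        hφc h.isOpen hφB ?_ (fun x hx => by linarith [h.neg_one_le x hx])
        (fun x hx hV => (h.smooth_V x hx (by linarith)).1.add contDiffAt_const)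
        (fun x hx hV => hΔ x hx (by linarith)) hξ hξ0 hξK
      exact h.lipschitz_V.add (LipschitzWith.const (1 : ℝ)).lipschitzOnWith |>.weaken (by simp)
    · refine le_of_eq ?_
      rw [measureReal_eq_zero_iff (by
        have := isFiniteMeasure_restrict_of_isBounded h.bounded
        exact measure_ne_top _ _)]
      rw [measure_eq_zero_iff_ae_notMem]
      filter_upwards [hζ, h.bounds] with x hx hx2 hcon
      by_cases hK : x ∈ tsupport φ
      · obtain ⟨h1, h2, -⟩ := hx2 (hφB hK)
        have h3 := hcon.2
        rw [abs_neg, abs_lt, not_and_or] at h3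
        have h4 := (abs_lt.1 hcon.1).2
        rcases h3 with h3 | h3 <;> linarith [hx.1]
      · rw [hx.2.2 hK, add_zero] at hcon
        exact hcon.2 hcon.1
  have h1 : 0 ≤ - ∫ x in Ω, inner ℝ (G x) (∇ φ x) := by
    refine nonneg_of_forall_pos_quadratic (b := ∫ x in Ω, ‖∇ φ x‖ ^ 2)
      (integral_nonneg fun x => by positivity) fun t ht => ?_
    have h2 := key t ht
    have h3 := h.integral_expand hφ hφc (-t)
    have h4 : ∫ x in Ω, (2 * t * inner ℝ (- G x) (∇ φ x) + t ^ 2 * ‖∇ φ x‖ ^ 2)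
        = ∫ x in Ω, (2 * -t * inner ℝ (G x) (∇ φ x) + (-t) ^ 2 * ‖∇ φ x‖ ^ 2) := by
      congr 1
      ext x
      rw [inner_neg_left]
      ring
    rw [h4, h3] at h2
    linarith
  linarith

/-- The upper bound on the mass of `Δu`: near a point where the upper obstacle is above `-1`,
upward variations cost at most the volume of the support. -/
theorem le_integral (h : OnePhase Ω B V W u G Λ) (hφ : ContDiff ℝ ∞ φ)
    (hφc : HasCompactSupport φ) (hφB : tsupport φ ⊆ B) (hφ0 : ∀ x, 0 ≤ φ x)
    (hφW : ∀ x ∈ tsupport φ, -1 < W x) {M : ℝ}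
    (hM : ∀ ζ : Space m → ℝ, (∀ᵐ x ∂(volume.restrict Ω),
      0 ≤ ζ x ∧ u x + ζ x ≤ W x ∧ (x ∉ tsupport φ → ζ x = 0)) →
      (volume.restrict Ω).real {x | |u x + ζ x| < 1 ∧ ¬ |u x| < 1} ≤ M) {t : ℝ} (ht : 0 ≤ t) :
    -M ≤ 2 * t * (∫ x in Ω, inner ℝ (G x) (∇ φ x)) + t ^ 2 * ∫ x in Ω, ‖∇ φ x‖ ^ 2 := by
  rw [← h.integral_expand hφ hφc t]
  refine h.minimizer.variation_up h.bounded h.isOpen h.subset h.lipschitz_W hφ hφc hφB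
    hφ0 ht (fun ξ H hξ hξ0 hξK => ?_) hM
  refine integral_inner_gradient_nonneg_of_laplacian_nonpos hφc (U := B ∩ {x | -1 < W x}) ?_
    (fun x hx => ⟨hφB hx, hφW x hx⟩) (fun x hx => (h.smooth_W x hx.1 hx.2).1)
    (fun x hx => (h.smooth_W x (hφB hx) (hφW x hx)).2) hξ hξ0 hξK
  exact h.lipschitz_W.continuousOn.isOpen_inter_preimage h.isOpen isOpen_Ioi

/-- The crude bound: the volume added to `{|u| < 1}` is at most that of the support. -/
theorem neg_measure_le_integral (h : OnePhase Ω B V W u G Λ) (hφ : ContDiff ℝ ∞ φ)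
    (hφc : HasCompactSupport φ) (hφB : tsupport φ ⊆ B) (hφ0 : ∀ x, 0 ≤ φ x)
    (hφW : ∀ x ∈ tsupport φ, -1 < W x) {t : ℝ} (ht : 0 ≤ t) :
    -volume.real (tsupport φ)
      ≤ 2 * t * (∫ x in Ω, inner ℝ (G x) (∇ φ x)) + t ^ 2 * ∫ x in Ω, ‖∇ φ x‖ ^ 2 := by
  refine h.le_integral hφ hφc hφB hφ0 hφW (fun ζ hζ => ?_) ht
  have hle : (volume.restrict Ω) {x | |u x + ζ x| < 1 ∧ ¬ |u x| < 1} ≤ volume (tsupport φ) := by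
    refine (measure_mono_ae ?_).trans (Measure.restrict_le_self (s := Ω) (tsupport φ))
    filter_upwards [hζ] with x hx hcon
    by_contra hK
    have h1 : ζ x = 0 := hx.2.2 hK
    obtain ⟨h2, h3⟩ := hcon
    rw [h1, add_zero] at h2
    exact h3 h2
  exact ENNReal.toReal_mono hφc.measure_lt_top.ne hle

/-- `u` is weakly superharmonic, hence harmonic, where it is above `-1`. -/
theorem integral_nonneg_of_neg_one_lt (h : OnePhase Ω B V W u G Λ) (hφ : ContDiff ℝ ∞ φ)
    (hφc : HasCompactSupport φ) (hφB : tsupport φ ⊆ B) (hφ0 : ∀ x, 0 ≤ φ x)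
    (hφW : ∀ x ∈ tsupport φ, -1 < W x)
    (hφu : ∀ᵐ x ∂(volume.restrict Ω), x ∈ tsupport φ → -1 < u x) :
    0 ≤ ∫ x in Ω, inner ℝ (G x) (∇ φ x) := by
  refine nonneg_of_forall_pos_quadratic (b := ∫ x in Ω, ‖∇ φ x‖ ^ 2)
    (integral_nonneg fun x => by positivity) fun t ht => ?_
  have := h.le_integral hφ hφc hφB hφ0 hφW (M := 0) (fun ζ hζ => le_of_eq ?_) ht
  · linarith
  rw [measureReal_eq_zero_iff (by
    have := isFiniteMeasure_restrict_of_isBounded h.bounded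
    exact measure_ne_top _ _)]
  rw [measure_eq_zero_iff_ae_notMem]
  filter_upwards [hζ, h.bounds, hφu] with x hx hx2 hx3 hcon
  by_cases hK : x ∈ tsupport φ
  · exact hcon.2 (abs_lt.2 ⟨hx3 hK, (hx2 (hφB hK)).2.1⟩)
  · obtain ⟨h2, h3⟩ := hcon
    rw [hx.2.2 hK, add_zero] at h2
    exact h3 h2

end OnePhase

end OnePhase

/-! ### Averages against a radial kernel -/

section Kernel

open Filter InnerProductSpace

/-- A radial averaging kernel `η` together with its potential `Ψ`, which satisfies
`∇Ψ(z) = -η(z) z`. Because of this relation, the derivative in `r` of the average of a function at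
scale `r` is its Laplacian tested with a rescaled copy of `Ψ`. -/
structure RadialKernel (m : ℕ) where
  /-- the potential -/
  Ψ : Space m → ℝ
  /-- the averaging kernel -/
  η : Space m → ℝ
  contDiff_Ψ : ContDiff ℝ ∞ Ψ
  contDiff_η : ContDiff ℝ ∞ η
  Ψ_nonneg : ∀ z, 0 ≤ Ψ z
  η_nonneg : ∀ z, 0 ≤ η z
  Ψ_eq_zero : ∀ z, 1 ≤ ‖z‖ → Ψ z = 0
  η_eq_zero : ∀ z, 1 ≤ ‖z‖ → η z = 0
  fderiv_Ψ : ∀ z v, fderiv ℝ Ψ z v = -(η z * inner ℝ z v)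
  integral_η : ∫ z, η z = 1
  exists_lower : ∃ c > 0, ∀ z, ‖z‖ ≤ 1 / 2 → c ≤ η z

theorem hasDerivAt_expNegInvGlue (t : ℝ) :
    HasDerivAt expNegInvGlue (t⁻¹ ^ 2 * expNegInvGlue t) t := by
  simpa using expNegInvGlue.hasDerivAt_polynomial_eval_inv_mul 1 t

theorem hasCompactSupport_of_eq_zero {m : ℕ} {f : Space m → ℝ} (hf : ∀ z, 1 ≤ ‖z‖ → f z = 0) :
    HasCompactSupport f :=
  HasCompactSupport.of_support_subset_isCompact (isCompact_closedBall 0 1) fun z hz => by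
    by_contra h
    exact hz (hf z (by simpa using (not_le.1 (mt mem_closedBall_zero_iff.2 h)).le))

/-- The potential is a multiple of `exp(-1 / (1 - |z|²))` in the unit ball. -/
theorem nonempty_radialKernel (m : ℕ) : Nonempty (RadialKernel m) := by
  set g : ℝ → ℝ := fun t => t⁻¹ ^ 2 * expNegInvGlue t with hg
  have hgd : g = deriv expNegInvGlue := by
    ext t
    exact (hasDerivAt_expNegInvGlue t).deriv.symm
  have hχ : ContDiff ℝ ∞ expNegInvGlue := expNegInvGlue.contDiff
  have hgs : ContDiff ℝ ∞ g := by
    rw [hgd]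
    exact (contDiff_infty_iff_deriv.1 hχ).2
  have hg0 : ∀ t, 0 ≤ g t := fun t => mul_nonneg (sq_nonneg _) (expNegInvGlue.nonneg t)
  have hgz : ∀ t ≤ 0, g t = 0 := fun t ht => by simp [hg, expNegInvGlue.zero_of_nonpos ht]
  have hgp : ∀ t, 0 < t → 0 < g t := fun t ht => by
    have := expNegInvGlue.pos_of_pos ht
    simp only [hg]
    positivity
  have hN : ContDiff ℝ ∞ fun z : Space m => 1 - ‖z‖ ^ 2 :=
    contDiff_const.sub (contDiff_id.norm_sq ℝ)
  set η₀ : Space m → ℝ := fun z => 2 * g (1 - ‖z‖ ^ 2) with hη₀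
  set Ψ₀ : Space m → ℝ := fun z => expNegInvGlue (1 - ‖z‖ ^ 2) with hΨ₀
  have hη₀s : ContDiff ℝ ∞ η₀ := contDiff_const.mul (hgs.comp hN)
  have hΨ₀s : ContDiff ℝ ∞ Ψ₀ := hχ.comp hN
  have hη₀z : ∀ z, 1 ≤ ‖z‖ → η₀ z = 0 := fun z hz => by
    simp only [hη₀]
    rw [hgz _ (by nlinarith), mul_zero]
  have hη₀n : ∀ z, 0 ≤ η₀ z := fun z => mul_nonneg two_pos.le (hg0 _)
  have hη₀p : ∀ z, ‖z‖ ≤ 1 / 2 → 0 < η₀ z := fun z hz =>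
    mul_pos two_pos (hgp _ (by nlinarith [norm_nonneg z]))
  have hI : 0 < ∫ z, η₀ z :=
    hη₀s.continuous.integral_pos_of_hasCompactSupport_nonneg_nonzero
      (hasCompactSupport_of_eq_zero hη₀z) hη₀n (x := 0) (hη₀p 0 (by simp)).ne'
  set I := ∫ z, η₀ z
  refine ⟨⟨fun z => I⁻¹ * Ψ₀ z, fun z => I⁻¹ * η₀ z, contDiff_const.mul hΨ₀s,
    contDiff_const.mul hη₀s, fun z => mul_nonneg (inv_nonneg.2 hI.le) (expNegInvGlue.nonneg _),
    fun z => mul_nonneg (inv_nonneg.2 hI.le) (hη₀n z), fun z hz => ?_, fun z hz => ?_,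
    fun z v => ?_, ?_, ?_⟩⟩
  · simp only [hΨ₀]
    rw [expNegInvGlue.zero_of_nonpos (by nlinarith), mul_zero]
  · rw [hη₀z z hz, mul_zero]
  · have h1 : HasFDerivAt (fun z : Space m => 1 - ‖z‖ ^ 2)
        (-((2 : ℕ) • (innerSL ℝ z : Space m →L[ℝ] ℝ))) z :=
      (hasStrictFDerivAt_norm_sq z).hasFDerivAt.const_sub 1
    have h2 : HasFDerivAt Ψ₀ (g (1 - ‖z‖ ^ 2) •
        -((2 : ℕ) • (innerSL ℝ z : Space m →L[ℝ] ℝ))) z :=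
      HasDerivAt.comp_hasFDerivAt (h₂ := expNegInvGlue) (f := fun z : Space m => 1 - ‖z‖ ^ 2) z
        (hasDerivAt_expNegInvGlue _) h1
    rw [(h2.const_mul I⁻¹).fderiv]
    simp [hη₀]
    ring
  · rw [integral_const_mul, inv_mul_cancel₀ hI.ne']
  · obtain ⟨z₀, hz₀, hmin⟩ := (isCompact_closedBall (0 : Space m) (1 / 2)).exists_isMinOn
      ⟨0, by simp⟩ hη₀s.continuous.continuousOn
    refine ⟨I⁻¹ * η₀ z₀, mul_pos (inv_pos.2 hI) (hη₀p z₀ (by simpa using hz₀)), fun z hz => ?_⟩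
    exact mul_le_mul_of_nonneg_left (hmin (by simpa using hz)) (inv_nonneg.2 hI.le)

namespace RadialKernel

variable {m : ℕ} (k : RadialKernel m) {Ω : Set (Space m)} {u : Space m → ℝ}
  {G : Space m → Space m}

theorem hasCompactSupport_η : HasCompactSupport k.η := hasCompactSupport_of_eq_zero k.η_eq_zero

theorem hasCompactSupport_Ψ : HasCompactSupport k.Ψ := hasCompactSupport_of_eq_zero k.Ψ_eq_zero

/-- The average of `u` around `x` at scale `r`. It is the mean of `u` with respect to a probability
measure only if the ball of radius `r` about `x` lies in `Ω`; elsewhere `u` is cut off. -/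
noncomputable def avg (Ω : Set (Space m)) (u : Space m → ℝ) (x : Space m) (r : ℝ) : ℝ :=
  ∫ y in Ω, u y * ((r ^ (m + 1))⁻¹ * k.η (r⁻¹ • (y - x)))

/-- The potential, rescaled to the ball of radius `r` about `x`. -/
noncomputable def test (x : Space m) (r : ℝ) (y : Space m) : ℝ := k.Ψ (r⁻¹ • (y - x))

theorem test_nonneg (x : Space m) (r : ℝ) (y : Space m) : 0 ≤ k.test x r y := k.Ψ_nonneg _

theorem norm_inv_smul {r : ℝ} (hr : 0 < r) (x y : Space m) :
    ‖r⁻¹ • (y - x)‖ = dist y x / r := by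
  rw [norm_smul, norm_inv, Real.norm_of_nonneg hr.le, dist_eq_norm, div_eq_inv_mul]

theorem η_smul_eq_zero {r : ℝ} (hr : 0 < r) {x y : Space m} (hy : r ≤ dist y x) :
    k.η (r⁻¹ • (y - x)) = 0 :=
  k.η_eq_zero _ (by rw [norm_inv_smul hr]; exact (one_le_div hr).2 hy)

theorem tsupport_test {r : ℝ} (hr : 0 < r) (x : Space m) :
    tsupport (k.test x r) ⊆ Metric.closedBall x r := by
  refine closure_minimal (fun y hy => ?_) Metric.isClosed_closedBall
  by_contra h
  exact hy (k.Ψ_eq_zero _ (by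
    rw [norm_inv_smul hr]
    exact (one_le_div hr).2 (not_le.1 (mt Metric.mem_closedBall.2 h)).le))

theorem hasCompactSupport_test {r : ℝ} (hr : 0 < r) (x : Space m) :
    HasCompactSupport (k.test x r) :=
  (isCompact_closedBall x r).of_isClosed_subset (isClosed_tsupport _) (k.tsupport_test hr x)

theorem contDiff_test (x : Space m) (r : ℝ) : ContDiff ℝ ∞ (k.test x r) :=
  k.contDiff_Ψ.comp (g := k.Ψ) (f := fun y : Space m => r⁻¹ • (y - x)) (by fun_prop)

theorem hasFDerivAt_smul_sub (x y : Space m) (r : ℝ) :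
    HasFDerivAt (fun y : Space m => r⁻¹ • (y - x)) (r⁻¹ • ContinuousLinearMap.id ℝ (Space m)) y :=
  ((hasFDerivAt_id y).sub_const x).const_smul r⁻¹

theorem gradient_test (x y : Space m) (r : ℝ) :
    ∇ (k.test x r) y = -(r⁻¹ ^ 2 * k.η (r⁻¹ • (y - x))) • (y - x) := by
  refine ext_inner_right ℝ fun v => ?_
  have h1 : HasFDerivAt k.Ψ (fderiv ℝ k.Ψ (r⁻¹ • (y - x))) (r⁻¹ • (y - x)) :=
    (k.contDiff_Ψ.differentiable (by simp) _).hasFDerivAt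
  have h2 : HasFDerivAt (k.test x r) _ y := h1.comp y (hasFDerivAt_smul_sub x y r)
  rw [inner_gradient_left, h2.fderiv]
  simp only [ContinuousLinearMap.comp_apply, smul_apply, ContinuousLinearMap.id_apply, k.fderiv_Ψ,
    real_inner_smul_left, real_inner_smul_right]
  ring

/-- The `r`-derivative of the kernel is the divergence of the field `η((y - x) / r) (y - x)`; this
is the weak form of that identity. -/
theorem integral_mul_divergence (hu : MemH1 Ω u G) (hΩ : Bornology.IsBounded Ω) {x : Space m}
    {r : ℝ} (hr : 0 < r) (hball : Metric.closedBall x r ⊆ Ω) :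
    ∫ y in Ω, u y * ((m + 1) * k.η (r⁻¹ • (y - x))
        + fderiv ℝ k.η (r⁻¹ • (y - x)) (r⁻¹ • (y - x)))
      = r ^ 2 * ∫ y in Ω, inner ℝ (G y) (∇ (k.test x r) y) := by
  have hfin := isFiniteMeasure_restrict_of_isBounded hΩ
  let b := EuclideanSpace.basisFun (Fin (m + 1)) ℝ
  let q : Fin (m + 1) → Space m → ℝ := fun i y => k.η (r⁻¹ • (y - x)) * inner ℝ (b i) (y - x)
  have hqs : ∀ i, ContDiff ℝ ∞ (q i) := fun i =>
    (k.contDiff_η.comp (g := k.η) (f := fun y : Space m => r⁻¹ • (y - x)) (by fun_prop)).mul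
      (contDiff_const.inner ℝ (by fun_prop : ContDiff ℝ ∞ fun y : Space m => y - x))
  have hqt : ∀ i, tsupport (q i) ⊆ Metric.closedBall x r := fun i => by
    refine closure_minimal (fun y hy => ?_) Metric.isClosed_closedBall
    by_contra h
    refine hy ?_
    simp only [q]
    rw [k.η_smul_eq_zero hr (not_le.1 (mt Metric.mem_closedBall.2 h)).le, zero_mul]
  have hqc : ∀ i, HasCompactSupport (q i) := fun i =>
    (isCompact_closedBall x r).of_isClosed_subset (isClosed_tsupport _) (hqt i)
  have hqd : ∀ i y, fderiv ℝ (q i) y (b i)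
      = fderiv ℝ k.η (r⁻¹ • (y - x)) (inner ℝ (b i) (r⁻¹ • (y - x)) • b i)
        + k.η (r⁻¹ • (y - x)) := by
    intro i y
    have h1 : HasFDerivAt k.η (fderiv ℝ k.η (r⁻¹ • (y - x))) (r⁻¹ • (y - x)) :=
      (k.contDiff_η.differentiable (by simp) _).hasFDerivAt
    have h2 : HasFDerivAt (fun y => k.η (r⁻¹ • (y - x))) _ y :=
      h1.comp y (hasFDerivAt_smul_sub x y r)
    have h3 : HasFDerivAt (fun y : Space m => inner ℝ (b i) (y - x)) (innerSL ℝ (b i)) y :=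
      (innerSL ℝ (b i)).hasFDerivAt.comp y ((hasFDerivAt_id y).sub_const x)
    have h4 : HasFDerivAt (q i) _ y := h2.mul h3
    rw [h4.fderiv]
    simp only [add_apply, smul_apply, ContinuousLinearMap.comp_apply, innerSL_apply_apply,
      ContinuousLinearMap.id_apply, smul_eq_mul, map_smul, real_inner_smul_right,
      real_inner_self_eq_norm_sq, b.norm_eq_one]
    ring
  have hsum : ∀ y, (m + 1 : ℝ) * k.η (r⁻¹ • (y - x))
      + fderiv ℝ k.η (r⁻¹ • (y - x)) (r⁻¹ • (y - x)) = ∑ i, fderiv ℝ (q i) y (b i) := by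
    intro y
    simp only [hqd, Finset.sum_add_distrib, ← map_sum, b.sum_repr']
    simp
    ring
  have hi1 : ∀ i, Integrable (fun y => u y * fderiv ℝ (q i) y (b i)) (volume.restrict Ω) :=
    fun i => hu.memLp.integrable_mul (memLp_fderiv_apply (hqs i) (hqc i) (b i))
  have hi2 : ∀ i, Integrable (fun y => q i y * inner ℝ (G y) (b i)) (volume.restrict Ω) :=
    fun i => (memLp_of_hasCompactSupport (hqs i).continuous (hqc i)).integrable_mul
      (hu.memLp_grad.inner_const (b i))
  simp only [hsum, Finset.mul_sum]
  rw [integral_finsetSum _ fun i _ => hi1 i, ← integral_const_mul]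
  have h5 : ∀ i, ∫ y in Ω, u y * fderiv ℝ (q i) y (b i)
      = - ∫ y in Ω, q i y * inner ℝ (G y) (b i) := fun i =>
    hu.weak_grad (q i) (hqs i) (hqc i) ((hqt i).trans hball) (b i)
  simp only [h5]
  rw [Finset.sum_neg_distrib, ← integral_finsetSum _ fun i _ => hi2 i, ← integral_neg]
  congr 1
  ext y
  rw [k.gradient_test, inner_smul_right]
  have h6 : inner ℝ (G y) (y - x) = ∑ i, inner ℝ (b i) (y - x) * inner ℝ (G y) (b i) := by
    conv_lhs => rw [← b.sum_repr' (y - x), inner_sum]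
    simp [inner_smul_right]
  rw [h6]
  simp only [q, mul_assoc, ← Finset.mul_sum]
  field_simp

/-- The derivative of the averages in the radius is the distributional Laplacian of `u`, tested
with the rescaled potential. -/
theorem hasDerivAt_avg (hu : MemH1 Ω u G) (hΩ : Bornology.IsBounded Ω) {x : Space m}
    {r : ℝ} (hr : 0 < r) (hball : Metric.closedBall x r ⊆ Ω) :
    HasDerivAt (k.avg Ω u x) (-((r ^ m)⁻¹ * ∫ y in Ω, inner ℝ (G y) (∇ (k.test x r) y))) r := by
  have hfin := isFiniteMeasure_restrict_of_isBounded hΩ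
  set N : Space m → ℝ := fun z => (m + 1) * k.η z + fderiv ℝ k.η z z with hN
  have hη1 : ContDiff ℝ 1 k.η := k.contDiff_η.of_le (by simp)
  have hNc : Continuous N := (continuous_const.mul hη1.continuous).add
    ((hη1.continuous_fderiv one_ne_zero).clm_apply continuous_id)
  have hNs : HasCompactSupport N := by
    refine k.hasCompactSupport_η.mono' fun z hz => ?_
    by_contra h
    refine hz ?_
    simp only [hN]
    rw [fderiv_eq_zero_of_notMem_tsupport h, image_eq_zero_of_notMem_tsupport h]
    simp
  obtain ⟨C, hC⟩ := hNc.bounded_above_of_compact_support hNs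
  have hu1 : Integrable u (volume.restrict Ω) := hu.memLp.integrable one_le_two
  obtain ⟨C', hC'⟩ := k.contDiff_η.continuous.bounded_above_of_compact_support
    k.hasCompactSupport_η
  have hcont : ∀ s : ℝ, Continuous fun y : Space m => s⁻¹ • (y - x) := fun s => by fun_prop
  have hd : ∀ s : ℝ, 0 < s → ∀ y : Space m,
      HasDerivAt (fun s : ℝ => (s ^ (m + 1))⁻¹ * k.η (s⁻¹ • (y - x)))
        (-(s ^ (m + 2))⁻¹ * N (s⁻¹ • (y - x))) s := by
    intro s hs y
    have h1 : HasDerivAt (fun s : ℝ => (s ^ (m + 1))⁻¹) _ s :=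
      (hasDerivAt_pow (m + 1) s).inv (pow_pos hs _).ne'
    have h2 : HasDerivAt (fun s : ℝ => s⁻¹ • (y - x)) ((-(s ^ 2)⁻¹) • (y - x)) s :=
      (hasDerivAt_inv hs.ne').smul_const (y - x)
    have h3 : HasDerivAt (fun s : ℝ => k.η (s⁻¹ • (y - x)))
        (fderiv ℝ k.η (s⁻¹ • (y - x)) ((-(s ^ 2)⁻¹) • (y - x))) s :=
      (hη1.differentiable one_ne_zero (s⁻¹ • (y - x))).hasFDerivAt.comp_hasDerivAt s h2
    refine (h1.mul h3).congr_deriv ?_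
    simp only [hN, map_smul, smul_eq_mul]
    push_cast
    field_simp
    ring
  have hmain := hasDerivAt_integral_of_dominated_loc_of_deriv_le (μ := volume.restrict Ω)
    (F := fun s y => u y * ((s ^ (m + 1))⁻¹ * k.η (s⁻¹ • (y - x))))
    (F' := fun s y => u y * (-(s ^ (m + 2))⁻¹ * N (s⁻¹ • (y - x))))
    (x₀ := r) (s := Ioi (r / 2)) (bound := fun y => ‖u y‖ * (((r / 2) ^ (m + 2))⁻¹ * C))
    (Ioi_mem_nhds (by linarith)) (Eventually.of_forall fun s => ?_) ?_ ?_ ?_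
    (hu1.norm.mul_const _) ?_
  · refine hmain.2.congr_deriv ?_
    have h1 := k.integral_mul_divergence hu hΩ hr hball
    have h2 : ∫ y in Ω, u y * (-(r ^ (m + 2))⁻¹ * N (r⁻¹ • (y - x)))
        = -(r ^ (m + 2))⁻¹ * ∫ y in Ω, u y * N (r⁻¹ • (y - x)) := by
      rw [← integral_const_mul]
      congr 1
      ext y
      ring
    rw [h2, h1]
    field_simp
    ring
  · exact hu1.aestronglyMeasurable.mul
      ((continuous_const.mul (k.contDiff_η.continuous.comp (hcont s))).aestronglyMeasurable)
  · refine hu1.mul_bdd (c := (r ^ (m + 1))⁻¹ * C')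
      ((continuous_const.mul (k.contDiff_η.continuous.comp (hcont r))).aestronglyMeasurable)
      (Eventually.of_forall fun y => ?_)
    rw [norm_mul, Real.norm_of_nonneg (by positivity)]
    exact mul_le_mul_of_nonneg_left (hC' _) (by positivity)
  · exact hu1.aestronglyMeasurable.mul
      ((continuous_const.mul (hNc.comp (hcont r))).aestronglyMeasurable)
  · refine Eventually.of_forall fun y s hs => ?_
    have hs0 : 0 < s := (half_pos hr).trans hs
    rw [norm_mul, norm_mul, norm_neg, Real.norm_of_nonneg (by positivity : 0 ≤ (s ^ (m + 2))⁻¹)]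
    refine mul_le_mul_of_nonneg_left (mul_le_mul ?_ (hC _) (norm_nonneg _) (by positivity))
      (norm_nonneg _)
    exact inv_anti₀ (by positivity) (pow_le_pow_left₀ (by positivity) (le_of_lt hs) _)
  · exact Eventually.of_forall fun y s hs => (hd s ((half_pos hr).trans hs) y).const_mul _

end RadialKernel

end Kernel

/-! ### Comparison of averages -/

section Averages

open Filter InnerProductSpace

namespace RadialKernel

variable {m : ℕ} (k : RadialKernel m) {Ω : Set (Space m)} {u : Space m → ℝ}
  {G : Space m → Space m}

theorem continuous_kernel (x : Space m) (r : ℝ) :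
    Continuous fun y : Space m => (r ^ (m + 1))⁻¹ * k.η (r⁻¹ • (y - x)) :=
  continuous_const.mul (k.contDiff_η.continuous.comp (by fun_prop))

theorem kernel_nonneg (x y : Space m) {r : ℝ} (hr : 0 < r) :
    0 ≤ (r ^ (m + 1))⁻¹ * k.η (r⁻¹ • (y - x)) :=
  mul_nonneg (by positivity) (k.η_nonneg _)

theorem kernel_eq_zero {x y : Space m} {r : ℝ} (hr : 0 < r) (hy : y ∉ Metric.closedBall x r) :
    (r ^ (m + 1))⁻¹ * k.η (r⁻¹ • (y - x)) = 0 := by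
  rw [k.η_smul_eq_zero hr (not_le.1 (mt Metric.mem_closedBall.2 hy)).le, mul_zero]

theorem exists_upper : ∃ S > 0, ∀ z, k.η z ≤ S := by
  obtain ⟨C, hC⟩ := k.contDiff_η.continuous.bounded_above_of_compact_support k.hasCompactSupport_η
  refine ⟨max C 1, by positivity, fun z => ?_⟩
  exact (le_abs_self _).trans ((hC z).trans (le_max_left _ _))

theorem integrable_mul_kernel {μ : Measure (Space m)} (hu : Integrable u μ) (x : Space m)
    {r : ℝ} (hr : 0 < r) :
    Integrable (fun y => u y * ((r ^ (m + 1))⁻¹ * k.η (r⁻¹ • (y - x)))) μ := by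
  obtain ⟨S, hS, hηS⟩ := k.exists_upper
  refine hu.mul_bdd (c := (r ^ (m + 1))⁻¹ * S) (k.continuous_kernel x r).aestronglyMeasurable
    (Eventually.of_forall fun y => ?_)
  rw [Real.norm_of_nonneg (k.kernel_nonneg x y hr)]
  exact mul_le_mul_of_nonneg_left (hηS _) (by positivity)

theorem integral_kernel (x : Space m) {r : ℝ} (hr : 0 < r) :
    ∫ y, (r ^ (m + 1))⁻¹ * k.η (r⁻¹ • (y - x)) = 1 := by
  rw [integral_const_mul, integral_sub_right_eq_self (fun y => k.η (r⁻¹ • y)) x,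
    Measure.integral_comp_inv_smul_of_nonneg volume k.η hr.le, k.integral_η]
  simp only [finrank_euclideanSpace, Fintype.card_fin, smul_eq_mul, mul_one]
  exact inv_mul_cancel₀ (by positivity)

theorem avg_const (c : ℝ) {x : Space m} {r : ℝ} (hr : 0 < r) (hball : Metric.closedBall x r ⊆ Ω) :
    k.avg Ω (fun _ => c) x r = c := by
  unfold avg
  rw [setIntegral_eq_integral_of_forall_compl_eq_zero, integral_const_mul, k.integral_kernel x hr,
    mul_one]
  intro y hy
  rw [k.kernel_eq_zero hr fun h => hy (hball h), mul_zero]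

theorem avg_mono {v : Space m → ℝ} (hu : Integrable u (volume.restrict Ω))
    (hv : Integrable v (volume.restrict Ω)) {x : Space m} {r : ℝ} (hr : 0 < r)
    (huv : ∀ᵐ y ∂(volume.restrict Ω), y ∈ Metric.closedBall x r → u y ≤ v y) :
    k.avg Ω u x r ≤ k.avg Ω v x r := by
  refine integral_mono_ae (k.integrable_mul_kernel hu x hr) (k.integrable_mul_kernel hv x hr) ?_
  filter_upwards [huv] with y hy
  by_cases h : y ∈ Metric.closedBall x r
  · exact mul_le_mul_of_nonneg_right (hy h) (k.kernel_nonneg x y hr)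
  · rw [k.kernel_eq_zero hr h, mul_zero, mul_zero]

theorem avg_le [IsFiniteMeasure (volume.restrict Ω)] (hu : Integrable u (volume.restrict Ω))
    {x : Space m} {r c : ℝ} (hr : 0 < r) (hball : Metric.closedBall x r ⊆ Ω)
    (huc : ∀ᵐ y ∂(volume.restrict Ω), y ∈ Metric.closedBall x r → u y ≤ c) :
    k.avg Ω u x r ≤ c :=
  (k.avg_mono hu (integrable_const c) hr huc).trans_eq (k.avg_const c hr hball)

theorem le_avg [IsFiniteMeasure (volume.restrict Ω)] (hu : Integrable u (volume.restrict Ω))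
    {x : Space m} {r c : ℝ} (hr : 0 < r) (hball : Metric.closedBall x r ⊆ Ω)
    (huc : ∀ᵐ y ∂(volume.restrict Ω), y ∈ Metric.closedBall x r → c ≤ u y) :
    c ≤ k.avg Ω u x r :=
  (k.avg_const c hr hball).symm.trans_le (k.avg_mono (integrable_const c) hu hr huc)

theorem avg_add_one [IsFiniteMeasure (volume.restrict Ω)] (hu : Integrable u (volume.restrict Ω))
    {x : Space m} {r : ℝ} (hr : 0 < r) (hball : Metric.closedBall x r ⊆ Ω) :
    k.avg Ω (fun y => u y + 1) x r = k.avg Ω u x r + 1 := by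
  have h1 := k.avg_const 1 hr hball
  unfold avg at h1 ⊢
  simp only [add_mul]
  rw [integral_add (k.integrable_mul_kernel hu x hr)
    (k.integrable_mul_kernel (integrable_const 1) x hr), h1]

/-- Averages of a nonnegative function over a ball are controlled by averages over a larger one. -/
theorem exists_avg_le_avg : ∃ C > 0, ∀ (Ω : Set (Space m)) (v : Space m → ℝ) (x y : Space m)
    (r s : ℝ), Integrable v (volume.restrict Ω) → 0 < r → dist x y + r ≤ s / 2 →
    (∀ᵐ z ∂(volume.restrict Ω), z ∈ Metric.closedBall y s → 0 ≤ v z) →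
    k.avg Ω v x r ≤ C * (s / r) ^ (m + 1) * k.avg Ω v y s := by
  obtain ⟨S, hS, hηS⟩ := k.exists_upper
  obtain ⟨c, hc, hηc⟩ := k.exists_lower
  refine ⟨S / c, div_pos hS hc, fun Ω v x y r s hv hr hrs hv0 => ?_⟩
  have hs : 0 < s := by linarith [dist_nonneg (x := x) (y := y)]
  unfold avg
  rw [← integral_const_mul]
  refine integral_mono_ae (k.integrable_mul_kernel hv x hr)
    ((k.integrable_mul_kernel hv y hs).const_mul _) ?_
  filter_upwards [hv0] with z hz
  by_cases hzx : z ∈ Metric.closedBall x r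
  · have hzy : dist z y ≤ s / 2 :=
      (dist_triangle z x y).trans (by linarith [Metric.mem_closedBall.1 hzx])
    have h1 : c ≤ k.η (s⁻¹ • (z - y)) := by
      refine hηc _ ?_
      rw [norm_inv_smul hs, div_le_iff₀ hs]
      linarith
    have h2 : (r ^ (m + 1))⁻¹ * k.η (r⁻¹ • (z - x))
        ≤ S / c * (s / r) ^ (m + 1) * ((s ^ (m + 1))⁻¹ * k.η (s⁻¹ • (z - y))) := by
      have h3 : S / c * (s / r) ^ (m + 1) * ((s ^ (m + 1))⁻¹ * k.η (s⁻¹ • (z - y)))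
          = (r ^ (m + 1))⁻¹ * (S * (k.η (s⁻¹ • (z - y)) / c)) := by
        rw [div_pow]
        field_simp
      rw [h3]
      refine mul_le_mul_of_nonneg_left ((hηS _).trans ?_) (by positivity)
      exact le_mul_of_one_le_right hS.le ((one_le_div hc).2 h1)
    have h4 := mul_le_mul_of_nonneg_left h2 (hz (Metric.mem_closedBall.2 (by linarith)))
    linarith
  · rw [k.kernel_eq_zero hr hzx, mul_zero]
    by_cases hzy : z ∈ Metric.closedBall y s
    · exact mul_nonneg (by positivity) (mul_nonneg (hz hzy) (k.kernel_nonneg y z hs))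
    · rw [k.kernel_eq_zero hs hzy, mul_zero, mul_zero]

/-- Lipschitz dependence of the averages on the centre, relative to an average over a larger
ball. -/
theorem exists_abs_avg_sub_avg_le : ∃ C > 0, ∀ (Ω : Set (Space m)) (v : Space m → ℝ)
    (x x' : Space m) (r : ℝ), Integrable v (volume.restrict Ω) → 0 < r → dist x x' ≤ r →
    (∀ᵐ z ∂(volume.restrict Ω), z ∈ Metric.closedBall x (4 * r) → 0 ≤ v z) →
    |k.avg Ω v x r - k.avg Ω v x' r| ≤ C * (dist x x' / r) * k.avg Ω v x (4 * r) := by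
  obtain ⟨c, hc, hηc⟩ := k.exists_lower
  obtain ⟨L, hL⟩ := k.contDiff_η.lipschitzWith_of_hasCompactSupport k.hasCompactSupport_η
    (by simp)
  refine ⟨(L + 1) * 4 ^ (m + 1) / c, by positivity, fun Ω v x x' r hv hr hxx hv0 => ?_⟩
  unfold avg
  rw [← integral_sub (k.integrable_mul_kernel hv x hr) (k.integrable_mul_kernel hv x' hr),
    ← integral_const_mul, ← Real.norm_eq_abs]
  refine norm_integral_le_of_norm_le
    ((k.integrable_mul_kernel hv x (by positivity : 0 < 4 * r)).const_mul _) ?_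
  filter_upwards [hv0] with z hz
  rw [← mul_sub, norm_mul, ← mul_sub, norm_mul]
  have h4r : 0 < 4 * r := by positivity
  by_cases hz2 : dist z x ≤ 2 * r
  · have hv1 := hz (Metric.mem_closedBall.2 (by linarith))
    have h1 : c ≤ k.η ((4 * r)⁻¹ • (z - x)) := by
      refine hηc _ ?_
      rw [norm_inv_smul h4r, div_le_iff₀ h4r]
      linarith
    have h2 : ‖k.η (r⁻¹ • (z - x)) - k.η (r⁻¹ • (z - x'))‖ ≤ (L + 1) * (dist x x' / r) := by
      rw [← dist_eq_norm]
      refine (hL.dist_le_mul _ _).trans ?_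
      have : dist (r⁻¹ • (z - x)) (r⁻¹ • (z - x')) = dist x x' / r := by
        rw [dist_eq_norm, ← smul_sub, sub_sub_sub_cancel_left, norm_inv_smul hr, dist_comm]
      rw [this]
      exact mul_le_mul_of_nonneg_right (by linarith) (by positivity)
    have h3 : ‖(r ^ (m + 1))⁻¹‖ * ‖k.η (r⁻¹ • (z - x)) - k.η (r⁻¹ • (z - x'))‖
        ≤ (L + 1) * 4 ^ (m + 1) / c * (dist x x' / r)
          * (((4 * r) ^ (m + 1))⁻¹ * k.η ((4 * r)⁻¹ • (z - x))) := by
      have h5 : (L + 1) * 4 ^ (m + 1) / c * (dist x x' / r)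
          * (((4 * r) ^ (m + 1))⁻¹ * k.η ((4 * r)⁻¹ • (z - x)))
          = (r ^ (m + 1))⁻¹ * ((L + 1) * (dist x x' / r) * (k.η ((4 * r)⁻¹ • (z - x)) / c)) := by
        rw [mul_pow]
        field_simp
      rw [h5, Real.norm_of_nonneg (by positivity)]
      refine mul_le_mul_of_nonneg_left (h2.trans ?_) (by positivity)
      exact le_mul_of_one_le_right (by positivity) ((one_le_div hc).2 h1)
    rw [Real.norm_of_nonneg hv1]
    have h4 := mul_le_mul_of_nonneg_left h3 hv1
    linarith
  · have h1 : k.η (r⁻¹ • (z - x)) = 0 := k.η_smul_eq_zero hr (by linarith)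
    have h2 : k.η (r⁻¹ • (z - x')) = 0 := by
      refine k.η_smul_eq_zero hr ?_
      have := dist_triangle z x' x
      rw [dist_comm x' x] at this
      linarith
    rw [h1, h2, sub_zero, norm_zero, mul_zero, mul_zero]
    by_cases hzx : z ∈ Metric.closedBall x (4 * r)
    · exact mul_nonneg (by positivity) (mul_nonneg (hz hzx) (k.kernel_nonneg x z h4r))
    · rw [k.kernel_eq_zero h4r hzx, mul_zero, mul_zero]

/-- Almost every point is a Lebesgue point. -/
theorem ae_tendsto_avg (hΩ : IsOpen Ω) (hu : Integrable u (volume.restrict Ω)) :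
    ∀ᵐ x ∂(volume.restrict Ω), Tendsto (k.avg Ω u x) (𝓝[>] 0) (𝓝 (u x)) := by
  have hui : Integrable (Ω.indicator u) := (integrable_indicator_iff hΩ.measurableSet).2 hu
  obtain ⟨S, hS, hηS⟩ := k.exists_upper
  rw [ae_restrict_iff' hΩ.measurableSet]
  filter_upwards [
    (Besicovitch.vitaliFamily (volume : Measure (Space m))).ae_tendsto_average_norm_sub
    hui.locallyIntegrable] with x h₀ hx
  have hpos : ∀ᶠ r : ℝ in 𝓝[>] 0, 0 < r := eventually_mem_nhdsWithin
  have key := tendsto_integral_smul_of_tendsto_average_norm_sub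
    (f := Ω.indicator u) (c := Ω.indicator u x)
    (g := fun (r : ℝ) y => (r ^ (m + 1))⁻¹ * k.η (r⁻¹ • (y - x)))
    (S * volume.real (Metric.closedBall (0 : Space m) 1))
    (h₀.comp (Besicovitch.tendsto_filterAt volume x))
    (Eventually.of_forall fun r => hui.integrableOn) ?_ ?_ ?_
  · rw [indicator_of_mem hx] at key
    refine key.congr fun r => ?_
    unfold avg
    rw [← integral_indicator hΩ.measurableSet]
    congr 1
    ext y
    by_cases hy : y ∈ Ω <;> simp [hy, mul_comm]
  · refine tendsto_const_nhds.congr' ?_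
    filter_upwards [hpos] with r hr using (k.integral_kernel x hr).symm
  · filter_upwards [hpos] with r hr y hy
    by_contra h
    exact hy (k.kernel_eq_zero hr h)
  · filter_upwards [hpos] with r hr y
    rw [abs_of_nonneg (k.kernel_nonneg x y hr), Measure.real, Measure.real,
      Measure.addHaar_closedBall _ _ hr.le, ENNReal.toReal_mul,
      ENNReal.toReal_ofReal (by positivity)]
    simp only [finrank_euclideanSpace, Fintype.card_fin]
    have h1 : 0 < (volume (Metric.ball (0 : Space m) 1)).toReal :=
      ENNReal.toReal_pos (Metric.measure_ball_pos _ _ one_pos).ne' measure_ball_lt_top.ne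
    rw [Measure.addHaar_closedBall _ _ zero_le_one]
    simp only [one_pow, ENNReal.ofReal_one, one_mul]
    rw [mul_div_mul_right _ _ h1.ne', div_eq_inv_mul]
    exact mul_le_mul_of_nonneg_left (hηS _) (by positivity)

end RadialKernel

namespace OnePhase

variable {m : ℕ} (k : RadialKernel m) {Ω B : Set (Space m)} {V W u : Space m → ℝ}
  {G : Space m → Space m} {Λ : ℝ≥0} {x : Space m} {r s : ℝ}

theorem integrable (h : OnePhase Ω B V W u G Λ) : Integrable u (volume.restrict Ω) := by
  have := isFiniteMeasure_restrict_of_isBounded h.bounded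
  exact h.minimizer.1.1.memLp.integrable one_le_two

theorem hasDerivAt_avg (h : OnePhase Ω B V W u G Λ) (hr : 0 < r)
    (hball : Metric.closedBall x r ⊆ B) : HasDerivAt (k.avg Ω u x)
      ((r ^ m)⁻¹ * -∫ y in Ω, inner ℝ (G y) (∇ (k.test x r) y)) r :=
  (k.hasDerivAt_avg h.minimizer.1.1 h.bounded hr (hball.trans h.subset)).congr_deriv (by ring)

/-- The averages of a weakly subharmonic function increase with the radius. -/
theorem avg_le_avg (h : OnePhase Ω B V W u G Λ) (hr : 0 < r) (hrs : r ≤ s)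
    (hball : Metric.closedBall x s ⊆ B) : k.avg Ω u x r ≤ k.avg Ω u x s := by
  have hsub : ∀ t ∈ Icc r s, Metric.closedBall x t ⊆ B := fun t ht =>
    (Metric.closedBall_subset_closedBall ht.2).trans hball
  have hd : ∀ t ∈ Icc r s, HasDerivAt (k.avg Ω u x) _ t := fun t ht =>
    h.hasDerivAt_avg k (hr.trans_le ht.1) (hsub t ht)
  have hmono : MonotoneOn (k.avg Ω u x) (Icc r s) := by
    refine monotoneOn_of_deriv_nonneg (convex_Icc r s)
      (fun t ht => (hd t ht).continuousAt.continuousWithinAt)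
      (fun t ht => (hd t (interior_subset ht)).differentiableAt.differentiableWithinAt)
      fun t ht => ?_
    have ht' := interior_subset ht
    have ht0 : 0 < t := hr.trans_le ht'.1
    rw [(hd t ht').deriv]
    refine mul_nonneg (by positivity) (neg_nonneg.2 ?_)
    exact h.integral_nonpos (k.contDiff_test x t) (k.hasCompactSupport_test ht0 x)
      ((k.tsupport_test ht0 x).trans (hsub t ht')) (k.test_nonneg x t)
  exact hmono (left_mem_Icc.2 hrs) (right_mem_Icc.2 hrs) hrs

/-- In a ball in which `u` stays above `-1`, it is harmonic and has the mean value property. -/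
theorem avg_eq_avg (h : OnePhase Ω B V W u G Λ) (hr : 0 < r) (hrs : r ≤ s)
    (hball : Metric.closedBall x s ⊆ B) (hW : ∀ y ∈ Metric.closedBall x s, -1 < W y)
    (hu : ∀ᵐ y ∂(volume.restrict Ω), y ∈ Metric.closedBall x s → -1 < u y) :
    k.avg Ω u x r = k.avg Ω u x s := by
  refine le_antisymm (h.avg_le_avg k hr hrs hball) ?_
  have hsub : ∀ t ∈ Icc r s, Metric.closedBall x t ⊆ Metric.closedBall x s := fun t ht =>
    Metric.closedBall_subset_closedBall ht.2
  have hd : ∀ t ∈ Icc r s, HasDerivAt (k.avg Ω u x) _ t := fun t ht =>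
    h.hasDerivAt_avg k (hr.trans_le ht.1) ((hsub t ht).trans hball)
  have hmono : AntitoneOn (k.avg Ω u x) (Icc r s) := by
    refine antitoneOn_of_deriv_nonpos (convex_Icc r s)
      (fun t ht => (hd t ht).continuousAt.continuousWithinAt)
      (fun t ht => (hd t (interior_subset ht)).differentiableAt.differentiableWithinAt)
      fun t ht => ?_
    have ht' := interior_subset ht
    have ht0 : 0 < t := hr.trans_le ht'.1
    have hts := (k.tsupport_test ht0 x).trans (hsub t ht')
    rw [(hd t ht').deriv]
    refine mul_nonpos_of_nonneg_of_nonpos (by positivity) (neg_nonpos.2 ?_)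
    exact h.integral_nonneg_of_neg_one_lt (k.contDiff_test x t) (k.hasCompactSupport_test ht0 x)
      (hts.trans hball) (k.test_nonneg x t) (fun y hy => hW y (hts hy))
      (hu.mono fun y hy hyt => hy (hts hyt))
  exact hmono (left_mem_Icc.2 hrs) (right_mem_Icc.2 hrs) hrs

/-- Where the upper obstacle is above `-1`, averages of `u` grow at most linearly in the radius:
the gain in volume and the energy of the variation balance at the scale of the ball. -/
theorem exists_avg_sub_avg_le : ∃ C > 0, ∀ {Ω B : Set (Space m)} {V W u : Space m → ℝ}
    {G : Space m → Space m} {Λ : ℝ≥0} {x : Space m} {r s : ℝ}, OnePhase Ω B V W u G Λ → 0 < r →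
    r ≤ s → Metric.closedBall x s ⊆ B → (∀ y ∈ Metric.closedBall x s, -1 < W y) →
    k.avg Ω u x s - k.avg Ω u x r ≤ C * (s - r) := by
  obtain ⟨S, hS⟩ := ((k.contDiff_Ψ.of_le (by simp) :
    ContDiff ℝ 1 k.Ψ).continuous_fderiv one_ne_zero).bounded_above_of_compact_support
      (k.hasCompactSupport_Ψ.fderiv (𝕜 := ℝ))
  set β : ℝ := volume.real (Metric.closedBall (0 : Space m) 1) with hβ
  have hβ0 : 0 ≤ β := measureReal_nonneg
  refine ⟨β * (1 + S ^ 2) + 1, by positivity, fun {Ω B V W u G Λ x r s} h hr hrs hball hW => ?_⟩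
  have hfin := isFiniteMeasure_restrict_of_isBounded h.bounded
  have hsub : ∀ t ∈ Icc r s, Metric.closedBall x t ⊆ Metric.closedBall x s := fun t ht =>
    Metric.closedBall_subset_closedBall ht.2
  have hd : ∀ t ∈ Icc r s, HasDerivAt (k.avg Ω u x) _ t := fun t ht =>
    h.hasDerivAt_avg k (hr.trans_le ht.1) ((hsub t ht).trans hball)
  refine (convex_Icc r s).image_sub_le_mul_sub_of_deriv_le
      (fun t ht => (hd t ht).continuousAt.continuousWithinAt)
      (fun t ht => (hd t (interior_subset ht)).differentiableAt.differentiableWithinAt)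
      (fun t ht => ?_) r (left_mem_Icc.2 hrs) s (right_mem_Icc.2 hrs) hrs
  have ht' := interior_subset ht
  have ht0 : 0 < t := hr.trans_le ht'.1
  have hts := (k.tsupport_test ht0 x).trans (hsub t ht')
  rw [(hd t ht').deriv]
  -- the variation of size `t` at scale `t`
  have key := h.neg_measure_le_integral (k.contDiff_test x t) (k.hasCompactSupport_test ht0 x)
    (hts.trans hball) (k.test_nonneg x t) (fun y hy => hW y (hts hy)) ht0.le
  have hvol : volume.real (Metric.closedBall x t) = t ^ (m + 1) * β := by
    simp only [hβ, Measure.real]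
    rw [Measure.addHaar_closedBall _ _ ht0.le, Measure.addHaar_closedBall _ _ zero_le_one]
    simp [ENNReal.toReal_mul, ENNReal.toReal_ofReal (pow_nonneg ht0.le _)]
  have hvol1 : volume.real (tsupport (k.test x t)) ≤ t ^ (m + 1) * β := by
    rw [← hvol]
    exact measureReal_mono (k.tsupport_test ht0 x) measure_closedBall_lt_top.ne
  have hgrad : ∫ y in Ω, ‖∇ (k.test x t) y‖ ^ 2 ≤ (t⁻¹ * S) ^ 2 * (t ^ (m + 1) * β) := by
    have h1 : ∀ y, ‖∇ (k.test x t) y‖ ^ 2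
        ≤ (Metric.closedBall x t).indicator (fun _ => (t⁻¹ * S) ^ 2) y := by
      intro y
      by_cases hy : y ∈ Metric.closedBall x t
      · rw [indicator_of_mem hy]
        refine pow_le_pow_left₀ (norm_nonneg _) ?_ 2
        rw [norm_gradient]
        have h2 : HasFDerivAt k.Ψ (fderiv ℝ k.Ψ (t⁻¹ • (y - x))) (t⁻¹ • (y - x)) :=
          (k.contDiff_Ψ.differentiable (by simp) _).hasFDerivAt
        have h3 : HasFDerivAt (k.test x t) _ y :=
          h2.comp y (RadialKernel.hasFDerivAt_smul_sub x y t)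
        rw [h3.fderiv, ContinuousLinearMap.comp_smul, ContinuousLinearMap.comp_id, norm_smul,
          norm_inv, Real.norm_of_nonneg ht0.le]
        exact mul_le_mul_of_nonneg_left (hS _) (by positivity)
      · rw [indicator_of_notMem hy, gradient_eq_zero_of_notMem_tsupport fun h =>
          hy (k.tsupport_test ht0 x h)]
        simp
    have hball' : Metric.closedBall x t ⊆ Ω := ((hsub t ht').trans hball).trans h.subset
    calc ∫ y in Ω, ‖∇ (k.test x t) y‖ ^ 2
        ≤ ∫ y in Ω, (Metric.closedBall x t).indicator (fun _ => (t⁻¹ * S) ^ 2) y :=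
          integral_mono_of_nonneg (Eventually.of_forall fun y => by positivity)
            ((integrable_const _).indicator Metric.isClosed_closedBall.measurableSet)
            (Eventually.of_forall h1)
      _ = (t⁻¹ * S) ^ 2 * (t ^ (m + 1) * β) := by
          rw [integral_indicator Metric.isClosed_closedBall.measurableSet,
            Measure.restrict_restrict Metric.isClosed_closedBall.measurableSet,
            inter_eq_self_of_subset_left hball', setIntegral_const, smul_eq_mul, hvol, mul_comm]
  set I := ∫ y in Ω, inner ℝ (G y) (∇ (k.test x t) y)
  have h2 : t ^ 2 * ∫ y in Ω, ‖∇ (k.test x t) y‖ ^ 2 ≤ S ^ 2 * (t ^ (m + 1) * β) := by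
    refine (mul_le_mul_of_nonneg_left hgrad (sq_nonneg t)).trans_eq ?_
    field_simp
  have h3 : t * -I ≤ t * (t ^ m * (β * (1 + S ^ 2) + 1)) := by
    have h4 : 0 ≤ t ^ (m + 1) := by positivity
    have h5 : 0 ≤ t ^ (m + 1) * β * (1 + S ^ 2) := by positivity
    have h6 : t * (t ^ m * (β * (1 + S ^ 2) + 1))
        = t ^ (m + 1) * β * (1 + S ^ 2) + t ^ (m + 1) := by
      ring
    rw [h6]
    linarith
  have h4 := le_of_mul_le_mul_left h3 ht0
  rw [inv_mul_le_iff₀ (by positivity)]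
  exact h4

end OnePhase

end Averages

/-! ### The Lipschitz estimate in a one-phase region -/

section Lipschitz

open Filter InnerProductSpace

variable {m : ℕ} (k : RadialKernel m) {Ω B : Set (Space m)} {V W u : Space m → ℝ}
  {G : Space m → Space m} {Λ : ℝ≥0} {x y : Space m} {r s : ℝ}

/-- The limit of the averages of `u` over balls shrinking to `x` (a junk value if there is no
limit): a representative of `u` that is defined at every point of a one-phase region. -/
noncomputable def RadialKernel.value (Ω : Set (Space m)) (u : Space m → ℝ) (x : Space m) : ℝ :=
  limUnder (𝓝[>] 0) (k.avg Ω u x)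

theorem RadialKernel.ae_eq_value (hΩ : IsOpen Ω) (hu : Integrable u (volume.restrict Ω)) :
    u =ᵐ[volume.restrict Ω] k.value Ω u := by
  filter_upwards [k.ae_tendsto_avg hΩ hu] with x hx
  exact hx.limUnder_eq.symm

namespace OnePhase

theorem neg_one_le_avg (h : OnePhase Ω B V W u G Λ) (hr : 0 < r)
    (hball : Metric.closedBall x r ⊆ B) : -1 ≤ k.avg Ω u x r := by
  have := isFiniteMeasure_restrict_of_isBounded h.bounded
  refine k.le_avg h.integrable hr (hball.trans h.subset) ?_
  filter_upwards [h.bounds] with y hy hyr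
  exact (hy (hball hyr)).1

theorem avg_le_add (h : OnePhase Ω B V W u G Λ) (hr : 0 < r)
    (hball : Metric.closedBall x r ⊆ B) : k.avg Ω u x r ≤ W x + Λ * r := by
  have := isFiniteMeasure_restrict_of_isBounded h.bounded
  refine k.avg_le h.integrable hr (hball.trans h.subset) ?_
  filter_upwards [h.bounds] with y hy hyr
  refine (hy (hball hyr)).2.2.2.trans ?_
  have h1 := h.lipschitz_W.dist_le_mul y (hball hyr) x (hball (Metric.mem_closedBall_self hr.le))
  have h2 : Λ * dist y x ≤ Λ * r := mul_le_mul_of_nonneg_left hyr Λ.2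
  have h3 := (le_abs_self _).trans ((Real.dist_eq _ _).symm.trans_le h1)
  linarith

/-- By the sub-mean value property the averages decrease to a limit at every point. -/
theorem tendsto_avg (h : OnePhase Ω B V W u G Λ) (hr : 0 < r)
    (hball : Metric.closedBall x r ⊆ B) :
    Tendsto (k.avg Ω u x) (𝓝[>] 0) (𝓝 (k.value Ω u x)) := by
  have hsub : ∀ t ∈ Ioo 0 r, Metric.closedBall x t ⊆ B := fun t ht =>
    (Metric.closedBall_subset_closedBall ht.2.le).trans hball
  have key := MonotoneOn.tendsto_nhdsWithin_Ioo_right (nonempty_Ioo.2 hr)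
    (f := k.avg Ω u x) (fun t ht t' ht' htt => h.avg_le_avg k ht.1 htt (hsub t' ht'))
    ⟨-1, by rintro _ ⟨t, ht, rfl⟩; exact h.neg_one_le_avg k ht.1 (hsub t ht)⟩
  rwa [RadialKernel.value, key.limUnder_eq]

theorem value_le_avg (h : OnePhase Ω B V W u G Λ) (hr : 0 < r)
    (hball : Metric.closedBall x r ⊆ B) : k.value Ω u x ≤ k.avg Ω u x r := by
  refine le_of_tendsto (h.tendsto_avg k hr hball) ?_
  filter_upwards [Ioo_mem_nhdsGT hr] with t ht
  exact h.avg_le_avg k ht.1 ht.2.le hball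

theorem neg_one_le_value (h : OnePhase Ω B V W u G Λ) (hx : x ∈ B) : -1 ≤ k.value Ω u x := by
  obtain ⟨r, hr, hball⟩ := Metric.nhds_basis_closedBall.mem_iff.1 (h.isOpen.mem_nhds hx)
  refine ge_of_tendsto (h.tendsto_avg k hr hball) ?_
  filter_upwards [Ioo_mem_nhdsGT hr] with t ht
  exact h.neg_one_le_avg k ht.1 ((Metric.closedBall_subset_closedBall ht.2.le).trans hball)

theorem value_le (h : OnePhase Ω B V W u G Λ) (hx : x ∈ B) : k.value Ω u x ≤ W x := by
  obtain ⟨r, hr, hball⟩ := Metric.nhds_basis_closedBall.mem_iff.1 (h.isOpen.mem_nhds hx)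
  have h1 : Tendsto (fun t : ℝ => W x + Λ * t) (𝓝[>] 0) (𝓝 (W x)) := by
    have : Tendsto (fun t : ℝ => W x + Λ * t) (𝓝 0) (𝓝 (W x + Λ * 0)) :=
      Continuous.tendsto (by fun_prop) 0
    rw [mul_zero, add_zero] at this
    exact this.mono_left nhdsWithin_le_nhds
  refine le_of_tendsto_of_tendsto (h.tendsto_avg k hr hball) h1 ?_
  filter_upwards [Ioo_mem_nhdsGT hr] with t ht
  exact h.avg_le_add k ht.1 ((Metric.closedBall_subset_closedBall ht.2.le).trans hball)

/-- The growth estimate for averages, in the limit where the smaller radius tends to `0`. -/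
theorem exists_avg_le_value_add : ∃ C > 0, ∀ {Ω B : Set (Space m)} {V W u : Space m → ℝ}
    {G : Space m → Space m} {Λ : ℝ≥0} {x : Space m} {s : ℝ}, OnePhase Ω B V W u G Λ → 0 < s →
    Metric.closedBall x s ⊆ B → (∀ y ∈ Metric.closedBall x s, -1 < W y) →
    k.avg Ω u x s ≤ k.value Ω u x + C * s := by
  obtain ⟨C, hC, havg⟩ := exists_avg_sub_avg_le k
  refine ⟨C, hC, fun {Ω B V W u G Λ x s} h hs hball hW => ?_⟩
  rw [← sub_le_iff_le_add]
  refine ge_of_tendsto (h.tendsto_avg k hs hball) ?_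
  filter_upwards [Ioo_mem_nhdsGT hs] with t ht
  have h1 := havg h ht.1 ht.2.le hball hW
  have h2 : C * (s - t) ≤ C * s := mul_le_mul_of_nonneg_left (by linarith [ht.1]) hC.le
  linarith

theorem avg_eq_value (h : OnePhase Ω B V W u G Λ) (hs : 0 < s)
    (hball : Metric.closedBall x s ⊆ B) (hW : ∀ y ∈ Metric.closedBall x s, -1 < W y)
    (hu : ∀ᵐ y ∂(volume.restrict Ω), y ∈ Metric.closedBall x s → -1 < u y) :
    k.avg Ω u x s = k.value Ω u x := by
  refine tendsto_nhds_unique (tendsto_const_nhds.congr' ?_) (h.tendsto_avg k hs hball)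
  filter_upwards [Ioo_mem_nhdsGT hs] with t ht
  exact (h.avg_eq_avg k ht.1 ht.2.le hball hW hu).symm

/-- Linear growth of `u + 1` away from a point `y` where it vanishes. Either the upper obstacle
touches `-1` near `y` and the bound is that of `W`, or the averages of `u` about `y` grow at most
linearly, and they control the nearby values by subharmonicity. -/
theorem exists_value_add_one_le (Λ : ℝ≥0) : ∃ C > 0, ∀ {Ω B : Set (Space m)}
    {V W u : Space m → ℝ} {G : Space m → Space m} {x y : Space m} {d : ℝ},
    OnePhase Ω B V W u G Λ → Metric.closedBall y (4 * d) ⊆ B → k.value Ω u y = -1 →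
    dist x y < d → k.value Ω u x + 1 ≤ C * d := by
  obtain ⟨C₀, hC₀, hvalue⟩ := exists_avg_le_value_add k
  obtain ⟨C₁, hC₁, havg⟩ := k.exists_avg_le_avg
  refine ⟨5 * Λ + C₁ * 4 ^ (m + 1) * (C₀ * 4), by positivity,
    fun {Ω B V W u G x y d} h hball hy hxy => ?_⟩
  have hd : 0 < d := dist_nonneg.trans_lt hxy
  have hxd : Metric.closedBall x d ⊆ Metric.closedBall y (4 * d) :=
    Metric.closedBall_subset_closedBall' (by linarith)
  have hx := hball (hxd (Metric.mem_closedBall_self hd.le))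
  have hpos : 0 ≤ C₁ * 4 ^ (m + 1) * (C₀ * 4) * d := by positivity
  have hpos' : 0 ≤ (Λ : ℝ) * d := by positivity
  by_cases hW : ∀ w ∈ Metric.closedBall y (4 * d), -1 < W w
  · have := isFiniteMeasure_restrict_of_isBounded h.bounded
    have hΩ := hball.trans h.subset
    have h1 := hvalue h (by linarith) hball hW
    have h2 := havg Ω (fun z => u z + 1) x y d (4 * d)
      (h.integrable.add (integrable_const 1)) hd (by linarith) (by
        filter_upwards [h.bounds] with z hz hzy
        linarith [(hz (hball hzy)).1])
    rw [k.avg_add_one h.integrable hd (hxd.trans hΩ),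
      k.avg_add_one h.integrable (by linarith) hΩ, mul_div_assoc, div_self hd.ne', mul_one] at h2
    have h3 := h.value_le_avg k hd (hxd.trans hball)
    have h4 : C₁ * 4 ^ (m + 1) * (k.avg Ω u y (4 * d) + 1) ≤ C₁ * 4 ^ (m + 1) * (C₀ * (4 * d)) :=
      mul_le_mul_of_nonneg_left (by linarith) (by positivity)
    linarith
  · push Not at hW
    obtain ⟨w, hw, hWw⟩ := hW
    have h1 := h.lipschitz_W.dist_le_mul x hx w (hball hw)
    have h2 := (le_abs_self _).trans ((Real.dist_eq _ _).symm.trans_le h1)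
    have h3 : Λ * dist x w ≤ Λ * (5 * d) := by
      refine mul_le_mul_of_nonneg_left ?_ Λ.2
      have := dist_triangle_right x w y
      have := Metric.mem_closedBall.1 hw
      linarith
    linarith [h.value_le k hx]

theorem value_add_one_le_two (h : OnePhase Ω B V W u G Λ) (hx : x ∈ B) :
    k.value Ω u x + 1 ≤ 2 := by
  linarith [h.value_le k hx, h.lt_one x hx]

/-- Near the centre of a one-phase ball, `u + 1` is controlled by the radius `d` of a ball free
of zeros. -/
theorem exists_radius {R : ℝ} (hR : 0 < R) (Λ : ℝ≥0) : ∃ C > 0, ∀ {Ω : Set (Space m)}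
    {V W u : Space m → ℝ} {G : Space m → Space m} {x₀ x : Space m},
    OnePhase Ω (Metric.ball x₀ R) V W u G Λ → x ∈ Metric.ball x₀ (R / 64) →
    ∃ d, 0 ≤ d ∧ d ≤ R / 64 ∧ (∀ y ∈ Metric.ball x d, k.value Ω u y ≠ -1) ∧
      k.value Ω u x + 1 ≤ C * d := by
  obtain ⟨C₁, hC₁, hgrowth⟩ := exists_value_add_one_le k Λ
  have hρ : 0 < R / 64 := by positivity
  refine ⟨max C₁ (2 / (R / 64)), lt_max_of_lt_left hC₁, fun {Ω V W u G x₀ x} h hx => ?_⟩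
  have hx' := Metric.mem_ball.1 hx
  have htwo := h.value_add_one_le_two k (Metric.ball_subset_ball (by linarith) hx)
  have hlarge : ∀ d, R / 64 ≤ d → k.value Ω u x + 1 ≤ max C₁ (2 / (R / 64)) * d := by
    intro d hd
    calc k.value Ω u x + 1 ≤ 2 := htwo
      _ = 2 / (R / 64) * (R / 64) := by field_simp
      _ ≤ max C₁ (2 / (R / 64)) * d := by gcongr; exact le_max_right _ _
  set Z := {y | y ∈ Metric.ball x (R / 64) ∧ k.value Ω u y = -1} with hZ
  by_cases hne : Z.Nonempty
  · have hlt : Metric.infDist x Z < R / 64 := by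
      obtain ⟨y, hy⟩ := hne
      exact (Metric.infDist_le_dist_of_mem hy).trans_lt (Metric.mem_ball'.1 hy.1)
    refine ⟨Metric.infDist x Z, Metric.infDist_nonneg, hlt.le, fun y hy hyv => ?_, ?_⟩
    · have hyZ : y ∈ Z := ⟨Metric.ball_subset_ball hlt.le hy, hyv⟩
      exact (Metric.infDist_le_dist_of_mem hyZ).not_gt (Metric.mem_ball'.1 hy)
    · have key : ∀ d > Metric.infDist x Z,
          k.value Ω u x + 1 ≤ max C₁ (2 / (R / 64)) * d := by
        intro d hd
        rcases le_total (R / 64) d with hRd | hRd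
        · exact hlarge d hRd
        obtain ⟨y, hy, hxy⟩ := (Metric.infDist_lt_iff hne).1 hd
        have hd0 : 0 < d := dist_nonneg.trans_lt hxy
        have hball : Metric.closedBall y (4 * d) ⊆ Metric.ball x₀ R := by
          intro z hz
          have h1 := Metric.mem_closedBall.1 hz
          have h2 := Metric.mem_ball.1 hy.1
          have h3 := dist_triangle4 z y x x₀
          exact Metric.mem_ball.2 (by linarith)
        refine (hgrowth h hball hy.2 hxy).trans ?_
        exact mul_le_mul_of_nonneg_right (le_max_left _ _) hd0.le
      have hcont : Tendsto (fun d => max C₁ (2 / (R / 64)) * d) (𝓝[>] (Metric.infDist x Z))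
          (𝓝 (max C₁ (2 / (R / 64)) * Metric.infDist x Z)) :=
        (Continuous.tendsto (by fun_prop) _).mono_left nhdsWithin_le_nhds
      exact ge_of_tendsto hcont (eventually_mem_nhdsWithin.mono fun d hd => key d hd)
  · refine ⟨R / 64, hρ.le, le_rfl, fun y hy hyv => hne ⟨y, hy, hyv⟩, hlarge _ le_rfl⟩

/-- In a ball without zeros of `u + 1` the averages are constant, so that the smoothness of the
kernel yields a gradient estimate at the scale of the radius. -/
theorem exists_abs_value_sub_value_le : ∃ C > 0, ∀ {Ω B : Set (Space m)}
    {V W u : Space m → ℝ} {G : Space m → Space m} {Λ : ℝ≥0} {x x' : Space m} {d : ℝ},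
    OnePhase Ω B V W u G Λ → IsOpen Ω → Metric.ball x d ⊆ B →
    (∀ y ∈ Metric.ball x d, k.value Ω u y ≠ -1) → 0 < d → 16 * dist x x' ≤ d →
    |k.value Ω u x - k.value Ω u x'| ≤ C * (dist x x' / d) * (k.value Ω u x + 1) := by
  obtain ⟨C, hC, hker⟩ := k.exists_abs_avg_sub_avg_le
  refine ⟨8 * C, by positivity, fun {Ω B V W u G Λ x x' d} h hΩ hball hne hd hs => ?_⟩
  have := isFiniteMeasure_restrict_of_isBounded h.bounded
  have hgt : ∀ y ∈ Metric.ball x d, -1 < k.value Ω u y := fun y hy =>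
    (h.neg_one_le_value k (hball hy)).lt_of_ne (hne y hy).symm
  have hWgt : ∀ y ∈ Metric.ball x d, -1 < W y := fun y hy =>
    (hgt y hy).trans_le (h.value_le k (hball hy))
  have hugt : ∀ᵐ y ∂(volume.restrict Ω), y ∈ Metric.ball x d → -1 < u y := by
    filter_upwards [k.ae_eq_value hΩ h.integrable] with y hy hyd
    rw [hy]
    exact hgt y hyd
  have heq : ∀ z t, 0 < t → Metric.closedBall z t ⊆ Metric.ball x d →
      k.avg Ω (fun y => u y + 1) z t = k.value Ω u z + 1 := fun z t ht hzt => by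
    rw [k.avg_add_one h.integrable ht ((hzt.trans hball).trans h.subset),
      h.avg_eq_value k ht (hzt.trans hball) (fun y hy => hWgt y (hzt hy))
        (hugt.mono fun y hy hyt => hy (hzt hyt))]
  have hs0 : 0 ≤ dist x x' := dist_nonneg
  have hx4 : Metric.closedBall x (4 * (d / 8)) ⊆ Metric.ball x d :=
    Metric.closedBall_subset_ball (by linarith)
  have key := hker Ω (fun y => u y + 1) x x' (d / 8) (h.integrable.add (integrable_const 1))
    (by positivity) (by linarith) (by
      filter_upwards [hugt] with z hz hzx
      linarith [hz (hx4 hzx)])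
  rw [heq x (d / 8) (by positivity) (Metric.closedBall_subset_ball (by linarith)),
    heq x' (d / 8) (by positivity) (Metric.closedBall_subset_ball' (by
      rw [dist_comm]; linarith)), heq x (4 * (d / 8)) (by positivity) hx4,
    add_sub_add_right_eq_sub] at key
  refine key.trans_eq ?_
  field_simp

/-- The interior Lipschitz estimate in a one-phase ball, with a constant that depends only on the
dimension, the radius and the Lipschitz constant of the obstacles. If two points are close compared
with their distance to the zeros of `u + 1`, the interior gradient estimate applies; otherwise the
linear growth bounds both values. -/
theorem exists_lipschitz_value {R : ℝ} (hR : 0 < R) (Λ : ℝ≥0) : ∃ K > 0, ∀ {Ω : Set (Space m)}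
    {V W u : Space m → ℝ} {G : Space m → Space m} {x₀ x x' : Space m},
    OnePhase Ω (Metric.ball x₀ R) V W u G Λ → IsOpen Ω → x ∈ Metric.ball x₀ (R / 64) →
    x' ∈ Metric.ball x₀ (R / 64) → |k.value Ω u x - k.value Ω u x'| ≤ K * dist x x' := by
  obtain ⟨C, hC, hradius⟩ := exists_radius k hR Λ
  obtain ⟨C', hC', hint⟩ := exists_abs_value_sub_value_le k
  refine ⟨C' * C + 16 * C, by positivity, fun {Ω V W u G x₀ x x'} h hΩ hx hx' => ?_⟩
  -- the case of a ball about `x` that is free of zeros and large compared with `dist x x'`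
  have main : ∀ {x x' : Space m} {d : ℝ}, x ∈ Metric.ball x₀ (R / 64) → d ≤ R / 64 →
      (∀ y ∈ Metric.ball x d, k.value Ω u y ≠ -1) → k.value Ω u x + 1 ≤ C * d → 0 < d →
      16 * dist x x' ≤ d →
      |k.value Ω u x - k.value Ω u x'| ≤ (C' * C + 16 * C) * dist x x' := by
    intro x x' d hx hdR hne hval hd hs
    have hball : Metric.ball x d ⊆ Metric.ball x₀ R :=
      Metric.ball_subset_ball' (by linarith [Metric.mem_ball.1 hx])
    refine (hint h hΩ hball hne hd hs).trans ?_
    have h1 : C' * (dist x x' / d) * (k.value Ω u x + 1) ≤ C' * (dist x x' / d) * (C * d) :=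
      mul_le_mul_of_nonneg_left hval (by positivity)
    have h2 : C' * (dist x x' / d) * (C * d) = C' * C * dist x x' := by field_simp
    have h3 : 0 ≤ 16 * C * dist x x' := by positivity
    linarith
  obtain ⟨d, hd0, hdR, hne, hval⟩ := hradius h hx
  obtain ⟨d', hd0', hdR', hne', hval'⟩ := hradius h hx'
  rcases (dist_nonneg (x := x) (y := x')).eq_or_lt with hs | hs
  · rw [dist_eq_zero.1 hs.symm, sub_self, abs_zero, dist_self, mul_zero]
  by_cases h1 : 16 * dist x x' ≤ d
  · exact main hx hdR hne hval (by linarith) h1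
  by_cases h2 : 16 * dist x x' ≤ d'
  · rw [abs_sub_comm, dist_comm]
    exact main hx' hdR' hne' hval' (by linarith) (by rwa [dist_comm])
  have hsub : Metric.ball x₀ (R / 64) ⊆ Metric.ball x₀ R := Metric.ball_subset_ball (by linarith)
  have h3 := h.neg_one_le_value k (hsub hx)
  have h4 := h.neg_one_le_value k (hsub hx')
  have h5 : C * d ≤ C * (16 * dist x x') := mul_le_mul_of_nonneg_left (by linarith) hC.le
  have h6 : C * d' ≤ C * (16 * dist x x') := mul_le_mul_of_nonneg_left (by linarith) hC.le
  have h7 : 0 ≤ C' * C * dist x x' := by positivity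
  rw [abs_le]
  constructor <;> linarith

end OnePhase

end Lipschitz

/-! ### Cylinders -/

section Cylinders

variable {m : ℕ} {S T : Set (Space m)}

/-- The projection `x = (x', x_n) ↦ x'`. -/
noncomputable def horizontal (m : ℕ) : Space m →ₗ[ℝ] EuclideanSpace ℝ (Fin m) where
  toFun x := WithLp.toLp 2 fun i => x i.castSucc
  map_add' _ _ := rfl
  map_smul' _ _ := rfl

theorem cylinder_eq (c : Space m) (R h : ℝ) : cylinder c R h =
    horizontal m ⁻¹' Metric.ball (horizontal m c) R ∩
      EuclideanSpace.proj (𝕜 := ℝ) (Fin.last m) ⁻¹' Metric.ball (c (Fin.last m)) h := by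
  ext x
  simp only [cylinder, mem_ofPred_eq, mem_inter_iff, mem_preimage, Metric.mem_ball,
    EuclideanSpace.dist_eq, Real.dist_eq, sq_abs]
  rfl

theorem IsCylinder.isOpen (hS : IsCylinder S) : IsOpen S := by
  obtain ⟨c, R, h, -, -, rfl⟩ := hS
  rw [cylinder_eq]
  exact (Metric.isOpen_ball.preimage (horizontal m).continuous_of_finiteDimensional).inter
    (Metric.isOpen_ball.preimage (EuclideanSpace.proj (𝕜 := ℝ) (Fin.last m)).continuous)

theorem IsCylinder.convex (hS : IsCylinder S) : Convex ℝ S := by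
  obtain ⟨c, R, h, -, -, rfl⟩ := hS
  rw [cylinder_eq]
  exact ((convex_ball _ _).linear_preimage (horizontal m)).inter
    ((convex_ball _ _).linear_preimage (EuclideanSpace.proj (𝕜 := ℝ) (Fin.last m)).toLinearMap)

theorem IsCylinder.isBounded (hS : IsCylinder S) : Bornology.IsBounded S := by
  obtain ⟨c, R, h, hR, hh, rfl⟩ := hS
  refine (Metric.isBounded_iff_subset_ball c).2 ⟨R + h, fun x hx => ?_⟩
  obtain ⟨h1, h2⟩ := hx
  rw [Metric.mem_ball, EuclideanSpace.dist_eq, Fin.sum_univ_castSucc, Real.sqrt_lt' (by positivity)]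
  simp only [Real.dist_eq, sq_abs]
  rw [Real.sqrt_lt' hR] at h1
  have h3 := sq_lt_sq' (by linarith [neg_abs_le (x (Fin.last m) - c (Fin.last m))])
    (lt_of_le_of_lt (le_abs_self _) h2)
  nlinarith

theorem exists_mem_segment_frontier {x y : Space m} (hx : x ∈ S) (hy : y ∉ S) :
    ∃ p ∈ segment ℝ x y, p ∈ frontier S := by
  by_contra! hcon
  have hcover : segment ℝ x y ⊆ interior S ∪ (closure S)ᶜ := fun p hp => by
    by_cases h : p ∈ closure S
    · by_contra h'
      exact hcon p hp ⟨h, fun h'' => h' (Or.inl h'')⟩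
    · exact Or.inr h
  have hdisj : Disjoint (interior S) (closure S)ᶜ :=
    disjoint_compl_right_iff_subset.2 (interior_subset.trans subset_closure)
  have hxi : x ∈ interior S :=
    (hcover (left_mem_segment ℝ x y)).resolve_right fun h => h (subset_closure hx)
  have hsub := (convex_segment x y).isPreconnected.subset_left_of_subset_union isOpen_interior
    isClosed_closure.isOpen_compl hdisj hcover ⟨x, left_mem_segment ℝ x y, hxi⟩
  exact hy (interior_subset (hsub (right_mem_segment ℝ x y)))

theorem dist_right_le_of_mem_segment {x y p : Space m} (hp : p ∈ segment ℝ x y) :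
    dist p y ≤ dist x y := by
  linarith [dist_add_dist_of_mem_segment hp, dist_nonneg (x := x) (y := p)]

/-- A segment that leaves `D'` from a point of `D` crosses first `∂D` and then `∂D'`. -/
theorem ball_subset_of_le_dist_frontier (hST : closure S ⊆ T) {δ : ℝ}
    (hδ : ∀ x ∈ frontier S, ∀ y ∈ frontier T, δ ≤ dist x y) {x : Space m} (hx : x ∈ S) :
    Metric.ball x δ ⊆ T := by
  intro y hy
  by_contra hyT
  obtain ⟨p, hp, hpS⟩ := exists_mem_segment_frontier hx fun h => hyT (hST (subset_closure h))
  obtain ⟨q, hq, hqT⟩ := exists_mem_segment_frontier (hST (frontier_subset_closure hpS)) hyT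
  have h1 := dist_add_dist_of_mem_segment hq
  have h2 := dist_right_le_of_mem_segment hp
  have h3 := hδ p hpS q hqT
  linarith [Metric.mem_ball'.1 hy, dist_nonneg (x := q) (y := y)]

theorem exists_pos_le_dist {A B : Set (Space m)} (hA : IsCompact A) (hB : IsClosed B)
    (hAB : Disjoint A B) : ∃ r : ℝ, 0 < r ∧ ∀ x ∈ A, ∀ y ∈ B, r ≤ dist x y := by
  obtain ⟨r, hr, h⟩ := Metric.exists_pos_forall_lt_edist hA hB hAB
  refine ⟨r, hr, fun x hx y hy => ?_⟩
  have h1 := h x hx y hy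
  rw [edist_nndist, ENNReal.coe_lt_coe] at h1
  exact h1.le

end Cylinders

/-! ### Classical sub- and supersolutions -/

section Classical

open Filter

variable {m : ℕ} {Ω D D' : Set (Space m)} {V W w g : Space m → ℝ}

theorem eq_of_mem_closure_levelSet (hw : ContinuousOn w Ω) {c : ℝ} {p : Space m} (hp : p ∈ Ω)
    (hpc : p ∈ closure {x | x ∈ Ω ∧ w x = c}) : w p = c := by
  have h1 : ContinuousWithinAt w {x | x ∈ Ω ∧ w x = c} p := (hw p hp).mono fun x hx => hx.1
  have h2 := h1.mem_closure_image hpc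
  have h3 : closure (w '' {x | x ∈ Ω ∧ w x = c}) ⊆ {c} :=
    closure_minimal (by rintro _ ⟨x, hx, rfl⟩; exact hx.2) isClosed_singleton
  exact h3 h2

theorem eq_neg_one_of_mem_freeBdryNeg (hw : ContinuousOn w Ω) {p : Space m}
    (hp : p ∈ freeBdryNeg Ω w) : w p = -1 :=
  eq_of_mem_closure_levelSet hw hp.2 (frontier_subset_closure hp.1)

theorem contDiffAt_of_isC2Extension (hΩ : IsOpen Ω) (hw : ContinuousOn w Ω)
    (hg : IsC2Extension Ω w g) {x : Space m} (hx : x ∈ innerPhase Ω w) : ContDiffAt ℝ 2 w x := by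
  obtain ⟨U, hU, hsub, hgU, heq⟩ := hg
  have hopen : IsOpen (innerPhase Ω w) :=
    hw.abs.isOpen_inter_preimage hΩ isOpen_Iio
  have hxU : x ∈ U := hsub ⟨hx.1, subset_closure hx⟩
  refine (hgU.contDiffAt (hU.mem_nhds hxU)).congr_of_eventuallyEq ?_
  filter_upwards [hopen.mem_nhds hx] with y hy
  exact (heq ⟨hy.1, subset_closure hy⟩).symm

/-- Every segment along which `w` is not constant meets the closure of the inner phase at a point
with the same value as its first end point. -/
theorem exists_mem_segment_closure_innerPhase (hΩ : IsOpen Ω) (hw : ContinuousOn w Ω)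
    (hwI : ∀ x ∈ Ω, w x ∈ Icc (-1 : ℝ) 1) {x y : Space m} (hxy : segment ℝ x y ⊆ Ω)
    (hne : w y ≠ w x) : ∃ p ∈ segment ℝ x y, w p = w x ∧ p ∈ closure (innerPhase Ω w) := by
  have hxΩ := hxy (left_mem_segment ℝ x y)
  by_cases hx : |w x| < 1
  · exact ⟨x, left_mem_segment ℝ x y, rfl, subset_closure ⟨hxΩ, hx⟩⟩
  obtain ⟨p, hp, hpf⟩ := exists_mem_segment_frontier (S := {z | z ∈ Ω ∧ w z = w x})
    ⟨hxΩ, rfl⟩ fun h : y ∈ Ω ∧ w y = w x => hne h.2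
  have hpΩ := hxy hp
  have hpx := eq_of_mem_closure_levelSet hw hpΩ (frontier_subset_closure hpf)
  have hp1 : ¬ |w p| < 1 := by rwa [hpx]
  have hwx := hwI x hxΩ
  refine ⟨p, hp, hpx, mem_closure_iff_nhds.2 fun t ht => ?_⟩
  have hnear : ∀ᶠ z in 𝓝 p, |w z - w p| < 1 := by
    have h1 : ContinuousAt w p := hw.continuousAt (hΩ.mem_nhds hpΩ)
    have h2 : ContinuousAt (fun z => |w z - w p|) p := (h1.sub continuousAt_const).abs
    exact h2.eventually_lt continuousAt_const (by simp)
  have hmem : t ∩ Ω ∩ {z | |w z - w p| < 1} ∈ 𝓝 p :=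
    inter_mem (inter_mem ht (hΩ.mem_nhds hpΩ)) hnear
  have hpc := hpf.2
  rw [mem_interior_iff_mem_nhds] at hpc
  have hns : ¬ t ∩ Ω ∩ {z | |w z - w p| < 1} ⊆ {z | z ∈ Ω ∧ w z = w x} := fun h =>
    hpc (mem_of_superset hmem h)
  obtain ⟨z, ⟨⟨hzt, hzΩ⟩, hzn⟩, hz⟩ := not_subset.1 hns
  have hzx : w z ≠ w x := fun h => hz ⟨hzΩ, h⟩
  have hzI := hwI z hzΩ
  refine ⟨z, hzt, hzΩ, ?_⟩
  rw [mem_ofPred_eq, abs_lt] at hzn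
  rw [hpx] at hzn
  rw [abs_lt, not_and_or, not_lt, not_lt] at hx
  rw [abs_lt]
  -- `w x` is `1` or `-1`, and `w z` is close to it, different from it and in `[-1, 1]`
  rcases hx with hx | hx
  · have : w x = -1 := le_antisymm hx hwx.1
    exact ⟨lt_of_le_of_ne hzI.1 fun h => hzx (by rw [← h, this]), by linarith⟩
  · have : w x = 1 := le_antisymm hwx.2 hx
    exact ⟨by linarith, lt_of_le_of_ne hzI.2 fun h => hzx (by rw [h, this])⟩

/-- Since `w` is `±1` off the inner phase, its oscillation is that of the extension `g`. -/
theorem locallyLipschitzOn_of_isC2Extension (hΩ : IsOpen Ω) (hw : ContinuousOn w Ω)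
    (hwI : ∀ x ∈ Ω, w x ∈ Icc (-1 : ℝ) 1) (hg : IsC2Extension Ω w g) {p : Space m} (hp : p ∈ Ω) :
    ∃ C : ℝ≥0, ∃ ε > 0, LipschitzOnWith C w (Metric.ball p ε) := by
  obtain ⟨U, hU, hsub, hgU, heq⟩ := hg
  by_cases hpc : p ∈ closure (innerPhase Ω w)
  · obtain ⟨C, t, ht, hC⟩ := ((hgU.contDiffAt (hU.mem_nhds (hsub ⟨hp, hpc⟩))).of_le
      (by norm_num)).exists_lipschitzOnWith
    obtain ⟨ε, hε, hball⟩ := Metric.mem_nhds_iff.1 (inter_mem ht (hΩ.mem_nhds hp))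
    refine ⟨C, ε, hε, LipschitzOnWith.of_dist_le_mul fun x hx y hy => ?_⟩
    by_cases hxy : w x = w y
    · rw [hxy, dist_self]
      positivity
    have hseg : segment ℝ x y ⊆ Metric.ball p ε := (convex_ball p ε).segment_subset hx hy
    obtain ⟨a, ha, hax, hac⟩ := exists_mem_segment_closure_innerPhase hΩ hw hwI
      (hseg.trans fun z hz => (hball hz).2) (Ne.symm hxy)
    have hseg' : segment ℝ y a ⊆ Metric.ball p ε := (convex_ball p ε).segment_subset hy (hseg ha)
    obtain ⟨b, hb, hby, hbc⟩ := exists_mem_segment_closure_innerPhase hΩ hw hwI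
      (hseg'.trans fun z hz => (hball hz).2) (by rwa [hax])
    rw [← hax, ← hby, ← heq ⟨(hball (hseg ha)).2, hac⟩, ← heq ⟨(hball (hseg' hb)).2, hbc⟩]
    refine (hC.dist_le_mul a (hball (hseg ha)).1 b (hball (hseg' hb)).1).trans ?_
    refine mul_le_mul_of_nonneg_left ?_ C.2
    rw [dist_comm a b]
    refine (dist_right_le_of_mem_segment hb).trans ?_
    rw [dist_comm y a]
    exact dist_right_le_of_mem_segment ha
  · obtain ⟨ε, hε, hball⟩ := Metric.mem_nhds_iff.1
      (inter_mem (isClosed_closure.isOpen_compl.mem_nhds hpc) (hΩ.mem_nhds hp))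
    refine ⟨0, ε, hε, LipschitzOnWith.of_dist_le_mul fun x hx y hy => ?_⟩
    by_cases hxy : w x = w y
    · rw [hxy, dist_self]
      positivity
    have hseg : segment ℝ x y ⊆ Metric.ball p ε := (convex_ball p ε).segment_subset hx hy
    obtain ⟨a, ha, -, hac⟩ := exists_mem_segment_closure_innerPhase hΩ hw hwI
      (hseg.trans fun z hz => (hball hz).2) (Ne.symm hxy)
    exact absurd hac (hball (hseg ha)).1

theorem exists_lipschitzOnWith_of_isC2Extension (hΩ : IsOpen Ω) (hw : ContinuousOn w Ω)
    (hwI : ∀ x ∈ Ω, w x ∈ Icc (-1 : ℝ) 1) (hg : IsC2Extension Ω w g)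
    (hb : Bornology.IsBounded D') (hD' : closure D' ⊆ Ω) : ∃ C, LipschitzOnWith C w D' := by
  have hK : IsCompact (closure D') := hb.isCompact_closure
  obtain ⟨C, hC⟩ := LocallyLipschitzOn.exists_lipschitzOnWith_of_compact hK (f := w) fun p hp => by
    obtain ⟨C, ε, hε, hC⟩ := locallyLipschitzOn_of_isC2Extension hΩ hw hwI hg (hD' hp)
    exact ⟨C, _, mem_nhdsWithin_of_mem_nhds (Metric.ball_mem_nhds p hε), hC⟩
  exact ⟨C, hC.mono subset_closure⟩

/-- The quantities `δ`, `L`, `Λ` exist by compactness. -/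
theorem exists_controlledBy (hΩ : IsCylinder Ω) (hD' : IsCylinder D') (hD : IsCylinder D)
    (hDD' : closure D ⊆ D') (hD'Ω : closure D' ⊆ Ω) (hV : IsClassicalSubsolution Ω V)
    (hW : IsClassicalSupersolution Ω W) (hVW : NicelyIntertwined Ω V W) :
    ∃ (δ L : ℝ) (Λ : ℝ≥0), ControlledBy Ω D' D V W δ L Λ := by
  obtain ⟨gV, hgV, -⟩ := hV.gradient
  obtain ⟨gW, hgW, -⟩ := hW.gradient
  obtain ⟨C₁, hC₁⟩ := exists_lipschitzOnWith_of_isC2Extension hΩ.isOpen hV.continuousOn hV.mem_Icc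
    hgV hD'.isBounded hD'Ω
  obtain ⟨C₂, hC₂⟩ := exists_lipschitzOnWith_of_isC2Extension hΩ.isOpen hW.continuousOn hW.mem_Icc
    hgW hD'.isBounded hD'Ω
  have hcD : IsCompact (frontier D) :=
    hD.isBounded.isCompact_closure.of_isClosed_subset isClosed_frontier frontier_subset_closure
  obtain ⟨δ, hδ, hδ'⟩ := exists_pos_le_dist hcD (isClosed_frontier (s := D'))
    (disjoint_left.2 fun x hx hx' => hx'.2 (by
      rw [hD'.isOpen.interior_eq]; exact hDD' (frontier_subset_closure hx)))
  have hcD' : IsCompact (closure D') := hD'.isBounded.isCompact_closure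
  obtain ⟨L, hL, hL'⟩ := exists_pos_le_dist
    (A := closure D' ∩ frontier {x | x ∈ Ω ∧ W x = 1})
    (B := closure D' ∩ frontier {x | x ∈ Ω ∧ V x = -1})
    (hcD'.inter_right isClosed_frontier) (isClosed_closure.inter isClosed_frontier)
    (disjoint_left.2 fun x hx hx' => by
      have h1 := hVW.1 ⟨hx.2, hD'Ω hx.1⟩
      have h2 := eq_neg_one_of_mem_freeBdryNeg hV.continuousOn ⟨hx'.2, hD'Ω hx'.1⟩
      have h3 := h1.2
      rw [h2] at h3
      norm_num at h3)
  exact ⟨δ, L, max C₁ C₂, hδ, hδ', hL, fun x hx y hy => hL' x ⟨subset_closure hx.2, hx.1.1⟩ y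
    ⟨subset_closure hy.2, hy.1.1⟩, hC₁.weaken (le_max_left _ _), hC₂.weaken (le_max_right _ _)⟩

/-- The set where `V = -1` and `W = 1` is relatively closed, and open because the free boundary of
one obstacle lies in the inner phase of the other. -/
theorem forall_or_forall_not (hΩ : IsOpen Ω) (hΩc : Convex ℝ Ω) (hV : ContinuousOn V Ω)
    (hW : ContinuousOn W Ω) (hVW : NicelyIntertwined Ω V W) :
    (∀ x ∈ Ω, V x = -1 ∧ W x = 1) ∨ ∀ x ∈ Ω, ¬ (V x = -1 ∧ W x = 1) := by
  set T : Set (Space m) := interior {x | x ∈ Ω ∧ V x = -1} ∩ interior {x | x ∈ Ω ∧ W x = 1}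
  have hT : ∀ x ∈ Ω, V x = -1 → W x = 1 → x ∈ T := by
    intro x hx h1 h2
    constructor
    · by_contra h
      have := (hVW.2 ⟨⟨subset_closure ⟨hx, h1⟩, h⟩, hx⟩).2
      rw [h2] at this
      norm_num at this
    · by_contra h
      have := (hVW.1 ⟨⟨subset_closure ⟨hx, h2⟩, h⟩, hx⟩).2
      rw [h1] at this
      norm_num at this
  have hopen : IsOpen (Ω ∩ (fun x => (V x, W x)) ⁻¹' {((-1 : ℝ), (1 : ℝ))}ᶜ) :=
    (hV.prodMk hW).isOpen_inter_preimage hΩ isClosed_singleton.isOpen_compl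
  by_cases hne : (Ω ∩ T).Nonempty
  · left
    have hsub := hΩc.isPreconnected.subset_left_of_subset_union
      (isOpen_interior.inter isOpen_interior) hopen
      (disjoint_left.2 fun x hx hx' => hx'.2 (Prod.ext (interior_subset hx.1).2
        (interior_subset hx.2).2))
      (fun x hx => by
        by_cases h : V x = -1 ∧ W x = 1
        · exact Or.inl (hT x hx h.1 h.2)
        · exact Or.inr ⟨hx, fun h' => h ⟨congrArg Prod.fst h', congrArg Prod.snd h'⟩⟩) hne
    exact fun x hx => ⟨(interior_subset (hsub hx).1).2, (interior_subset (hsub hx).2).2⟩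
  · exact Or.inr fun x hx h => hne ⟨x, hx, hT x hx h.1 h.2⟩

/-- A small ball cannot meet both `{W = 1}` and `{V = -1}`: a segment from the first set to the
second crosses `F⁺(W)` and then `F⁻(V)`. -/
theorem forall_lt_one_or_forall_neg_one_lt {δ L : ℝ} {Λ : ℝ≥0} (hD'Ω : D' ⊆ Ω)
    (hV : IsClassicalSubsolution Ω V) (hW : IsClassicalSupersolution Ω W)
    (hVW : NicelyIntertwined Ω V W) (hc : ControlledBy Ω D' D V W δ L Λ)
    (hnot : ∀ x ∈ Ω, ¬ (V x = -1 ∧ W x = 1)) {x₀ : Space m} {R : ℝ} (hR : 2 * R ≤ L)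
    (hball : Metric.ball x₀ R ⊆ D') :
    (∀ x ∈ Metric.ball x₀ R, W x < 1) ∨ ∀ x ∈ Metric.ball x₀ R, -1 < V x := by
  by_contra! hcon
  obtain ⟨⟨x, hx, hWx⟩, y, hy, hVy⟩ := hcon
  have hΩ := hball.trans hD'Ω
  replace hWx : W x = 1 := le_antisymm (hW.mem_Icc x (hΩ hx)).2 hWx
  replace hVy : V y = -1 := le_antisymm hVy (hV.mem_Icc y (hΩ hy)).1
  have hseg := (convex_ball x₀ R).segment_subset hx hy
  obtain ⟨p, hp, hpf⟩ := exists_mem_segment_frontier (S := {z | z ∈ Ω ∧ W z = 1})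
    ⟨hΩ hx, hWx⟩ fun h : y ∈ Ω ∧ W y = 1 => hnot y h.1 ⟨hVy, h.2⟩
  have hpB := hseg hp
  have hpF : p ∈ freeBdryPos Ω W := ⟨hpf, hΩ hpB⟩
  have hseg' := (convex_ball x₀ R).segment_subset hy hpB
  obtain ⟨q, hq, hqf⟩ := exists_mem_segment_frontier (S := {z | z ∈ Ω ∧ V z = -1})
    ⟨hΩ hy, hVy⟩ fun h : p ∈ Ω ∧ V p = -1 => by
      have := (hVW.1 hpF).2
      rw [h.2] at this
      norm_num at this
  have hqB := hseg' hq
  have h1 := hc.separation_le p ⟨hpF, hball hpB⟩ q ⟨⟨hqf, hΩ hqB⟩, hball hqB⟩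
  have h2 := dist_triangle_right p q x₀
  linarith [Metric.mem_ball.1 hpB, Metric.mem_ball.1 hqB]

end Classical

/-! ### The gradient bound -/

section Conclusion

open Filter InnerProductSpace

variable {m : ℕ} (k : RadialKernel m) {Ω D D' B : Set (Space m)} {V W u v : Space m → ℝ}
  {G H : Space m → Space m} {δ L : ℝ} {Λ : ℝ≥0}

theorem MemH1.mono (hu : MemH1 Ω u G) (hΩ : MeasurableSet Ω) (hDΩ : D ⊆ Ω) : MemH1 D u G where
  memLp := hu.memLp.mono_measure (Measure.restrict_mono hDΩ le_rfl)
  memLp_grad := hu.memLp_grad.mono_measure (Measure.restrict_mono hDΩ le_rfl)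
  weak_grad φ hφ hc hs e := by
    have h := hu.weak_grad φ hφ hc (hs.trans hDΩ) e
    rwa [setIntegral_eq_of_subset_of_forall_sdiff_eq_zero hΩ hDΩ fun x hx => by
        rw [fderiv_eq_zero_of_notMem_tsupport fun h => hx.2 (hs h)]; simp,
      setIntegral_eq_of_subset_of_forall_sdiff_eq_zero hΩ hDΩ fun x hx => by
        rw [image_eq_zero_of_notMem_tsupport fun h => hx.2 (hs h), zero_mul]] at h

/-- Weak gradients are unique. -/
theorem MemH1.ae_eq (hD : IsOpen D) (hDb : Bornology.IsBounded D) (hu : MemH1 D u G)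
    (hv : MemH1 D v H) (huv : u =ᵐ[volume.restrict D] v) : G =ᵐ[volume.restrict D] H := by
  have := isFiniteMeasure_restrict_of_isBounded hDb
  have hG := hu.memLp_grad.integrable one_le_two
  have hH := hv.memLp_grad.integrable one_le_two
  have key : ∀ᵐ x ∂(volume.restrict D), x ∈ D → (G - H) x = 0 := by
    refine hD.ae_eq_zero_of_integral_contDiff_smul_eq_zero
      ((hG.sub hH).locallyIntegrable.locallyIntegrableOn D) fun φ hφ hc hs => ?_
    obtain ⟨C, hC⟩ := hφ.continuous.bounded_above_of_compact_support hc
    have hG' : Integrable (fun x => φ x • G x) (volume.restrict D) :=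
      hG.bdd_smul C hφ.continuous.aestronglyMeasurable (Eventually.of_forall hC)
    have hH' : Integrable (fun x => φ x • H x) (volume.restrict D) :=
      hH.bdd_smul C hφ.continuous.aestronglyMeasurable (Eventually.of_forall hC)
    simp only [Pi.sub_apply, smul_sub]
    rw [integral_sub hG' hH', sub_eq_zero]
    refine ext_inner_left ℝ fun e => ?_
    rw [← integral_inner hG', ← integral_inner hH', ← neg_inj]
    simp only [real_inner_comm _ e, real_inner_smul_left]
    rw [← hu.weak_grad φ hφ hc hs e, ← hv.weak_grad φ hφ hc hs e]
    exact integral_congr_ae (huv.mono fun x hx => by simp only [hx])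
  filter_upwards [key, ae_restrict_mem hD.measurableSet] with x hx hxD
  exact sub_eq_zero.1 (hx hxD)

theorem MemH1.ae_norm_le (hD : IsOpen D) (hDb : Bornology.IsBounded D) (hu : MemH1 D u G)
    {K : ℝ≥0} (hv : LipschitzWith K v) (huv : u =ᵐ[volume.restrict D] v) :
    ∀ᵐ x ∂(volume.restrict D), ‖G x‖ ≤ K := by
  filter_upwards [hu.ae_eq hD hDb (memH1_gradient_of_lipschitzWith hv hDb) huv] with x hx
  rw [hx, norm_gradient]
  exact norm_fderiv_le_of_lipschitz ℝ hv

/-- Where the obstacles are `-1` and `1` throughout, the constant `1` has energy zero. -/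
theorem IsConstrainedMinimizer.ae_grad_eq_zero (hu : IsConstrainedMinimizer Ω V W u G)
    (hΩ : MeasurableSet Ω) (hΩb : Bornology.IsBounded Ω) (hVW : ∀ x ∈ Ω, V x = -1 ∧ W x = 1) :
    G =ᵐ[volume.restrict Ω] 0 := by
  have := isFiniteMeasure_restrict_of_isBounded hΩb
  have hadm : Admissible Ω V W (fun _ => 1) (fun _ => 0) := by
    have h1 := memH1_gradient_of_lipschitzWith (LipschitzWith.const (1 : ℝ)) hΩb
    have h2 : (∇ fun _ : Space m => (1 : ℝ)) = fun _ => 0 := by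
      ext1 x
      simp [gradient]
    rw [h2] at h1
    refine ⟨h1, ?_⟩
    filter_upwards [ae_restrict_mem hΩ] with x hx
    rw [(hVW x hx).1, (hVW x hx).2]
    norm_num
  have hle := hu.2 _ _ hadm
  have h0 : energy Ω (fun _ => (1 : ℝ)) (fun _ => (0 : Space m)) = 0 := by simp [energy]
  rw [h0, energy, integral_add (hu.1.1.memLp_grad.integrable_norm_pow two_ne_zero)
    (integrable_phase hu.1.1.memLp.1)] at hle
  have h1 : 0 ≤ ∫ x in Ω, {y | |u y| < 1}.indicator (fun _ => (1 : ℝ)) x :=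
    integral_nonneg fun x => indicator_nonneg (fun _ _ => zero_le_one) x
  have h2 : 0 ≤ ∫ x in Ω, ‖G x‖ ^ 2 := integral_nonneg fun x => by positivity
  have h3 := (integral_eq_zero_iff_of_nonneg (fun x => by positivity)
    (hu.1.1.memLp_grad.integrable_norm_pow two_ne_zero)).1 (le_antisymm (by linarith) h2)
  filter_upwards [h3] with x hx
  simpa using hx

/-- A bounded function with vanishing weak gradient equals its averages, which are Lipschitz. -/
theorem exists_lipschitz_value_of_grad_eq_zero {R : ℝ} (hR : 0 < R) : ∃ K > 0,
    ∀ {Ω : Set (Space m)} {u : Space m → ℝ} {G : Space m → Space m} {x₀ x x' : Space m},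
    MemH1 Ω u G → Bornology.IsBounded Ω → G =ᵐ[volume.restrict Ω] 0 →
    (∀ᵐ y ∂(volume.restrict Ω), -1 ≤ u y ∧ u y ≤ 1) → Metric.ball x₀ R ⊆ Ω →
    x ∈ Metric.ball x₀ (R / 64) → x' ∈ Metric.ball x₀ (R / 64) →
    |k.value Ω u x - k.value Ω u x'| ≤ K * dist x x' := by
  obtain ⟨C, hC, hker⟩ := k.exists_abs_avg_sub_avg_le
  refine ⟨C * (16 / R) * 2, by positivity,
    fun {Ω u G x₀ x x'} hu hΩ hG hbd hball hx hx' => ?_⟩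
  have := isFiniteMeasure_restrict_of_isBounded hΩ
  have hui := hu.memLp.integrable one_le_two
  have hsub : ∀ z ∈ Metric.ball x₀ (R / 64), ∀ t ≤ R / 4, Metric.closedBall z t ⊆ Ω :=
    fun z hz t ht => (Metric.closedBall_subset_ball' (by linarith [Metric.mem_ball.1 hz])).trans
      hball
  have heq : ∀ z ∈ Metric.ball x₀ (R / 64), k.avg Ω u z (R / 16) = k.value Ω u z := by
    intro z hz
    have hd : ∀ t ∈ Ioc 0 (R / 16), HasDerivAt (k.avg Ω u z) 0 t := fun t ht => by
      convert k.hasDerivAt_avg hu hΩ ht.1 (hsub z hz t (by linarith [ht.2])) using 1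
      rw [integral_eq_zero_of_ae, mul_zero, neg_zero]
      filter_upwards [hG] with y hy
      rw [hy]
      simp
    have hconst : ∀ t ∈ Ioc 0 (R / 16), k.avg Ω u z t = k.avg Ω u z (R / 16) := fun t ht =>
      (convex_Ioc 0 (R / 16)).is_const_of_fderivWithin_eq_zero (𝕜 := ℝ)
        (fun s hs => (hd s hs).differentiableAt.differentiableWithinAt)
        (fun s hs => by
          rw [((hd s hs).hasFDerivAt.hasFDerivWithinAt).fderivWithin
            (uniqueDiffOn_Ioc 0 (R / 16) s hs)]
          ext
          simp) ht ⟨by positivity, le_rfl⟩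
    have hlim : Tendsto (k.avg Ω u z) (𝓝[>] 0) (𝓝 (k.avg Ω u z (R / 16))) := by
      refine tendsto_const_nhds.congr' ?_
      filter_upwards [Ioc_mem_nhdsGT (show (0 : ℝ) < R / 16 by positivity)] with t ht
      exact (hconst t ht).symm
    exact hlim.limUnder_eq.symm
  have hxx : dist x x' ≤ R / 16 := by
    linarith [dist_triangle_right x x' x₀, Metric.mem_ball.1 hx, Metric.mem_ball.1 hx']
  have key := hker Ω (fun y => u y + 1) x x' (R / 16) (hui.add (integrable_const 1))
    (by positivity) hxx (hbd.mono fun y hy _ => by linarith [hy.1])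
  have hle := k.avg_le hui (r := 4 * (R / 16)) (c := 1) (by positivity)
    (hsub x hx _ (by linarith)) (hbd.mono fun y hy _ => hy.2)
  rw [k.avg_add_one hui (by positivity) (hsub x hx _ (by linarith)),
    k.avg_add_one hui (by positivity) (hsub x' hx' _ (by linarith)),
    k.avg_add_one hui (by positivity) (hsub x hx _ (by linarith)), heq x hx, heq x' hx',
    add_sub_add_right_eq_sub] at key
  refine key.trans ?_
  calc C * (dist x x' / (R / 16)) * (k.avg Ω u x (4 * (R / 16)) + 1)
      ≤ C * (dist x x' / (R / 16)) * 2 :=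
        mul_le_mul_of_nonneg_left (by linarith) (by positivity)
    _ = C * (16 / R) * 2 * dist x x' := by field_simp

/-- Where `W < 1`, the pair of obstacles is smooth off the phase `{-1}`. -/
theorem onePhase_of_lt_one (hΩ : IsCylinder Ω) (hV : IsClassicalSubsolution Ω V)
    (hW : IsClassicalSupersolution Ω W) (hVW : ∀ x ∈ Ω, V x ≤ W x)
    (hu : IsConstrainedMinimizer Ω V W u G) (hB : IsOpen B) (hBΩ : B ⊆ Ω)
    (hLV : LipschitzOnWith Λ V B) (hLW : LipschitzOnWith Λ W B) (hlt : ∀ x ∈ B, W x < 1) :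
    OnePhase Ω B V W u G Λ where
  bounded := hΩ.isBounded
  minimizer := hu
  isOpen := hB
  subset := hBΩ
  lipschitz_V := hLV
  lipschitz_W := hLW
  neg_one_le x hx := (hV.mem_Icc x (hBΩ hx)).1
  lt_one := hlt
  smooth_V x hx h := by
    obtain ⟨g, hg, -⟩ := hV.gradient
    have hin : x ∈ innerPhase Ω V :=
      ⟨hBΩ hx, abs_lt.2 ⟨h, (hVW x (hBΩ hx)).trans_lt (hlt x hx)⟩⟩
    exact ⟨contDiffAt_of_isC2Extension hΩ.isOpen hV.continuousOn hg hin,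
      hV.laplacian_nonneg x hin⟩
  smooth_W x hx h := by
    obtain ⟨g, hg, -⟩ := hW.gradient
    have hin : x ∈ innerPhase Ω W := ⟨hBΩ hx, abs_lt.2 ⟨h, hlt x hx⟩⟩
    exact ⟨contDiffAt_of_isC2Extension hΩ.isOpen hW.continuousOn hg hin,
      hW.laplacian_nonpos x hin⟩

/-- Where `V > -1`, the reflected problem is of the kind treated above. -/
theorem onePhase_neg_of_neg_one_lt (hΩ : IsCylinder Ω) (hV : IsClassicalSubsolution Ω V)
    (hW : IsClassicalSupersolution Ω W) (hVW : ∀ x ∈ Ω, V x ≤ W x)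
    (hu : IsConstrainedMinimizer Ω V W u G) (hB : IsOpen B) (hBΩ : B ⊆ Ω)
    (hLV : LipschitzOnWith Λ V B) (hLW : LipschitzOnWith Λ W B) (hlt : ∀ x ∈ B, -1 < V x) :
    OnePhase Ω B (fun x => - W x) (fun x => - V x) (fun x => - u x) (fun x => - G x) Λ where
  bounded := hΩ.isBounded
  minimizer := hu.neg
  isOpen := hB
  subset := hBΩ
  lipschitz_V := hLW.neg
  lipschitz_W := hLV.neg
  neg_one_le x hx := neg_le_neg (hW.mem_Icc x (hBΩ hx)).2
  lt_one x hx := by linarith [hlt x hx]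
  smooth_V x hx h := by
    obtain ⟨g, hg, -⟩ := hW.gradient
    have hin : x ∈ innerPhase Ω W :=
      ⟨hBΩ hx, abs_lt.2 ⟨(hlt x hx).trans_le (hVW x (hBΩ hx)), by linarith⟩⟩
    refine ⟨(contDiffAt_of_isC2Extension hΩ.isOpen hW.continuousOn hg hin).neg, ?_⟩
    have h1 : Δ (fun x => - W x) x = - Δ W x := congrFun (laplacian_neg (f := W)) x
    rw [h1]
    linarith [hW.laplacian_nonpos x hin]
  smooth_W x hx h := by
    obtain ⟨g, hg, -⟩ := hV.gradient
    have hin : x ∈ innerPhase Ω V := ⟨hBΩ hx, abs_lt.2 ⟨hlt x hx, by linarith⟩⟩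
    refine ⟨(contDiffAt_of_isC2Extension hΩ.isOpen hV.continuousOn hg hin).neg, ?_⟩
    have h1 : Δ (fun x => - V x) x = - Δ V x := congrFun (laplacian_neg (f := V)) x
    rw [h1]
    linarith [hV.laplacian_nonneg x hin]

theorem OnePhase.value_neg (h : OnePhase Ω B V W u G Λ) {x : Space m} (hx : x ∈ B) :
    k.value Ω (fun y => - u y) x = - k.value Ω u x := by
  obtain ⟨r, hr, hball⟩ := Metric.nhds_basis_closedBall.mem_iff.1 (h.isOpen.mem_nhds hx)
  have h1 := (h.tendsto_avg k hr hball).neg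
  have h2 : k.avg Ω (fun y => - u y) x = fun r => - k.avg Ω u x r := by
    ext r
    simp only [RadialKernel.avg, neg_mul, integral_neg]
  rw [← h2] at h1
  exact h1.limUnder_eq

/-- The Lipschitz estimate at a scale that depends only on `δ` and `L`. -/
theorem exists_lipschitz_value_of_controlledBy (hδ : 0 < δ) (hL : 0 < L) (Λ : ℝ≥0) :
    ∃ K > 0, ∃ ρ > 0, ∀ {Ω D' D : Set (Space m)} {V W u : Space m → ℝ} {G : Space m → Space m}
      {x x' : Space m}, IsCylinder Ω → closure D ⊆ D' → closure D' ⊆ Ω →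
      IsClassicalSubsolution Ω V → IsClassicalSupersolution Ω W → (∀ x ∈ Ω, V x ≤ W x) →
      NicelyIntertwined Ω V W → IsConstrainedMinimizer Ω V W u G →
      ControlledBy Ω D' D V W δ L Λ → x ∈ D → dist x x' < ρ →
      |k.value Ω u x - k.value Ω u x'| ≤ K * dist x x' := by
  -- balls of radius `δ` about points of `D` lie in `D'`; those of diameter at most `L` meet at most
  -- one of the two phases
  set R := min δ (L / 2)
  have hR : 0 < R := lt_min hδ (by linarith)
  obtain ⟨K₁, hK₁, h₁⟩ := OnePhase.exists_lipschitz_value k hR Λ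
  obtain ⟨K₂, hK₂, h₂⟩ := exists_lipschitz_value_of_grad_eq_zero k hR
  refine ⟨max K₁ K₂, lt_max_of_lt_left hK₁, R / 64, by positivity,
    fun {Ω D' D V W u G x x'} hΩ hDD' hD'Ω hV hW hVW hN hu hc hx hxx => ?_⟩
  have hball : Metric.ball x R ⊆ D' :=
    (Metric.ball_subset_ball (min_le_left _ _)).trans
      (ball_subset_of_le_dist_frontier hDD' hc.dist_le hx)
  have hD'Ω' : D' ⊆ Ω := subset_closure.trans hD'Ω
  have hxR : x ∈ Metric.ball x (R / 64) := Metric.mem_ball_self (by positivity)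
  have hxR' : x' ∈ Metric.ball x (R / 64) := Metric.mem_ball'.2 hxx
  have hK1 : K₁ * dist x x' ≤ max K₁ K₂ * dist x x' :=
    mul_le_mul_of_nonneg_right (le_max_left _ _) dist_nonneg
  have hK2 : K₂ * dist x x' ≤ max K₁ K₂ * dist x x' :=
    mul_le_mul_of_nonneg_right (le_max_right _ _) dist_nonneg
  rcases forall_or_forall_not hΩ.isOpen hΩ.convex hV.continuousOn hW.continuousOn hN with hd | hnd
  · refine (h₂ hu.1.1 hΩ.isBounded (hu.ae_grad_eq_zero hΩ.isOpen.measurableSet hΩ.isBounded hd)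
      ?_ (hball.trans hD'Ω') hxR hxR').trans hK2
    filter_upwards [hu.1.2, ae_restrict_mem hΩ.isOpen.measurableSet] with y hy hyΩ
    rwa [(hd y hyΩ).1, (hd y hyΩ).2] at hy
  · rcases forall_lt_one_or_forall_neg_one_lt hD'Ω' hV hW hN hc hnd
      (by linarith [min_le_right δ (L / 2)]) hball with hlt | hlt
    · exact (h₁ (onePhase_of_lt_one hΩ hV hW hVW hu Metric.isOpen_ball (hball.trans hD'Ω')
        (hc.lipschitz_V.mono hball) (hc.lipschitz_W.mono hball) hlt) hΩ.isOpen hxR hxR').trans hK1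
    · have h := onePhase_neg_of_neg_one_lt hΩ hV hW hVW hu Metric.isOpen_ball (hball.trans hD'Ω')
        (hc.lipschitz_V.mono hball) (hc.lipschitz_W.mono hball) hlt
      have hsub : Metric.ball x (R / 64) ⊆ Metric.ball x R := Metric.ball_subset_ball (by linarith)
      have h3 := h₁ h hΩ.isOpen hxR hxR'
      have h4 := h.value_neg k (hsub hxR)
      have h5 := h.value_neg k (hsub hxR')
      simp only [neg_neg] at h4 h5
      rw [h4, h5, neg_sub_neg, abs_sub_comm]
      exact h3.trans hK1

/-- The estimate of the gradient and the Lipschitz representative, with a constant chosen before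
the domains and the functions. -/
theorem exists_gradient_bound (m : ℕ) (δ L : ℝ) (Λ : ℝ≥0) : ∃ K : ℝ≥0, ∀ {Ω D' D : Set (Space m)}
      {V W u : Space m → ℝ} {G : Space m → Space m}, IsCylinder Ω → IsCylinder D →
      closure D ⊆ D' → closure D' ⊆ Ω →
      IsClassicalSubsolution Ω V → IsClassicalSupersolution Ω W → (∀ x ∈ Ω, V x ≤ W x) →
      NicelyIntertwined Ω V W → IsConstrainedMinimizer Ω V W u G →
      ControlledBy Ω D' D V W δ L Λ →
      (∀ᵐ x ∂(volume.restrict D), ‖G x‖ ≤ K) ∧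
        ∃ u' : Space m → ℝ, LipschitzOnWith K u' D ∧ u =ᵐ[volume.restrict D] u' := by
  by_cases hpos : 0 < δ ∧ 0 < L
  swap
  -- without positivity there is no configuration with these parameters
  · exact ⟨0, fun {Ω D' D V W u G} _ _ _ _ _ _ _ _ _ hc =>
      absurd ⟨hc.dist_pos, hc.separation_pos⟩ hpos⟩
  obtain ⟨k⟩ := nonempty_radialKernel m
  obtain ⟨K, hK, ρ, hρ, hlip⟩ := exists_lipschitz_value_of_controlledBy k hpos.1 hpos.2 Λ
  have hK' : 0 ≤ max K (2 / ρ) := hK.le.trans (le_max_left _ _)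
  -- at distances of at least `ρ` the bound `|u| ≤ 1` is enough
  refine ⟨⟨max K (2 / ρ), hK'⟩,
    fun {Ω D' D V W u G} hΩ hD hDD' hD'Ω hV hW hVW hN hu hc => ?_⟩
  have hDΩ : D ⊆ Ω := subset_closure.trans (hDD'.trans (subset_closure.trans hD'Ω))
  have := isFiniteMeasure_restrict_of_isBounded hΩ.isBounded
  set E := {x | x ∈ D ∧ u x = k.value Ω u x ∧ -1 ≤ u x ∧ u x ≤ 1} with hE
  have hfull : ∀ᵐ x ∂(volume.restrict D), x ∈ E := by
    have h1 := ae_restrict_of_ae_restrict_of_subset hDΩ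
      (k.ae_eq_value hΩ.isOpen (hu.1.1.memLp.integrable one_le_two))
    have h2 := ae_restrict_of_ae_restrict_of_subset hDΩ hu.1.2
    filter_upwards [h1, h2, ae_restrict_mem hD.isOpen.measurableSet] with x hx1 hx2 hxD
    exact ⟨hxD, hx1, (hV.mem_Icc x (hDΩ hxD)).1.trans hx2.1,
      hx2.2.trans (hW.mem_Icc x (hDΩ hxD)).2⟩
  have hlipE : LipschitzOnWith ⟨max K (2 / ρ), hK'⟩ u E := by
    refine LipschitzOnWith.of_dist_le_mul fun x hx x' hx' => ?_
    change dist (u x) (u x') ≤ max K (2 / ρ) * dist x x'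
    rw [Real.dist_eq]
    rcases lt_or_ge (dist x x') ρ with hs | hs
    · rw [hx.2.1, hx'.2.1]
      exact (hlip hΩ hDD' hD'Ω hV hW hVW hN hu hc hx.1 hs).trans
        (mul_le_mul_of_nonneg_right (le_max_left _ _) dist_nonneg)
    · calc |u x - u x'| ≤ 2 := by
            rw [abs_le]
            constructor <;> linarith [hx.2.2.1, hx.2.2.2, hx'.2.2.1, hx'.2.2.2]
        _ = 2 / ρ * ρ := by field_simp
        _ ≤ max K (2 / ρ) * dist x x' :=
          mul_le_mul (le_max_right _ _) hs hρ.le hK'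
  obtain ⟨u', hu', heq⟩ := hlipE.extend_real
  have hae : u =ᵐ[volume.restrict D] u' := hfull.mono fun x hx => heq hx
  exact ⟨(hu.1.1.mono hΩ.isOpen.measurableSet hDΩ).ae_norm_le hD.isOpen hD.isBounded hu' hae,
    u', hu'.lipschitzOnWith, hae⟩

end Conclusion

end TwoPhase

theorem mainTheorem9 (m : ℕ) :
    ∃ K : ℝ → ℝ → ℝ≥0 → ℝ≥0,
      ∀ Ω D' D : Set (TwoPhase.Space m),
        TwoPhase.IsCylinder Ω → TwoPhase.IsCylinder D' → TwoPhase.IsCylinder D →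
        closure D ⊆ D' → closure D' ⊆ Ω →
      ∀ V W : TwoPhase.Space m → ℝ,
        TwoPhase.IsClassicalSubsolution Ω V → TwoPhase.IsClassicalSupersolution Ω W →
        (∀ x ∈ Ω, V x ≤ W x) → TwoPhase.NicelyIntertwined Ω V W →
      ∀ (u : TwoPhase.Space m → ℝ) (G : TwoPhase.Space m → TwoPhase.Space m),
        TwoPhase.IsConstrainedMinimizer Ω V W u G →
        (∃ (δ L : ℝ) (Λ : ℝ≥0), TwoPhase.ControlledBy Ω D' D V W δ L Λ) ∧
        ∀ (δ L : ℝ) (Λ : ℝ≥0), TwoPhase.ControlledBy Ω D' D V W δ L Λ →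
          (∀ᵐ x ∂(volume.restrict D), ‖G x‖ ≤ K δ L Λ) ∧
          ∃ u' : TwoPhase.Space m → ℝ,
            LipschitzOnWith (K δ L Λ) u' D ∧ u =ᵐ[volume.restrict D] u' := by
  choose K hK using TwoPhase.exists_gradient_bound m
  exact ⟨K, fun Ω D' D hΩ hD' hD hDD' hD'Ω V W hV hW hVW hN u G hu =>
    ⟨TwoPhase.exists_controlledBy hΩ hD' hD hDD' hD'Ω hV hW hN,
      fun δ L Λ hc => hK δ L Λ hΩ hD hDD' hD'Ω hV hW hVW hN hu hc⟩⟩
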